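/- **Proposition (wave-function lifting in 2D).** There is a function $C:[0,\infty)^2\to[0,\infty)$ with the following property. Let $M_1\ge 0$, let $\sqrt\rho\in H^1(\mathbf R^2)$ be a non-negative continuous function and let $\Lambda\in L^2(\mathbf R^2;\mathbf R^2)$, with $$\|\sqrt\rho\|_{H^1(\mathbf R^2)}+\|\Lambda\|_{L^2(\mathbf R^2)}\le M_1 .$$ Put $\rho=(\sqrt\rho)^2$, $J=\sqrt\rho\,\Lambda$, and assume: (i) (isolated point vacuum) there is $\alpha>0$ such that any two distinct points of $V=\{x:\rho(x)=0\}$ have distance at least $\alpha$; (ii) (quantised vorticity) the velocity field $v=J/\rho$, which is defined and locally integrable on $\mathbf R^2\setminus V$, is a distribution $v\in D'(\mathbf R^2;\mathbf R^2)$ (that is, some $v\in D'(\mathbf R^2;\mathbf R^2)$ coincides with the function $J/\rho$ on $\mathbf R^2\setminus V$; for instance $J/\rho\in L^1_{loc}(\mathbf R^2)$), and there are integers $k_x$, $x\in V$, with $$\nabla\wedge v=\partial_{x_1}v_2-\partial_{x_2}v_1=2\pi\sum_{x\in V}k_x\delta_x\quad\text{in } D'(\mathbf R^2).$$ Then there is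 $\psi\in H^1(\mathbf R^2;\mathbf C)$ such that, almost everywhere, $$|\psi|=\sqrt\rho,\qquad \Lambda=\operatorname{Im}(\bar\phi\,\nabla\psi)$$ for some polar factor $\phi$ of $\psi$, i.e. some $\phi\in L^\infty(\mathbf R^2;\mathbf C)$ with $\|\phi\|_{L^\infty}\le1$ and $|\psi|\phi=\psi$ a.e. Moreover, if $\triangle\rho\in L^1_{loc}(\mathbf R^2)$ and, for some $M_2\ge0$, $$\Big\|\frac{\Lambda_j^2}{\sqrt\rho}-\partial_{x_j}^2\sqrt\rho\Big\|_{L^2(\mathbf R^2)}+\Big\|\frac{\partial_{x_j}J_j}{\sqrt\rho}\Big\|_{L^2(\mathbf R^2)}\le M_2,\qquad j=1,2,$$ where $\partial_{x_j}^2\sqrt\rho$ and $\partial_{x_j}J_j$ are weak derivatives on $\mathbf R^2\setminus V$ that are locally integrable functions there, then this same $\psi$ belongs to $H^2(\mathbf R^2)$ and $$\|\psi\|_{H^2(\mathbf R^2)}\le C(M_1,M_2).$$ Here $\|f\|_{H^k}=\sum_{i=0}^k\|\nabla^i f\|_{L^2}$. -/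

import Mathlib

open MeasureTheory
open scoped ENNReal NNReal ContDiff

/-- The Euclidean plane. -/
abbrev Plane : Type := EuclideanSpace ℝ (Fin 2)

/-- The standard basis vector `e i` of the plane. -/
noncomputable def Plane.e (i : Fin 2) : Plane := EuclideanSpace.single i (1 : ℝ)

/-- `g` is the weak partial derivative `∂ᵢ f` on the (open) set `Ω`: both functions are locally
integrable on `Ω` and `∫ (∂ᵢ η) f = - ∫ η g` for all `η ∈ C_c^∞(Ω)`. -/
structure HasWeakPartial {𝕜 : Type*} [RCLike 𝕜] (Ω : Set Plane) (i : Fin 2)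
    (f g : Plane → 𝕜) : Prop where
  locallyIntegrableOn : LocallyIntegrableOn f Ω volume
  locallyIntegrableOn_deriv : LocallyIntegrableOn g Ω volume
  integral_eq : ∀ η : Plane → ℝ, ContDiff ℝ ∞ η → HasCompactSupport η → tsupport η ⊆ Ω →
    ∫ x, (fderiv ℝ η x (Plane.e i)) • f x = - ∫ x, η x • g x

/-- `f ∈ H¹(ℝ²)` with weak gradient `Df`. -/
structure IsH1 {𝕜 : Type*} [RCLike 𝕜] (f : Plane → 𝕜)
    (Df : Plane → EuclideanSpace 𝕜 (Fin 2)) : Prop where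
  memLp : MemLp f 2 volume
  memLp_grad : MemLp Df 2 volume
  hasWeakPartial : ∀ i, HasWeakPartial Set.univ i f (fun x => Df x i)

/-- `f ∈ H²(ℝ²)` with weak gradient `Df` and weak Hessian `D2f`; the entry `(i, j)` is
`∂ᵢ ∂ⱼ f`, and the pointwise norm of the Hessian is the Frobenius norm. -/
structure IsH2 {𝕜 : Type*} [RCLike 𝕜] (f : Plane → 𝕜)
    (Df : Plane → EuclideanSpace 𝕜 (Fin 2))
    (D2f : Plane → EuclideanSpace 𝕜 (Fin 2 × Fin 2)) : Prop where
  isH1 : IsH1 f Df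
  memLp_hess : MemLp D2f 2 volume
  hasWeakPartial : ∀ i j,
    HasWeakPartial Set.univ i (fun x => Df x j) (fun x => D2f x (i, j))

/-- The norm `‖f‖_{L²} + ‖∇f‖_{L²}` of `H¹(ℝ²)`, where `Df = ∇f`. -/
noncomputable def normH1 {𝕜 : Type*} [RCLike 𝕜] (f : Plane → 𝕜)
    (Df : Plane → EuclideanSpace 𝕜 (Fin 2)) : ℝ≥0∞ :=
  eLpNorm f 2 volume + eLpNorm Df 2 volume

/-- The norm `‖f‖_{L²} + ‖∇f‖_{L²} + ‖∇²f‖_{L²}` of `H²(ℝ²)`, where `Df = ∇f`, `D2f = ∇²f`. -/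
noncomputable def normH2 {𝕜 : Type*} [RCLike 𝕜] (f : Plane → 𝕜)
    (Df : Plane → EuclideanSpace 𝕜 (Fin 2))
    (D2f : Plane → EuclideanSpace 𝕜 (Fin 2 × Fin 2)) : ℝ≥0∞ :=
  eLpNorm f 2 volume + eLpNorm Df 2 volume + eLpNorm D2f 2 volume

/-- The set `P(ψ)` of polar factors of `ψ`: `‖φ‖_{L^∞} ≤ 1` and `|ψ| φ = ψ` a.e. -/
def polarFactors (ψ : Plane → ℂ) : Set (Plane → ℂ) :=
  {φ | MemLp φ ∞ volume ∧ eLpNorm φ ∞ volume ≤ 1 ∧ ∀ᵐ x, (‖ψ x‖ : ℂ) * φ x = ψ x}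

section Hydrodynamics

/-! The hydrodynamic data are `r = √ρ` and `Λ`, with `ρ = r²` and `J = r Λ`. -/

/-- The vacuum `V = {ρ = 0}`. -/
def vacuum (r : Plane → ℝ) : Set Plane := {x | r x = 0}

/-- The momentum density `J = √ρ Λ`. -/
noncomputable def momentum (r : Plane → ℝ) (Λ : Plane → Plane) (x : Plane) : Plane :=
  r x • Λ x

/-- The velocity `v = J / ρ`, meaningful outside the vacuum. -/
noncomputable def velocity (r : Plane → ℝ) (Λ : Plane → Plane) (x : Plane) : Plane :=
  (r x ^ 2)⁻¹ • momentum r Λ x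

/-- Distinct vacuum points have a uniformly positive mutual distance. -/
def HasSeparatedPointVacuum (r : Plane → ℝ) : Prop :=
  ∃ α : ℝ, 0 < α ∧ ∀ x ∈ vacuum r, ∀ y ∈ vacuum r, x ≠ y → α ≤ dist x y

open scoped Distributions LineDeriv in
/-- Quantised vorticity. The velocity field is a vector-valued distribution `v ∈ D'(ℝ²)`, given by
the function `J / ρ` off the vacuum (where that function is locally integrable), and
`∂₁ v₂ - ∂₂ v₁ = 2π ∑_{x ∈ V} k_x δ_x` in `D'(ℝ²)` with integers `k_x`. If `J / ρ` is locally
integrable on the whole plane, the distribution defined by it is such a `v`. The sum over `V`,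
evaluated at a test function, has finitely many non-zero terms when `V` is separated. -/
def HasQuantisedVorticity (r : Plane → ℝ) (Λ : Plane → Plane) : Prop :=
  ∃ v : 𝓓'((⊤ : TopologicalSpace.Opens Plane), Plane),
    (∀ η : 𝓓((⊤ : TopologicalSpace.Opens Plane), ℝ), Disjoint (tsupport η) (vacuum r) →
      v η = ∫ x, η x • velocity r Λ x) ∧
    ∃ k : vacuum r → ℤ, ∀ η : 𝓓((⊤ : TopologicalSpace.Opens Plane), ℝ),
      (∂_{Plane.e 0} v) η 1 - (∂_{Plane.e 1} v) η 0 =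
        2 * Real.pi * ∑ᶠ x : vacuum r, (k x : ℝ) * η x

/-- The higher order condition: `Δρ ∈ L¹_loc(ℝ²)` (in the sense of distributions), and for
`j = 1, 2`
`‖Λⱼ² / √ρ - ∂ⱼ² √ρ‖_{L²} + ‖∂ⱼ Jⱼ / √ρ‖_{L²} ≤ M₂`,
the derivatives `d = ∂ⱼ² √ρ` and `m = ∂ⱼ Jⱼ` being weak derivatives off the vacuum, hence defined
almost everywhere when the vacuum is separated. Here `Dr = ∇√ρ`. -/
structure HasHigherOrderBound (r : Plane → ℝ) (Dr Λ : Plane → Plane) (M₂ : ℝ≥0) : Prop where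
  laplacian : ∃ L : Plane → ℝ, LocallyIntegrable L volume ∧
    ∀ η : Plane → ℝ, ContDiff ℝ ∞ η → HasCompactSupport η →
      ∫ x, Laplacian.laplacian η x * r x ^ 2 = ∫ x, η x * L x
  bound : ∀ j : Fin 2, ∃ d m : Plane → ℝ,
    HasWeakPartial (vacuum r)ᶜ j (fun x => Dr x j) d ∧
    HasWeakPartial (vacuum r)ᶜ j (fun x => momentum r Λ x j) m ∧
    eLpNorm (fun x => Λ x j ^ 2 / r x - d x) 2 volume
      + eLpNorm (fun x => m x / r x) 2 volume ≤ M₂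

end Hydrodynamics

/-! ### Charts, rectangles and test functions on the plane -/

open Set Filter Topology

/-! The wave function is ψ = √ρ · φ with φ = exp(iF), where F is a phase whose gradient off the
vacuum is v, up to jumps by multiples of 2π.

Phase. A sum of products of step functions gives an integer-valued N with ∂₀∂₁N = ∑ kₓδₓ
(`phaseCount`). Quantisation of the vorticity then says that (v₀ + 2π∂₀N, v₁) is curl-free on the
whole plane. Divergence-free pairs of test functions are rotated gradients, so this field is the
gradient of a linear functional T on test functions (`exists_potential`). On a rectangle without
vacuum points N splits into a function of x₀ plus a function of x₁. If A is the integer-valued part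
depending on x₀, then T - 2πA has gradient v there, hence is a function g, and T is the function g +
2πA, whose exponential is exp(ig) (`exists_density`, `exists_local_phase`). Since T is global, these
local functions agree almost everywhere on overlaps and glue to F
(`HasQuantisedVorticity.exists_phase`).

Calculus. Off the vacuum v is only locally integrable, so product and chain rules are carried out on
lines: weak differentiability amounts to absolute continuity on almost every line
(`HasWeakPartial.ae_hasACRep`, `HasWeakPartial.of_slices`). Vacuum points are removed with cutoffs
that depend on the transverse coordinate alone, so that the derivative never falls on them
(`HasWeakPartial.of_compl`). As √ρ v = Λ off the vacuum, this yields ∇ψ = (∇√ρ + iΛ)φ on the plane,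
and φ is the required polar factor.

Second derivatives. Differentiating ∂ⱼψ once more in the same direction, the terms in ∂ⱼ√ρ · vⱼ
cancel, leaving ∂ⱼ²ψ = (-(Λⱼ²/√ρ - ∂ⱼ²√ρ) + i ∂ⱼJⱼ/√ρ)φ, which M₂ controls. The mixed derivative
follows from Plancherel and |ξ₀ξ₁| ≤ ξ₀² + ξ₁² (`exists_mixed_weakPartial`). The resulting constant
is C = M₁ + 6M₂. -/

/-- `η` is a test function supported in `Ω`. -/
structure IsTest (Ω : Set Plane) (η : Plane → ℝ) : Prop where
  contDiff : ContDiff ℝ ∞ η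
  hasCompactSupport : HasCompactSupport η
  tsupport_subset : tsupport η ⊆ Ω

namespace Plane

/-- Coordinates of the plane adapted to the direction `i`: the point whose `i`-th coordinate is
`p.2` and whose other coordinate is `p.1`. -/
noncomputable def chart (i : Fin 2) : (ℝ × ℝ) ≃L[ℝ] Plane :=
  LinearEquiv.toContinuousLinearEquiv
    { toFun := fun p => WithLp.toLp 2 (fun k => if k = i then p.2 else p.1)
      invFun := fun x => (x (i + 1), x i)
      map_add' := fun p q => by
        ext k
        by_cases h : k = i <;> simp [h]
      map_smul' := fun c p => by
        ext k
        by_cases h : k = i <;> simp [h]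
      left_inv := fun p => by
        have : i + 1 ≠ i := by fin_cases i <;> simp
        simp [this]
      right_inv := fun x => by
        ext k
        by_cases h : k = i
        · simp [h]
        · have : k = i + 1 := by revert h; fin_cases i <;> fin_cases k <;> simp
          simp [this] }

theorem chart_apply (i : Fin 2) (p : ℝ × ℝ) (k : Fin 2) :
    chart i p k = if k = i then p.2 else p.1 := rfl

@[simp]
theorem chart_apply_self (i : Fin 2) (p : ℝ × ℝ) : chart i p i = p.2 := by simp [chart_apply]

@[simp]
theorem chart_apply_add_one (i : Fin 2) (p : ℝ × ℝ) : chart i p (i + 1) = p.1 := by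
  have : i + 1 ≠ i := by fin_cases i <;> simp
  simp [chart_apply]

@[simp]
theorem chart_coords (i : Fin 2) (x : Plane) : chart i (x (i + 1), x i) = x :=
  (chart i).apply_symm_apply x

theorem chart_zero_one (i : Fin 2) : chart i (0, 1) = e i := by
  ext k
  by_cases h : k = i <;> simp [chart_apply, e, h]

theorem chart_mk_eq (i : Fin 2) (s t : ℝ) : chart i (s, t) = chart i (s, 0) + t • e i := by
  rw [← chart_zero_one, ← map_smul, ← map_add]
  simp

theorem measurePreserving_chart (i : Fin 2) : MeasurePreserving (chart i) volume volume := by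
  have h1 : MeasurePreserving
      (fun p : ℝ × ℝ => WithLp.toLp 2 ((MeasurableEquiv.finTwoArrow (α := ℝ)).symm p) :
        ℝ × ℝ → Plane) volume volume :=
    (PiLp.volume_preserving_toLp (Fin 2)).comp (volume_preserving_finTwoArrow ℝ).symm
  fin_cases i
  · have h2 : MeasurePreserving (Prod.swap : ℝ × ℝ → ℝ × ℝ) volume volume :=
      Measure.measurePreserving_swap
    convert h1.comp h2 using 1
    ext p k
    fin_cases k <;> simp [chart_apply, MeasurableEquiv.finTwoArrow]
  · convert h1 using 1
    ext p k
    fin_cases k <;> simp [chart_apply, MeasurableEquiv.finTwoArrow]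

theorem measurableEmbedding_chart (i : Fin 2) : MeasurableEmbedding (chart i) :=
  (chart i).toHomeomorph.measurableEmbedding

theorem integral_chart {F : Type*} [NormedAddCommGroup F] [NormedSpace ℝ F] (i : Fin 2)
    (f : Plane → F) : ∫ p, f (chart i p) = ∫ x, f x :=
  (measurePreserving_chart i).integral_comp (measurableEmbedding_chart i) f

theorem integrable_chart {F : Type*} [NormedAddCommGroup F] (i : Fin 2) {f : Plane → F} :
    Integrable (fun p => f (chart i p)) ↔ Integrable f :=
  (measurePreserving_chart i).integrable_comp_emb (measurableEmbedding_chart i)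

theorem hasDerivAt_chart (i : Fin 2) (s t : ℝ) :
    HasDerivAt (fun t => chart i (s, t)) (e i) t := by
  have : (fun t => chart i (s, t)) = fun t => chart i (s, 0) + t • e i :=
    funext fun t => chart_mk_eq i s t
  rw [this]
  simpa using ((hasDerivAt_id t).smul_const (e i)).const_add (chart i (s, 0))

theorem hasDerivAt_comp_chart {η : Plane → ℝ} (hη : Differentiable ℝ η) (i : Fin 2) (s t : ℝ) :
    HasDerivAt (fun t => η (chart i (s, t))) (fderiv ℝ η (chart i (s, t)) (e i)) t :=
  ((hη _).hasFDerivAt).comp_hasDerivAt t (hasDerivAt_chart i s t)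

theorem continuous_apply (i : Fin 2) : Continuous fun x : Plane => x i := by fun_prop

/-- The open coordinate rectangle with corners `a` and `b`. -/
def box (a b : Fin 2 → ℝ) : Set Plane := {x | ∀ i, x i ∈ Ioo (a i) (b i)}

/-- The closed coordinate rectangle with corners `a` and `b`. -/
def closedBox (a b : Fin 2 → ℝ) : Set Plane := {x | ∀ i, x i ∈ Icc (a i) (b i)}

theorem isOpen_box (a b : Fin 2 → ℝ) : IsOpen (box a b) := by
  simp only [box, ofPred_forall]
  exact isOpen_iInter_of_finite fun i => isOpen_Ioo.preimage (continuous_apply i)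

theorem isClosed_closedBox (a b : Fin 2 → ℝ) : IsClosed (closedBox a b) := by
  simp only [closedBox, ofPred_forall]
  exact isClosed_iInter fun i => isClosed_Icc.preimage (continuous_apply i)

theorem box_subset_closedBox (a b : Fin 2 → ℝ) : box a b ⊆ closedBox a b :=
  fun _ hx i => Ioo_subset_Icc_self (hx i)

theorem chart_mem_box {i : Fin 2} {a b : Fin 2 → ℝ} {p : ℝ × ℝ} :
    chart i p ∈ box a b ↔ p.1 ∈ Ioo (a (i + 1)) (b (i + 1)) ∧ p.2 ∈ Ioo (a i) (b i) := by
  constructor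
  · intro h
    exact ⟨by simpa using h (i + 1), by simpa using h i⟩
  · rintro ⟨h1, h2⟩ k
    by_cases hk : k = i
    · subst hk; simpa using h2
    · have : k = i + 1 := by revert hk; fin_cases i <;> fin_cases k <;> simp
      subst this; simpa using h1

theorem chart_mem_closedBox {i : Fin 2} {a b : Fin 2 → ℝ} {p : ℝ × ℝ} :
    chart i p ∈ closedBox a b ↔ p.1 ∈ Icc (a (i + 1)) (b (i + 1)) ∧ p.2 ∈ Icc (a i) (b i) := by
  constructor
  · intro h
    exact ⟨by simpa using h (i + 1), by simpa using h i⟩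
  · rintro ⟨h1, h2⟩ k
    by_cases hk : k = i
    · subst hk; simpa using h2
    · have : k = i + 1 := by revert hk; fin_cases i <;> fin_cases k <;> simp
      subst this; simpa using h1

theorem isCompact_closedBox (a b : Fin 2 → ℝ) : IsCompact (closedBox a b) := by
  have : closedBox a b = chart 1 '' (Icc (a 0) (b 0) ×ˢ Icc (a 1) (b 1)) := by
    ext x
    constructor
    · intro hx
      exact ⟨(x 0, x 1), ⟨hx 0, hx 1⟩, chart_coords 1 x⟩
    · rintro ⟨p, hp, rfl⟩
      exact chart_mem_closedBox.2 hp
  rw [this]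
  exact (isCompact_Icc.prod isCompact_Icc).image (chart 1).continuous

theorem exists_closedBox_subset {Ω : Set Plane} (hΩ : IsOpen Ω) {x : Plane} (hx : x ∈ Ω) :
    ∃ a b : Fin 2 → ℝ, (∀ i, a i < b i) ∧ x ∈ box a b ∧ closedBox a b ⊆ Ω := by
  obtain ⟨ε, hε, hsub⟩ := Metric.isOpen_iff.1 hΩ x hx
  refine ⟨fun i => x i - ε / 3, fun i => x i + ε / 3, fun i => by linarith,
    fun i => ⟨by linarith, by linarith⟩, fun y hy => hsub ?_⟩
  have h : ∀ i, (y i - x i) ^ 2 ≤ (ε / 3) ^ 2 := fun i => by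
    have := hy i
    apply sq_le_sq'  <;> linarith [this.1, this.2]
  rw [Metric.mem_ball, EuclideanSpace.dist_eq, Fin.sum_univ_two]
  rw [Real.sqrt_lt' hε]
  simp only [Real.dist_eq, sq_abs]
  nlinarith [h 0, h 1]

theorem exists_box_supset {K : Set Plane} (hK : IsCompact K) :
    ∃ M : ℝ, 0 < M ∧ K ⊆ box (fun _ => -M) (fun _ => M) := by
  obtain ⟨M, hM, hsub⟩ := hK.isBounded.subset_closedBall_lt 0 0
  refine ⟨M + 1, by linarith, fun x hx i => ?_⟩
  have h1 : ‖x‖ ≤ M := by simpa using hsub hx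
  have h2 : |x i| ≤ ‖x‖ := by simpa using PiLp.norm_apply_le x i
  constructor <;> linarith [abs_le.1 (h2.trans h1)]

end Plane

/-! ### Smooth dependence of integrals on a parameter. -/

section ParametricIntegral

variable {E : Type} [NormedAddCommGroup E] [NormedSpace ℝ E] [ProperSpace E]

/-- Differentiation under the integral: the derivative of `F` is bounded on the unit ball around
`x₀` times the interval, a compact set because `E` is proper. -/
theorem hasFDerivAt_intervalIntegral_of_contDiff {G : Type} [NormedAddCommGroup G]
    [NormedSpace ℝ G] {F : E × ℝ → G} (hF : ContDiff ℝ 1 F) (a b : ℝ) (x₀ : E) :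
    HasFDerivAt (fun x => ∫ t in a..b, F (x, t))
      (∫ t in a..b, (fderiv ℝ F (x₀, t)).comp (ContinuousLinearMap.inl ℝ E ℝ)) x₀ := by
  have hc : Continuous fun p : E × ℝ =>
      (fderiv ℝ F p).comp (ContinuousLinearMap.inl ℝ E ℝ) :=
    (hF.continuous_fderiv (by norm_num)).clm_comp continuous_const
  obtain ⟨C, hC⟩ := ((isCompact_closedBall x₀ 1).prod (isCompact_uIcc (a := a) (b := b))
    ).exists_bound_of_continuousOn hc.continuousOn
  refine (intervalIntegral.hasFDerivAt_integral_of_dominated_of_fderiv_le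
    (F' := fun x t => (fderiv ℝ F (x, t)).comp (ContinuousLinearMap.inl ℝ E ℝ))
    (bound := fun _ => C) (Metric.closedBall_mem_nhds x₀ one_pos) ?_ ?_ ?_ ?_ ?_ ?_)
  · exact Eventually.of_forall fun x =>
      (hF.continuous.comp (Continuous.prodMk_right x)).aestronglyMeasurable
  · exact (hF.continuous.comp (Continuous.prodMk_right x₀)).intervalIntegrable _ _
  · exact (hc.comp (Continuous.prodMk_right x₀)).aestronglyMeasurable
  · exact Eventually.of_forall fun t ht x hx => hC (x, t) ⟨hx, uIoc_subset_uIcc ht⟩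
  · exact intervalIntegrable_const
  · refine Eventually.of_forall fun t ht x hx => ?_
    have h1 : HasFDerivAt F (fderiv ℝ F (x, t)) (x, t) :=
      (hF.differentiable (by norm_num) _).hasFDerivAt
    exact h1.comp x (hasFDerivAt_prodMk_left x t)

/-- The derivative in the parameter is again an integral of this kind, valued in a space of
continuous linear maps. Hence the induction lets `G` vary; with `E` and `G` in `Type` that space
stays in the same universe. -/
theorem ContDiff.intervalIntegral_param {n : ℕ} {G : Type} [NormedAddCommGroup G]
    [NormedSpace ℝ G] {F : E × ℝ → G} (hF : ContDiff ℝ ∞ F) (a b : ℝ) :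
    ContDiff ℝ n fun x => ∫ t in a..b, F (x, t) := by
  induction n generalizing G with
  | zero =>
    refine contDiff_zero.2 ?_
    have : Continuous (Function.uncurry fun x t => F (x, t)) := hF.continuous
    exact intervalIntegral.continuous_parametric_intervalIntegral_of_continuous' this a b
  | succ n ih =>
    refine (contDiff_succ_iff_hasFDerivAt (n := n)).2
      ⟨fun x => ∫ t in a..b, (fderiv ℝ F (x, t)).comp (ContinuousLinearMap.inl ℝ E ℝ), ?_,
        fun x => hasFDerivAt_intervalIntegral_of_contDiff (hF.of_le (by exact_mod_cast le_top)) a b x⟩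
    have key : ContDiff ℝ ∞ fun p : E × ℝ =>
        (fderiv ℝ F p).comp (ContinuousLinearMap.inl ℝ E ℝ) :=
      (hF.fderiv_right (m := ∞) (by simp)).clm_comp contDiff_const
    exact ih key

theorem ContDiff.intervalIntegral_param_infty {G : Type} [NormedAddCommGroup G]
    [NormedSpace ℝ G] {F : E × ℝ → G} (hF : ContDiff ℝ ∞ F) (a b : ℝ) :
    ContDiff ℝ ∞ fun x => ∫ t in a..b, F (x, t) :=
  contDiff_infty.2 fun _ => hF.intervalIntegral_param a b

end ParametricIntegral

theorem IsCompact.exists_Icc_of_subset_Ioo {K : Set ℝ} (hK : IsCompact K) {a b : ℝ}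
    (h : K ⊆ Ioo a b) : ∃ a' b', a < a' ∧ b' < b ∧ K ⊆ Icc a' b' := by
  rcases K.eq_empty_or_nonempty with rfl | hne
  · exact ⟨a + 1, b - 1, by linarith, by linarith, empty_subset _⟩
  · obtain ⟨x, hx, hx'⟩ := hK.exists_isLeast hne
    obtain ⟨y, hy, hy'⟩ := hK.exists_isGreatest hne
    exact ⟨x, y, (h hx).1, (h hy).2, fun z hz => ⟨hx' hz, hy' hz⟩⟩

/-! ### Test functions on rectangles: primitives and averages along lines. -/

namespace IsTest

open Plane

variable {Ω : Set Plane} {η : Plane → ℝ}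

theorem differentiable (h : IsTest Ω η) : Differentiable ℝ η :=
  h.contDiff.differentiable (by simp)

theorem continuous (h : IsTest Ω η) : Continuous η := h.contDiff.continuous

theorem mono {Ω' : Set Plane} (h : IsTest Ω η) (hΩ : Ω ⊆ Ω') : IsTest Ω' η :=
  ⟨h.contDiff, h.hasCompactSupport, h.tsupport_subset.trans hΩ⟩

theorem fderiv_apply (h : IsTest Ω η) (v : Plane) : IsTest Ω fun x => fderiv ℝ η x v where
  contDiff := (h.contDiff.fderiv_right (m := ∞) (by simp)).clm_apply contDiff_const
  hasCompactSupport := h.hasCompactSupport.fderiv_apply ℝ v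
  tsupport_subset := (tsupport_fderiv_apply_subset ℝ v).trans h.tsupport_subset

theorem mul_left {ζ : Plane → ℝ} (h : IsTest Ω η) (hζ : ContDiff ℝ ∞ ζ) :
    IsTest Ω fun x => ζ x * η x where
  contDiff := hζ.mul h.contDiff
  hasCompactSupport := h.hasCompactSupport.mul_left
  tsupport_subset := (closure_mono (Function.support_mul_subset_right ζ η)).trans h.tsupport_subset

theorem sub {ζ : Plane → ℝ} (h : IsTest Ω η) (hζ : IsTest Ω ζ) : IsTest Ω fun x => η x - ζ x where
  contDiff := h.contDiff.sub hζ.contDiff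
  hasCompactSupport := h.hasCompactSupport.sub hζ.hasCompactSupport
  tsupport_subset := by
    refine (closure_minimal ?_ ((isClosed_tsupport η).union (isClosed_tsupport ζ))).trans
      (union_subset h.tsupport_subset hζ.tsupport_subset)
    exact (Function.support_sub η ζ).trans (union_subset_union subset_closure subset_closure)

theorem eq_zero_of_notMem (h : IsTest Ω η) {x : Plane} (hx : x ∉ Ω) : η x = 0 :=
  image_eq_zero_of_notMem_tsupport fun h' => hx (h.tsupport_subset h')

theorem exists_closedBox {a b : Fin 2 → ℝ} (h : IsTest (box a b) η) :
    ∃ a' b' : Fin 2 → ℝ, (∀ i, a i < a' i) ∧ (∀ i, b' i < b i) ∧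
      ∀ x, x ∉ closedBox a' b' → η x = 0 := by
  have key : ∀ i : Fin 2, ∃ a' b', a i < a' ∧ b' < b i ∧
      (fun x : Plane => x i) '' tsupport η ⊆ Icc a' b' := fun i =>
    (h.hasCompactSupport.isCompact.image (Plane.continuous_apply i)).exists_Icc_of_subset_Ioo
      (by rintro _ ⟨x, hx, rfl⟩; exact h.tsupport_subset hx i)
  choose a' b' ha hb hsub using key
  refine ⟨a', b', ha, hb, fun x hx => image_eq_zero_of_notMem_tsupport fun hx' => hx fun i => ?_⟩
  exact hsub i ⟨x, hx', rfl⟩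

theorem of_closedBox {a b a' b' : Fin 2 → ℝ} (ha : ∀ i, a i < a' i) (hb : ∀ i, b' i < b i)
    (hη : ContDiff ℝ ∞ η) (h0 : ∀ x, x ∉ closedBox a' b' → η x = 0) : IsTest (box a b) η := by
  have hsub : tsupport η ⊆ closedBox a' b' :=
    closure_minimal (fun x hx => by_contra fun hx' => hx (h0 x hx')) (isClosed_closedBox a' b')
  refine ⟨hη, (isCompact_closedBox a' b').of_isClosed_subset (isClosed_tsupport η) hsub,
    hsub.trans fun x hx i => ⟨(ha i).trans_le (hx i).1, (hx i).2.trans_lt (hb i)⟩⟩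

/-- A test function with vanishing integrals along all lines in direction `i` is the `i`-th
partial derivative of a test function. -/
theorem exists_primitive {a b : Fin 2 → ℝ} (h : IsTest (box a b) η) (i : Fin 2)
    (h0 : ∀ s, ∫ t, η (chart i (s, t)) = 0) :
    ∃ E, IsTest (box a b) E ∧ ∀ x, fderiv ℝ E x (e i) = η x := by
  obtain ⟨a', b', ha, hb, hz⟩ := h.exists_closedBox
  have hz1 : ∀ s t, s ∉ Icc (a' (i + 1)) (b' (i + 1)) → η (chart i (s, t)) = 0 := fun s t hs =>
    hz _ fun hc => hs (chart_mem_closedBox.1 hc).1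
  have hz2 : ∀ s t, t ∉ Icc (a' i) (b' i) → η (chart i (s, t)) = 0 := fun s t hs =>
    hz _ fun hc => hs (chart_mem_closedBox.1 hc).2
  set E : Plane → ℝ := fun x => ∫ t in (a i)..(x i), η (chart i (x (i + 1), t)) with hE
  -- Rescaling to the fixed interval [0, 1] moves the variable endpoint into the integrand, so that
  -- smoothness follows from the parametric integral.
  have hE' : E = fun x => (x i - a i) *
      ∫ σ in (0 : ℝ)..1, η (chart i (x (i + 1), a i + (x i - a i) * σ)) := by
    ext x
    have := intervalIntegral.smul_integral_comp_add_mul (a := 0) (b := 1)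
      (fun t => η (chart i (x (i + 1), t))) (x i - a i) (a i)
    simp only [smul_eq_mul, mul_zero, add_zero, mul_one, add_sub_cancel] at this
    exact this.symm
  have hEs : ContDiff ℝ ∞ E := by
    rw [hE']
    refine ContDiff.mul (by fun_prop) ?_
    have : ContDiff ℝ ∞ fun q : Plane × ℝ =>
        η (chart i (q.1 (i + 1), a i + (q.1 i - a i) * q.2)) := by
      refine h.contDiff.comp ((chart i).contDiff.comp ?_)
      fun_prop
    exact this.intervalIntegral_param_infty 0 1
  refine ⟨E, of_closedBox ha hb hEs fun x hx => ?_, fun x => ?_⟩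
  · by_cases h1 : x (i + 1) ∈ Icc (a' (i + 1)) (b' (i + 1))
    · have h2 : x i ∉ Icc (a' i) (b' i) := fun h2 => hx <| by
        have := chart_mem_closedBox.2 (show (x (i + 1), x i).1 ∈ _ ∧ (x (i + 1), x i).2 ∈ _ from
          ⟨h1, h2⟩)
        simpa using this
      rcases lt_or_ge (x i) (a' i) with h3 | h3
      · refine intervalIntegral.integral_zero_ae (Eventually.of_forall fun t ht => hz2 _ _ ?_)
        rintro ⟨h4, -⟩
        have := uIoc_subset_uIcc ht
        have := this.2
        exact absurd (h4.trans this) (not_le.2 (max_lt (ha i) h3))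
      -- Beyond the support of `η` the primitive is the integral over the full line, which vanishes
      -- by `h0`.
      · have h4 : b' i < x i := by
          by_contra h5
          exact h2 ⟨h3, not_lt.1 h5⟩
        rw [hE]
        simp only
        rw [intervalIntegral.integral_eq_integral_of_support_subset, h0]
        intro t ht
        by_contra h5
        refine ht (hz2 _ _ fun h6 => h5 ⟨(ha i).trans_le h6.1, h6.2.trans h4.le⟩)
    · refine intervalIntegral.integral_zero_ae (Eventually.of_forall fun t ht => hz1 _ _ h1)
  · have h1 := hasDerivAt_comp_chart (hEs.differentiable (by simp)) i (x (i + 1)) (x i)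
    have h2 : HasDerivAt (fun t => E (chart i (x (i + 1), t))) (η (chart i (x (i + 1), x i)))
        (x i) := by
      have hc : Continuous fun t => η (chart i (x (i + 1), t)) :=
        h.continuous.comp ((chart i).continuous.comp (Continuous.prodMk_right _))
      have := intervalIntegral.integral_hasDerivAt_right (hc.intervalIntegrable (a i) (x i))
        (hc.stronglyMeasurableAtFilter _ _) hc.continuousAt
      simpa [hE] using this
    have h3 := h1.unique h2
    simpa using h3

/-- Averaging a test function along the lines in direction `i`. -/
theorem average {a b : Fin 2 → ℝ} (h : IsTest (box a b) η) (i : Fin 2) {β : ℝ → ℝ}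
    (hβ : ContDiff ℝ ∞ β) (hβc : HasCompactSupport β) (hβs : tsupport β ⊆ Ioo (a i) (b i)) :
    IsTest (box a b) fun x => (∫ t, η (chart i (x (i + 1), t))) * β (x i) := by
  obtain ⟨a', b', ha, hb, hz⟩ := h.exists_closedBox
  obtain ⟨c, d, hc, hd, hcd⟩ := hβc.isCompact.exists_Icc_of_subset_Ioo hβs
  have hz1 : ∀ s t, s ∉ Icc (a' (i + 1)) (b' (i + 1)) → η (chart i (s, t)) = 0 := fun s t hs =>
    hz _ fun hc => hs (chart_mem_closedBox.1 hc).1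
  have hz2 : ∀ s t, t ∉ Icc (a' i) (b' i) → η (chart i (s, t)) = 0 := fun s t hs =>
    hz _ fun hc => hs (chart_mem_closedBox.1 hc).2
  have hint : ∀ s, ∫ t, η (chart i (s, t)) = ∫ t in (a i)..(b i), η (chart i (s, t)) := by
    intro s
    rw [intervalIntegral.integral_eq_integral_of_support_subset]
    intro t ht
    by_contra h5
    exact ht (hz2 _ _ fun h6 => h5 ⟨(ha i).trans_le h6.1, h6.2.trans (hb i).le⟩)
  -- The support is controlled by `β` in direction `i` and by `η` in the other direction.
  refine of_closedBox (a' := fun k => if k = i then c else a' k)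
    (b' := fun k => if k = i then d else b' k) (fun k => ?_) (fun k => ?_) ?_ fun x hx => ?_
  · by_cases hk : k = i
    · simpa [hk] using hc
    · simpa [hk] using ha k
  · by_cases hk : k = i
    · simpa [hk] using hd
    · simpa [hk] using hb k
  · simp only [hint]
    refine ContDiff.mul ?_ (hβ.comp (by fun_prop))
    have : ContDiff ℝ ∞ fun q : Plane × ℝ => η (chart i (q.1 (i + 1), q.2)) := by
      refine h.contDiff.comp ((chart i).contDiff.comp ?_)
      fun_prop
    exact this.intervalIntegral_param_infty _ _
  · by_cases h1 : x (i + 1) ∈ Icc (a' (i + 1)) (b' (i + 1))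
    · have h2 : x i ∉ Icc c d := fun h2 => hx <| by
        have hi : i + 1 ≠ i := by fin_cases i <;> simp
        have := (chart_mem_closedBox (i := i) (a := fun k => if k = i then c else a' k)
          (b := fun k => if k = i then d else b' k) (p := (x (i + 1), x i))).2
          (by simpa [hi] using ⟨h1, h2⟩)
        simpa using this
      have : β (x i) = 0 := image_eq_zero_of_notMem_tsupport fun h3 => h2 (hcd h3)
      simp [this]
    · simp [hz1 _ _ h1]

theorem integrable (h : IsTest Ω η) : Integrable η :=
  h.continuous.integrable_of_hasCompactSupport h.hasCompactSupport

end IsTest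

/-- There is a smooth bump function with integral one supported in a given open interval. -/
theorem exists_contDiff_bump_integral_eq_one {a b : ℝ} (hab : a < b) :
    ∃ β : ℝ → ℝ, ContDiff ℝ ∞ β ∧ HasCompactSupport β ∧ tsupport β ⊆ Ioo a b ∧ ∫ t, β t = 1 := by
  let f : ContDiffBump ((a + b) / 2) :=
    { rIn := (b - a) / 8, rOut := (b - a) / 4, rIn_pos := by linarith, rIn_lt_rOut := by linarith }
  refine ⟨f.normed volume, f.contDiff_normed, f.hasCompactSupport_normed, ?_, f.integral_normed⟩
  rw [f.tsupport_normed_eq, Real.closedBall_eq_Icc]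
  intro x hx
  have h1 : f.rOut = (b - a) / 4 := rfl
  constructor <;> linarith [hx.1, hx.2]

/-! ### Functions with an absolutely continuous representative -/

theorem AbsolutelyContinuousOnInterval.comp_lipschitzOnWith {X Y : Type*} [PseudoMetricSpace X]
    [PseudoMetricSpace Y] {f : ℝ → X} {g : X → Y} {a b : ℝ} {K : ℝ≥0} {s : Set X}
    (hf : AbsolutelyContinuousOnInterval f a b) (hg : LipschitzOnWith K g s)
    (hs : MapsTo f (uIcc a b) s) : AbsolutelyContinuousOnInterval (fun t => g (f t)) a b := by
  rw [absolutelyContinuousOnInterval_iff] at hf ⊢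
  intro ε hε
  obtain ⟨δ, hδ, h⟩ := hf (ε / (K + 1)) (by positivity)
  refine ⟨δ, hδ, fun E hE hlt => ?_⟩
  have h1 := h E hE hlt
  have h2 : ∀ i ∈ Finset.range E.1, dist (g (f (E.2 i).1)) (g (f (E.2 i).2)) ≤
      K * dist (f (E.2 i).1) (f (E.2 i).2) := fun i hi =>
    hg.dist_le_mul _ (hs (hE.1 i hi).1) _ (hs (hE.1 i hi).2)
  calc _ ≤ ∑ i ∈ Finset.range E.1, K * dist (f (E.2 i).1) (f (E.2 i).2) := Finset.sum_le_sum h2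
    _ = K * ∑ i ∈ Finset.range E.1, dist (f (E.2 i).1) (f (E.2 i).2) := by rw [Finset.mul_sum]
    _ ≤ K * (ε / (K + 1)) := by gcongr
    _ < ε := by
      rw [mul_div_assoc', div_lt_iff₀ (by positivity)]
      nlinarith

/-- On `[a, b]`, the function `F` agrees almost everywhere with an absolutely continuous function
with derivative `G`. -/
def HasACRep {E : Type*} [NormedAddCommGroup E] [NormedSpace ℝ E] (a b : ℝ) (F G : ℝ → E) : Prop :=
  ∃ F' : ℝ → E, AbsolutelyContinuousOnInterval F' a b ∧ (∀ᵐ t, t ∈ uIcc a b → F t = F' t) ∧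
    ∀ᵐ t, t ∈ uIcc a b → HasDerivAt F' (G t) t

namespace HasACRep

variable {E : Type*} [NormedAddCommGroup E] [NormedSpace ℝ E] {a b : ℝ}

theorem congr {F G F₁ G₁ : ℝ → E} (h : HasACRep a b F G) (hF : ∀ᵐ t, t ∈ uIcc a b → F₁ t = F t)
    (hG : ∀ᵐ t, t ∈ uIcc a b → G₁ t = G t) : HasACRep a b F₁ G₁ := by
  obtain ⟨F', h1, h2, h3⟩ := h
  refine ⟨F', h1, ?_, ?_⟩
  · filter_upwards [h2, hF] with t ht ht' hm
    rw [ht' hm, ht hm]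
  · filter_upwards [h3, hG] with t ht ht' hm
    rw [ht' hm]
    exact ht hm

theorem add {F G F₁ G₁ : ℝ → E} (h : HasACRep a b F G) (h₁ : HasACRep a b F₁ G₁) :
    HasACRep a b (fun t => F t + F₁ t) fun t => G t + G₁ t := by
  obtain ⟨F', h1, h2, h3⟩ := h
  obtain ⟨F₁', k1, k2, k3⟩ := h₁
  refine ⟨fun t => F' t + F₁' t, h1.add k1, ?_, ?_⟩
  · filter_upwards [h2, k2] with t ht kt hm
    rw [ht hm, kt hm]
  · filter_upwards [h3, k3] with t ht kt hm
    exact (ht hm).add (kt hm)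

theorem mul {F G F₁ G₁ : ℝ → ℂ} (h : HasACRep a b F G) (h₁ : HasACRep a b F₁ G₁) :
    HasACRep a b (fun t => F t * F₁ t) fun t => G t * F₁ t + F t * G₁ t := by
  obtain ⟨F', h1, h2, h3⟩ := h
  obtain ⟨F₁', k1, k2, k3⟩ := h₁
  refine ⟨fun t => F' t * F₁' t, h1.smul k1, ?_, ?_⟩
  · filter_upwards [h2, k2] with t ht kt hm
    rw [ht hm, kt hm]
  · filter_upwards [h2, k2, h3, k3] with t ht2 kt2 ht kt hm
    rw [ht2 hm, kt2 hm]
    exact (ht hm).mul (kt hm)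

theorem const_mul {F G : ℝ → ℂ} (h : HasACRep a b F G) (c : ℂ) :
    HasACRep a b (fun t => c * F t) fun t => c * G t := by
  obtain ⟨F', h1, h2, h3⟩ := h
  refine ⟨fun t => c * F' t, h1.const_smul c, ?_, ?_⟩
  · filter_upwards [h2] with t ht hm
    rw [ht hm]
  · filter_upwards [h3] with t ht hm
    exact (ht hm).const_mul c

theorem ofReal {F G : ℝ → ℝ} (h : HasACRep a b F G) :
    HasACRep a b (fun t => (F t : ℂ)) fun t => (G t : ℂ) := by
  obtain ⟨F', h1, h2, h3⟩ := h
  refine ⟨fun t => (F' t : ℂ), h1.comp_lipschitzOnWith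
    (Complex.isometry_ofReal.lipschitz.lipschitzOnWith (s := univ)) (mapsTo_univ _ _), ?_, ?_⟩
  · filter_upwards [h2] with t ht hm
    rw [ht hm]
  · filter_upwards [h3] with t ht hm
    exact (ht hm).ofReal_comp

/-- The map x ↦ exp(ix) is 1-Lipschitz, so it preserves absolute continuity. -/
theorem exp_I {F G : ℝ → ℝ} (h : HasACRep a b F G) :
    HasACRep a b (fun t => Complex.exp (Complex.I * F t))
      fun t => Complex.I * G t * Complex.exp (Complex.I * F t) := by
  obtain ⟨F', h1, h2, h3⟩ := h
  have hd : ∀ x : ℝ, HasDerivAt (fun x : ℝ => Complex.exp (Complex.I * x))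
      (Complex.exp (Complex.I * x) * Complex.I) x := fun x => by
    have := ((hasDerivAt_id x).ofReal_comp.const_mul Complex.I).cexp
    simpa using this
  have hl : LipschitzWith 1 fun x : ℝ => Complex.exp (Complex.I * x) := by
    refine lipschitzWith_of_nnnorm_deriv_le (fun x => (hd x).differentiableAt) fun x => ?_
    rw [(hd x).deriv, ← NNReal.coe_le_coe]
    simp [mul_comm Complex.I]
  refine ⟨fun t => Complex.exp (Complex.I * F' t), h1.comp_lipschitzOnWith
    (hl.lipschitzOnWith (s := univ)) (mapsTo_univ _ _), ?_, ?_⟩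
  · filter_upwards [h2] with t ht hm
    rw [ht hm]
  · filter_upwards [h2, h3] with t ht2 ht hm
    rw [ht2 hm]
    have := (hd (F' t)).scomp t (ht hm)
    rw [Complex.real_smul, mul_comm (Complex.exp _), ← mul_assoc, mul_comm (G t : ℂ)] at this
    exact this

/-- Continuity makes `F` equal to its representative at every point of the interval, so both are
bounded below by the minimum c > 0 of `F`. On [c, ∞) inversion is Lipschitz with constant c⁻². -/
theorem inv {F G : ℝ → ℝ} (h : HasACRep a b F G) (hab : a < b) (hc : ContinuousOn F (Icc a b))
    (hpos : ∀ t ∈ Icc a b, 0 < F t) :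
    HasACRep a b (fun t => (F t)⁻¹) fun t => -G t / F t ^ 2 := by
  obtain ⟨F', h1, h2, h3⟩ := h
  rw [uIcc_of_le hab.le] at h2 h3
  have hc' : ContinuousOn F' (Icc a b) := by simpa [uIcc_of_le hab.le] using h1.continuousOn
  have heq : EqOn F F' (Icc a b) :=
    Measure.eqOn_Icc_of_ae_eq volume hab.ne ((ae_restrict_iff' measurableSet_Icc).2 h2) hc hc'
  obtain ⟨t₀, ht₀, hmin⟩ := isCompact_Icc.exists_isMinOn (nonempty_Icc.2 hab.le) hc
  set c := F t₀ with hcdef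
  have hcpos : 0 < c := hpos t₀ ht₀
  have hl : LipschitzOnWith (Real.toNNReal ((c ^ 2)⁻¹)) (fun x : ℝ => x⁻¹) (Ici c) := by
    refine LipschitzOnWith.of_dist_le_mul fun x hx y hy => ?_
    have hx0 : 0 < x := hcpos.trans_le hx
    have hy0 : 0 < y := hcpos.trans_le hy
    rw [Real.coe_toNNReal _ (by positivity), Real.dist_eq, Real.dist_eq,
      inv_sub_inv hx0.ne' hy0.ne', abs_div, abs_sub_comm y x, abs_of_pos (mul_pos hx0 hy0),
      div_eq_inv_mul]
    gcongr
    rw [sq]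
    exact mul_le_mul hx hy hcpos.le hx0.le
  refine ⟨fun t => (F' t)⁻¹, h1.comp_lipschitzOnWith hl ?_, ?_, ?_⟩
  · intro t ht
    rw [uIcc_of_le hab.le] at ht
    change c ≤ F' t
    rw [← heq ht]
    exact hmin ht
  · refine Eventually.of_forall fun t ht => ?_
    rw [uIcc_of_le hab.le] at ht
    simp only [heq ht]
  · rw [uIcc_of_le hab.le]
    filter_upwards [h3] with t ht hm
    rw [heq hm]
    refine (ht hm).inv ?_
    rw [← heq hm]
    exact (hpos t hm).ne'

/-- Integration by parts for the absolutely continuous representative; integrability of `G` is that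
of its derivative. -/
theorem integral_deriv_mul_real {F G : ℝ → ℝ} (h : HasACRep a b F G) {ζ : ℝ → ℝ}
    (hζ : ContDiff ℝ 1 ζ) (ha : ζ a = 0) (hb : ζ b = 0) :
    IntervalIntegrable G volume a b ∧
      ∫ t in a..b, deriv ζ t * F t = -∫ t in a..b, ζ t * G t := by
  obtain ⟨F', h1, h2, h3⟩ := h
  have hG : ∀ᵐ t, t ∈ uIoc a b → deriv F' t = G t :=
    h3.mono fun t ht hm => (ht (uIoc_subset_uIcc hm)).deriv
  constructor
  · exact h1.intervalIntegrable_deriv.congr_ae ((ae_restrict_iff' measurableSet_uIoc).2 hG)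
  · have h4 := AbsolutelyContinuousOnInterval.integral_mul_deriv_eq_deriv_mul
      (f := ζ) (a := a) (b := b) hζ.contDiffOn.absolutelyContinuousOnInterval h1
    rw [ha, hb, zero_mul, zero_mul, sub_zero, zero_sub] at h4
    have h5 : ∫ t in a..b, ζ t * G t = ∫ t in a..b, ζ t * deriv F' t :=
      intervalIntegral.integral_congr_ae (hG.mono fun t ht hm => by rw [ht hm])
    have h6 : ∫ t in a..b, deriv ζ t * F t = ∫ t in a..b, deriv ζ t * F' t :=
      intervalIntegral.integral_congr_ae
        (h2.mono fun t ht hm => by rw [ht (uIoc_subset_uIcc hm)])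
    rw [h5, h6, h4, neg_neg]

theorem intervalIntegrable {F G : ℝ → ℝ} (h : HasACRep a b F G) : IntervalIntegrable F volume a b := by
  obtain ⟨F', h1, h2, -⟩ := h
  refine h1.continuousOn.intervalIntegrable.congr_ae ((ae_restrict_iff' measurableSet_uIoc).2 ?_)
  exact h2.mono fun t ht hm => (ht (uIoc_subset_uIcc hm)).symm

theorem re {F G : ℝ → ℂ} (h : HasACRep a b F G) :
    HasACRep a b (fun t => (F t).re) fun t => (G t).re := by
  obtain ⟨F', h1, h2, h3⟩ := h
  refine ⟨fun t => (F' t).re, h1.comp_lipschitzOnWith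
    (Complex.reCLM.lipschitz.lipschitzOnWith (s := univ)) (mapsTo_univ _ _), ?_, ?_⟩
  · filter_upwards [h2] with t ht hm
    rw [ht hm]
  · filter_upwards [h3] with t ht hm
    exact Complex.reCLM.hasFDerivAt.comp_hasDerivAt t (ht hm)

theorem im {F G : ℝ → ℂ} (h : HasACRep a b F G) :
    HasACRep a b (fun t => (F t).im) fun t => (G t).im := by
  obtain ⟨F', h1, h2, h3⟩ := h
  refine ⟨fun t => (F' t).im, h1.comp_lipschitzOnWith
    (Complex.imCLM.lipschitz.lipschitzOnWith (s := univ)) (mapsTo_univ _ _), ?_, ?_⟩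
  · filter_upwards [h2] with t ht hm
    rw [ht hm]
  · filter_upwards [h3] with t ht hm
    exact Complex.imCLM.hasFDerivAt.comp_hasDerivAt t (ht hm)

theorem integral_deriv_smul {F G : ℝ → ℂ} (h : HasACRep a b F G) {ζ : ℝ → ℝ}
    (hζ : ContDiff ℝ 1 ζ) (ha : ζ a = 0) (hb : ζ b = 0) :
    ∫ t in a..b, deriv ζ t • F t = -∫ t in a..b, ζ t • G t := by
  have hζ' : Continuous (deriv ζ) := hζ.continuous_deriv (by norm_num)
  obtain ⟨r1, r2⟩ := h.re.integral_deriv_mul_real hζ ha hb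
  obtain ⟨i1, i2⟩ := h.im.integral_deriv_mul_real hζ ha hb
  have key : ∀ (z : ℝ → ℝ) (W : ℝ → ℂ), Continuous z →
      IntervalIntegrable (fun t => (W t).re) volume a b →
      IntervalIntegrable (fun t => (W t).im) volume a b →
      ∫ t in a..b, z t • W t =
        ((∫ t in a..b, z t * (W t).re : ℝ) : ℂ) + ((∫ t in a..b, z t * (W t).im : ℝ) : ℂ) *
          Complex.I := by
    intro z W hz hr hi
    rw [← intervalIntegral.integral_ofReal, ← intervalIntegral.integral_ofReal,
      ← intervalIntegral.integral_mul_const, ← intervalIntegral.integral_add]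
    · refine intervalIntegral.integral_congr fun t _ => ?_
      apply Complex.ext <;> simp
    · have := hr.continuousOn_mul hz.continuousOn
      exact ⟨this.1.ofReal, this.2.ofReal⟩
    · have := hi.continuousOn_mul hz.continuousOn
      exact IntervalIntegrable.mul_const ⟨this.1.ofReal, this.2.ofReal⟩ _
  rw [key _ _ hζ' h.re.intervalIntegrable h.im.intervalIntegrable, key _ _ hζ.continuous r1 i1,
    r2, i2]
  push_cast
  ring

end HasACRep

theorem intervalIntegral_eq_integral_of_eq_zero {E : Type*} [NormedAddCommGroup E]
    [NormedSpace ℝ E] {f : ℝ → E} {a b : ℝ} (h : ∀ t, t ∉ Icc a b → f t = 0) (hab : a ≤ b) :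
    ∫ t in a..b, f t = ∫ t, f t := by
  rw [intervalIntegral.integral_of_le hab, ← integral_Icc_eq_integral_Ioc,
    setIntegral_eq_integral_of_forall_compl_eq_zero h]

/-- The primitive of an integrable function has an absolutely continuous representative. -/
theorem hasACRep_integral_Iic {h : ℝ → ℝ} (hh : Integrable h) (a b : ℝ) :
    HasACRep a b (fun t => ∫ τ in Iic t, h τ) h := by
  have heq : ∀ t, ∫ τ in Iic t, h τ = (∫ τ in Iic a, h τ) + ∫ τ in a..t, h τ := fun t => by
    rw [← intervalIntegral.integral_Iic_sub_Iic hh.integrableOn hh.integrableOn]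
    ring
  refine ⟨fun t => (∫ τ in Iic a, h τ) + ∫ τ in a..t, h τ, ?_,
    Eventually.of_forall fun t _ => heq t, ?_⟩
  · refine AbsolutelyContinuousOnInterval.add ?_
      (hh.intervalIntegrable.absolutelyContinuousOnInterval_intervalIntegral left_mem_uIcc)
    exact (LipschitzWith.const _).lipschitzOnWith.absolutelyContinuousOnInterval
  · filter_upwards [(hh.intervalIntegrable (a := a) (b := b)).ae_hasDerivAt_integral] with t ht hm
    exact (ht hm a left_mem_uIcc).const_add _

theorem integral_deriv_mul_integral_Iic {h ζ : ℝ → ℝ} (hh : Integrable h) (hζ : ContDiff ℝ 1 ζ)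
    (hζc : HasCompactSupport ζ) :
    ∫ t, deriv ζ t * ∫ τ in Iic t, h τ = -∫ t, ζ t * h t := by
  obtain ⟨M, hM, hsub⟩ := hζc.isCompact.isBounded.subset_closedBall_lt 0 0
  have hz : ∀ t, t ∉ Icc (-(M + 1)) (M + 1) → ζ t = 0 ∧ deriv ζ t = 0 := fun t ht => by
    have : t ∉ tsupport ζ := fun h' => ht <| by
      have := hsub h'
      rw [Real.closedBall_eq_Icc] at this
      constructor <;> linarith [this.1, this.2]
    exact ⟨image_eq_zero_of_notMem_tsupport this,
      by_contra fun h' => this (support_deriv_subset h')⟩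
  have hz' : ∀ t, M < |t| → ζ t = 0 := fun t ht => by
    refine image_eq_zero_of_notMem_tsupport fun h' => ?_
    have := hsub h'
    rw [mem_closedBall_zero_iff, Real.norm_eq_abs] at this
    linarith
  have h1 := ((hasACRep_integral_Iic hh (-(M + 1)) (M + 1)).integral_deriv_mul_real hζ
    (hz' _ (by rw [abs_neg, abs_of_pos] <;> linarith)) (hz' _ (by rw [abs_of_pos] <;> linarith))).2
  rwa [intervalIntegral_eq_integral_of_eq_zero (fun t ht => by rw [(hz t ht).2, zero_mul])
    (by linarith), intervalIntegral_eq_integral_of_eq_zero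
    (fun t ht => by rw [(hz t ht).1, zero_mul]) (by linarith)] at h1

/-! ### Weak derivatives along lines -/

namespace Plane

/-- The primitive of `g` in direction `i`. -/
noncomputable def linePrimitive (i : Fin 2) (g : Plane → ℝ) (x : Plane) : ℝ :=
  ∫ τ in Iic (x i), g (chart i (x (i + 1), τ))

theorem linePrimitive_chart (i : Fin 2) (g : Plane → ℝ) (s t : ℝ) :
    linePrimitive i g (chart i (s, t)) = ∫ τ in Iic t, g (chart i (s, τ)) := by
  simp [linePrimitive]

theorem ae_integrable_slice {F : Type*} [NormedAddCommGroup F] {f : Plane → F} (hf : Integrable f)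
    (i : Fin 2) : ∀ᵐ s, Integrable fun t => f (chart i (s, t)) :=
  ((integrable_chart i).2 hf).prod_right_ae

theorem integral_eq_integral_integral {F : Type*} [NormedAddCommGroup F] [NormedSpace ℝ F]
    {f : Plane → F} (hf : Integrable f) (i : Fin 2) :
    ∫ x, f x = ∫ s, ∫ t, f (chart i (s, t)) := by
  rw [← integral_chart i]
  exact integral_prod _ ((integrable_chart i).2 hf)

theorem ae_chart {P : Plane → Prop} (h : ∀ᵐ x, P x) (i : Fin 2) :
    ∀ᵐ s : ℝ, ∀ᵐ t : ℝ, P (chart i (s, t)) := by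
  have h1 : ∀ᵐ p : ℝ × ℝ, P (chart i p) :=
    (measurePreserving_chart i).quasiMeasurePreserving.ae h
  exact Measure.ae_ae_of_ae_prod h1

theorem stronglyMeasurable_linePrimitive (i : Fin 2) {g : Plane → ℝ} (hg : StronglyMeasurable g) :
    StronglyMeasurable (linePrimitive i g) := by
  have h1 : StronglyMeasurable (Function.uncurry fun (x : Plane) (τ : ℝ) =>
      if τ ≤ x i then g (chart i (x (i + 1), τ)) else 0) := by
    refine StronglyMeasurable.ite ?_ ?_ stronglyMeasurable_const
    · exact measurableSet_le measurable_snd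
        ((Plane.continuous_apply i).measurable.comp measurable_fst)
    · refine hg.comp_measurable ((chart i).continuous.measurable.comp ?_)
      exact (((Plane.continuous_apply (i + 1)).measurable.comp measurable_fst)).prodMk
        measurable_snd
  have h2 := h1.integral_prod_right (ν := volume)
  convert h2 using 1
  ext x
  rw [linePrimitive, ← integral_indicator measurableSet_Iic]
  rfl

/-- The primitive is bounded by the integral of |g| over the whole line, which is integrable in the
transverse coordinate by Fubini, and the rectangle has finite length in direction `i`. -/
theorem integrableOn_linePrimitive (i : Fin 2) {g : Plane → ℝ} (hg : StronglyMeasurable g)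
    (hgi : Integrable g) (a b : Fin 2 → ℝ) : IntegrableOn (linePrimitive i g) (box a b) := by
  rw [← integrable_indicator_iff (isOpen_box a b).measurableSet, ← integrable_chart i]
  have h1 : Integrable fun s => ∫ t, ‖g (chart i (s, t))‖ :=
    ((integrable_chart i).2 hgi).norm.integral_prod_left
  have h2 : Integrable ((Ioo (a i) (b i)).indicator (fun _ => (1 : ℝ))) :=
    (integrable_indicator_iff measurableSet_Ioo).2 (by simp)
  refine (h1.mul_prod h2).mono' ?_ ?_
  · exact (((stronglyMeasurable_linePrimitive i hg).indicator
      (isOpen_box a b).measurableSet).comp_measurable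
      (chart i).continuous.measurable).aestronglyMeasurable
  · have h3 : ∀ᵐ p : ℝ × ℝ, Integrable fun t => g (chart i (p.1, t)) :=
      Measure.quasiMeasurePreserving_fst.ae (ae_integrable_slice hgi i)
    refine h3.mono fun p hp => ?_
    by_cases hm : chart i p ∈ box a b
    · rw [indicator_of_mem hm, indicator_of_mem (chart_mem_box.1 hm).2, mul_one]
      refine (norm_integral_le_integral_norm _).trans ?_
      simp only [chart_apply_add_one]
      exact setIntegral_le_integral hp.norm (Eventually.of_forall fun _ => norm_nonneg _)
    · rw [indicator_of_notMem hm, norm_zero]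
      exact mul_nonneg (integral_nonneg fun _ => norm_nonneg _)
        (indicator_nonneg (fun _ _ => zero_le_one) _)

end Plane

open Plane

variable {η : Plane → ℝ} {a b : Fin 2 → ℝ}

theorem IsTest.slice_contDiff {Ω : Set Plane} (h : IsTest Ω η) (i : Fin 2) (s : ℝ) :
    ContDiff ℝ 1 fun t => η (chart i (s, t)) :=
  (h.contDiff.of_le (by exact_mod_cast le_top)).comp
    ((chart i).contDiff.comp (contDiff_prodMk_right s))

theorem IsTest.slice_hasCompactSupport {Ω : Set Plane} (h : IsTest Ω η) (i : Fin 2) (s : ℝ) :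
    HasCompactSupport fun t => η (chart i (s, t)) := by
  have h1 : HasCompactSupport fun p => η (chart i p) :=
    h.hasCompactSupport.comp_homeomorph (chart i).toHomeomorph
  refine HasCompactSupport.intro (h1.isCompact.image continuous_snd) fun t ht => ?_
  by_contra hne
  exact ht ⟨(s, t), subset_tsupport _ hne, rfl⟩

theorem IsTest.deriv_slice {Ω : Set Plane} (h : IsTest Ω η) (i : Fin 2) (s t : ℝ) :
    deriv (fun t => η (chart i (s, t))) t = fderiv ℝ η (chart i (s, t)) (e i) :=
  (hasDerivAt_comp_chart h.differentiable i s t).deriv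

theorem IsTest.slice_integrable {Ω : Set Plane} (h : IsTest Ω η) (i : Fin 2) (s : ℝ) :
    Integrable fun t => η (chart i (s, t)) :=
  (h.slice_contDiff i s).continuous.integrable_of_hasCompactSupport (h.slice_hasCompactSupport i s)

theorem IsTest.integrable_mul_of_integrableOn {Ω : Set Plane} (hη : IsTest Ω η) (hΩ : IsOpen Ω)
    {F : Type*} [NormedAddCommGroup F] [NormedSpace ℝ F] {u : Plane → F} (hu : IntegrableOn u Ω) :
    Integrable fun x => η x • u x := by
  obtain ⟨C, hC⟩ := hη.hasCompactSupport.exists_bound_of_continuous hη.continuous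
  have h1 : IntegrableOn (fun x => η x • u x) Ω :=
    hu.bdd_smul C hη.continuous.aestronglyMeasurable (Eventually.of_forall fun x => hC x)
  rw [← integrable_indicator_iff hΩ.measurableSet] at h1
  refine h1.congr (Eventually.of_forall fun x => ?_)
  by_cases hx : x ∈ Ω
  · rw [indicator_of_mem hx]
  · simp only [indicator_of_notMem hx, hη.eq_zero_of_notMem hx, zero_smul]

/-- Integration by parts against the primitive in direction `i`. -/
theorem IsTest.integral_fderiv_mul_linePrimitive (hη : IsTest (box a b) η) (i : Fin 2)
    {g : Plane → ℝ} (hg : StronglyMeasurable g) (hgi : Integrable g) :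
    ∫ x, fderiv ℝ η x (e i) * linePrimitive i g x = -∫ x, η x * g x := by
  have h1 : Integrable fun x => fderiv ℝ η x (e i) * linePrimitive i g x :=
    (hη.fderiv_apply (e i)).integrable_mul_of_integrableOn (isOpen_box a b)
      (integrableOn_linePrimitive i hg hgi a b)
  have h2 : Integrable fun x => η x * g x :=
    hη.integrable_mul_of_integrableOn (isOpen_box a b) hgi.integrableOn
  rw [integral_eq_integral_integral h1 i, integral_eq_integral_integral h2 i, ← integral_neg]
  refine integral_congr_ae ((ae_integrable_slice hgi i).mono fun s hs => ?_)
  have h3 := integral_deriv_mul_integral_Iic hs (hη.slice_contDiff i s)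
    (hη.slice_hasCompactSupport i s)
  simpa only [hη.deriv_slice, linePrimitive_chart] using h3

/-- Fubini: pairing with an averaged test function. -/
theorem IsTest.integral_average_mul (hη : IsTest (box a b) η) (i : Fin 2) {β : ℝ → ℝ}
    (hβ : ContDiff ℝ ∞ β) (hβc : HasCompactSupport β) (hβs : tsupport β ⊆ Ioo (a i) (b i))
    {W : Plane → ℝ} (hW : IntegrableOn W (box a b)) :
    Integrable ((box a b).indicator
        fun x => ∫ c, β c * (box a b).indicator W (chart i (x (i + 1), c))) ∧
      ∫ x, (∫ t, η (chart i (x (i + 1), t))) * β (x i) * W x =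
        ∫ x, η x * ∫ c, β c * (box a b).indicator W (chart i (x (i + 1), c)) := by
  set W₀ := (box a b).indicator W with hW₀
  have hW₀i : Integrable W₀ := (integrable_indicator_iff (isOpen_box a b).measurableSet).2 hW
  obtain ⟨C, hC⟩ := hβc.exists_bound_of_continuous hβ.continuous
  have h0 : Integrable fun p : ℝ × ℝ => β p.2 * W₀ (chart i p) :=
    ((integrable_chart i).2 hW₀i).bdd_mul (c := C)
      (hβ.continuous.comp continuous_snd).aestronglyMeasurable
      (Eventually.of_forall fun p => hC p.2)
  set w : ℝ → ℝ := fun s => ∫ c, β c * W₀ (chart i (s, c)) with hw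
  have hwi : Integrable w := h0.integral_prod_left
  have hint : Integrable ((box a b).indicator fun x => w (x (i + 1))) := by
    rw [← integrable_chart i]
    have h2 : Integrable ((Ioo (a i) (b i)).indicator (fun _ => (1 : ℝ))) :=
      (integrable_indicator_iff measurableSet_Ioo).2 (by simp)
    have h3 := ((integrable_indicator_iff (measurableSet_Ioo (a := a (i + 1))
      (b := b (i + 1)))).2 hwi.integrableOn).mul_prod h2
    refine Integrable.congr h3 (Eventually.of_forall fun p => ?_)
    beta_reduce
    by_cases hm : chart i p ∈ box a b
    · rw [indicator_of_mem hm, indicator_of_mem (chart_mem_box.1 hm).2,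
        indicator_of_mem (chart_mem_box.1 hm).1]
      simp
    · rw [indicator_of_notMem hm]
      rw [chart_mem_box, not_and_or] at hm
      rcases hm with hm | hm <;> simp [hm]
  refine ⟨hint, ?_⟩
  have hA := hη.average i hβ hβc hβs
  have h1 : Integrable fun x => (∫ t, η (chart i (x (i + 1), t))) * β (x i) * W₀ x :=
    hA.integrable_mul_of_integrableOn (isOpen_box a b) hW₀i.integrableOn
  have h2 : Integrable fun x => η x * w (x (i + 1)) := by
    have := hη.integrable_mul_of_integrableOn (isOpen_box a b)
      ((integrable_indicator_iff (isOpen_box a b).measurableSet).1 hint)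
    exact this
  have h3 : ∫ x, (∫ t, η (chart i (x (i + 1), t))) * β (x i) * W x =
      ∫ x, (∫ t, η (chart i (x (i + 1), t))) * β (x i) * W₀ x := by
    congr 1
    ext x
    by_cases hx : x ∈ box a b
    · rw [hW₀, indicator_of_mem hx]
    · have := hA.eq_zero_of_notMem hx
      simp only at this
      rw [this, zero_mul, zero_mul]
  rw [h3, integral_eq_integral_integral h1 i, integral_eq_integral_integral h2 i]
  congr 1
  ext s
  simp only [chart_apply_add_one, chart_apply_self]
  rw [integral_mul_const, hw]
  simp only
  rw [← integral_const_mul]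
  congr 1
  ext t
  ring

theorem MeasureTheory.LocallyIntegrableOn.integrableOn_closedBox {F : Type*} [NormedAddCommGroup F]
    {Ω : Set Plane} {f : Plane → F} (hf : LocallyIntegrableOn f Ω) (hQ : closedBox a b ⊆ Ω) :
    IntegrableOn f (closedBox a b) :=
  hf.integrableOn_compact_subset hQ (isCompact_closedBox a b)

/-- A function on a rectangle whose weak derivative in direction `i` vanishes does not depend on
the `i`-th coordinate. -/
theorem ae_eq_of_integral_fderiv_mul_eq_zero (hab : ∀ k, a k < b k) (i : Fin 2) {D : Plane → ℝ}
    (hD : IntegrableOn D (box a b))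
    (h : ∀ η, IsTest (box a b) η → ∫ x, fderiv ℝ η x (e i) * D x = 0) :
    ∃ w : ℝ → ℝ, ∀ᵐ x, x ∈ box a b → D x = w (x (i + 1)) := by
  obtain ⟨β, hβ, hβc, hβs, hβ1⟩ := exists_contDiff_bump_integral_eq_one (hab i)
  refine ⟨fun s => ∫ c, β c * (box a b).indicator D (chart i (s, c)), ?_⟩
  set w : ℝ → ℝ := fun s => ∫ c, β c * (box a b).indicator D (chart i (s, c)) with hw
  have hwi : IntegrableOn (fun x : Plane => w (x (i + 1))) (box a b) := by
    obtain ⟨hint, -⟩ := IsTest.integral_average_mul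
      (η := fun _ => 0) ⟨contDiff_const, HasCompactSupport.zero, by simp⟩ i hβ hβc hβs hD
    exact (integrable_indicator_iff (isOpen_box a b).measurableSet).1 hint
  have hsub : LocallyIntegrableOn (fun x => D x - w (x (i + 1))) (box a b) :=
    (hD.sub hwi).locallyIntegrableOn
  refine ((isOpen_box a b).ae_eq_zero_of_integral_contDiff_smul_eq_zero hsub ?_).mono
    fun x hx hm => sub_eq_zero.1 (hx hm)
  intro η h1 h2 h3
  have hη : IsTest (box a b) η := ⟨h1, h2, h3⟩
  obtain ⟨-, hav⟩ := hη.integral_average_mul i hβ hβc hβs hD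
  have hA := hη.average i hβ hβc hβs
  -- Since ∫ β = 1, `η` minus its average has zero integral on each line in direction `i`. It is
  -- thus a derivative ∂ᵢE, and `D` annihilates it; so `D` sees only the average of `η`.
  obtain ⟨E, hE, hE'⟩ := (hη.sub hA).exists_primitive i fun s => by
    simp only [chart_apply_add_one, chart_apply_self]
    rw [integral_sub (hη.slice_integrable i s)
      ((hβ.continuous.integrable_of_hasCompactSupport hβc).const_mul _), integral_const_mul, hβ1,
      mul_one, sub_self]
  have h0 := h E hE
  simp only [hE', sub_mul] at h0
  have i1 := hη.integrable_mul_of_integrableOn (isOpen_box a b) hD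
  have i2 := hA.integrable_mul_of_integrableOn (isOpen_box a b) hD
  have i3 := hη.integrable_mul_of_integrableOn (isOpen_box a b) hwi
  simp only [smul_eq_mul] at i1 i2 i3
  rw [integral_sub i1 i2, hav, sub_eq_zero] at h0
  simp only [smul_eq_mul, mul_sub]
  rw [integral_sub i1 i3, h0, sub_self]

/-- A weakly differentiable function is absolutely continuous on almost every line. -/
theorem HasWeakPartial.ae_hasACRep {Ω : Set Plane} {i : Fin 2} {f g : Plane → ℝ}
    (h : HasWeakPartial Ω i f g) (hab : ∀ k, a k < b k) (hQ : closedBox a b ⊆ Ω) :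
    ∀ᵐ s, s ∈ Ioo (a (i + 1)) (b (i + 1)) →
      HasACRep (a i) (b i) (fun t => f (chart i (s, t))) fun t => g (chart i (s, t)) := by
  have hfi : IntegrableOn f (box a b) :=
    (h.locallyIntegrableOn.integrableOn_closedBox hQ).mono_set (box_subset_closedBox a b)
  have hgi : IntegrableOn g (box a b) :=
    (h.locallyIntegrableOn_deriv.integrableOn_closedBox hQ).mono_set (box_subset_closedBox a b)
  have hQm := (isOpen_box a b).measurableSet
  have hgi' : Integrable ((box a b).indicator g) := (integrable_indicator_iff hQm).2 hgi
  -- A strongly measurable version of the truncated derivative, needed for measurability of its line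
  -- primitive.
  obtain ⟨G, hG, hgG⟩ := hgi'.1
  have hGi : Integrable G := hgi'.congr hgG
  have hu := integrableOn_linePrimitive i hG hGi a b
  -- `f` minus the primitive of `G` has zero weak derivative in direction `i`, so it is constant on
  -- almost every such line. The primitive provides the absolutely continuous representative.
  obtain ⟨w, hw⟩ := ae_eq_of_integral_fderiv_mul_eq_zero hab i (hfi.sub hu) fun η hη => by
    have i1 := (hη.fderiv_apply (e i)).integrable_mul_of_integrableOn (isOpen_box a b) hfi
    have i2 := (hη.fderiv_apply (e i)).integrable_mul_of_integrableOn (isOpen_box a b) hu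
    simp only [smul_eq_mul] at i1 i2
    simp only [mul_sub, Pi.sub_apply]
    rw [integral_sub i1 i2, hη.integral_fderiv_mul_linePrimitive i hG hGi]
    have := h.integral_eq η hη.contDiff hη.hasCompactSupport
      (hη.tsupport_subset.trans ((box_subset_closedBox a b).trans hQ))
    simp only [smul_eq_mul] at this
    rw [this, sub_neg_eq_add, neg_add_eq_zero]
    refine integral_congr_ae (hgG.mono fun x hx => ?_)
    simp only
    rw [← hx]
    by_cases hm : x ∈ box a b
    · rw [indicator_of_mem hm]
    · rw [hη.eq_zero_of_notMem hm, zero_mul, zero_mul]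
  filter_upwards [ae_chart hw i, ae_chart hgG i, ae_integrable_slice hGi i] with s h1 h2 h3 hs
  have hIoo : ∀ᵐ t : ℝ, t ∈ uIcc (a i) (b i) → t ∈ Ioo (a i) (b i) := by
    rw [uIcc_of_le (hab i).le]
    have e1 : ∀ᵐ t : ℝ, t ≠ a i := by simp [ae_iff]
    have e2 : ∀ᵐ t : ℝ, t ≠ b i := by simp [ae_iff]
    filter_upwards [e1, e2] with t t1 t2 ht
    exact ⟨lt_of_le_of_ne ht.1 t1.symm, lt_of_le_of_ne ht.2 t2⟩
  have hconst : HasACRep (a i) (b i) (fun _ : ℝ => w s) fun _ => 0 :=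
    ⟨fun _ => w s, (LipschitzWith.const _).lipschitzOnWith.absolutelyContinuousOnInterval,
      Eventually.of_forall fun _ _ => rfl, Eventually.of_forall fun t _ => hasDerivAt_const t _⟩
  refine (hconst.add (hasACRep_integral_Iic h3 (a i) (b i))).congr ?_ ?_
  · filter_upwards [h1, hIoo] with t t1 t2 ht
    have := t1 (chart_mem_box.2 ⟨hs, t2 ht⟩)
    simp only [Pi.sub_apply, linePrimitive_chart, chart_apply_add_one] at this
    linarith
  · filter_upwards [h2, hIoo] with t t1 t2 ht
    rw [← t1, indicator_of_mem (chart_mem_box.2 ⟨hs, t2 ht⟩), zero_add]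

/-! ### Weak derivatives from lines, and removal of isolated points -/

open scoped Manifold

theorem IsTest.integrable_smul {Ω : Set Plane} (hη : IsTest Ω η) {F : Type*}
    [NormedAddCommGroup F] [NormedSpace ℝ F] {u : Plane → F} (hu : LocallyIntegrableOn u Ω) :
    Integrable fun x => η x • u x := by
  obtain ⟨C, hC⟩ := hη.hasCompactSupport.exists_bound_of_continuous hη.continuous
  have hm : MeasurableSet (tsupport η) := (isClosed_tsupport η).measurableSet
  have h1 : IntegrableOn (fun x => η x • u x) (tsupport η) :=
    (hu.integrableOn_compact_subset hη.tsupport_subset hη.hasCompactSupport.isCompact).bdd_smul C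
      hη.continuous.aestronglyMeasurable (Eventually.of_forall fun x => hC x)
  rw [← integrable_indicator_iff hm] at h1
  refine h1.congr (Eventually.of_forall fun x => ?_)
  by_cases hx : x ∈ tsupport η
  · rw [indicator_of_mem hx]
  · simp only [indicator_of_notMem hx, image_eq_zero_of_notMem_tsupport hx, zero_smul]

/-- Integration by parts on a rectangle for functions that are absolutely continuous on almost
every line in direction `i`. -/
theorem IsTest.integral_fderiv_smul_of_slices (hη : IsTest (box a b) η) (hab : ∀ k, a k < b k)
    (i : Fin 2) {f g : Plane → ℂ} (hf : IntegrableOn f (box a b)) (hg : IntegrableOn g (box a b))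
    (h : ∀ᵐ s, s ∈ Ioo (a (i + 1)) (b (i + 1)) →
      HasACRep (a i) (b i) (fun t => f (chart i (s, t))) fun t => g (chart i (s, t))) :
    ∫ x, fderiv ℝ η x (e i) • f x = -∫ x, η x • g x := by
  have h1 := (hη.fderiv_apply (e i)).integrable_mul_of_integrableOn (isOpen_box a b) hf
  have h2 := hη.integrable_mul_of_integrableOn (isOpen_box a b) hg
  rw [integral_eq_integral_integral h1 i, integral_eq_integral_integral h2 i, ← integral_neg]
  refine integral_congr_ae (h.mono fun s hs => ?_)
  have hz : ∀ t, t ∉ Ioo (a i) (b i) → η (chart i (s, t)) = 0 := fun t ht =>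
    hη.eq_zero_of_notMem fun hm => ht (chart_mem_box.1 hm).2
  have hz' : ∀ t, t ∉ Ioo (a i) (b i) → fderiv ℝ η (chart i (s, t)) (e i) = 0 := fun t ht =>
    (hη.fderiv_apply (e i)).eq_zero_of_notMem fun hm => ht (chart_mem_box.1 hm).2
  by_cases hm : s ∈ Ioo (a (i + 1)) (b (i + 1))
  · have h3 := (hs hm).integral_deriv_smul (hη.slice_contDiff i s) (hz _ (by simp)) (hz _ (by simp))
    rw [intervalIntegral_eq_integral_of_eq_zero _ (hab i).le,
      intervalIntegral_eq_integral_of_eq_zero _ (hab i).le] at h3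
    · simpa only [hη.deriv_slice] using h3
    · intro t ht
      rw [hz t fun h' => ht (Ioo_subset_Icc_self h'), zero_smul]
    · intro t ht
      rw [hη.deriv_slice, hz' t fun h' => ht (Ioo_subset_Icc_self h'), zero_smul]
  · have e1 : ∀ t, η (chart i (s, t)) = 0 := fun t =>
      hη.eq_zero_of_notMem fun h' => hm (chart_mem_box.1 h').1
    have e2 : ∀ t, fderiv ℝ η (chart i (s, t)) (e i) = 0 := fun t =>
      (hη.fderiv_apply (e i)).eq_zero_of_notMem fun h' => hm (chart_mem_box.1 h').1
    simp [e1, e2]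

/-- Being the weak derivative is a local property. -/
theorem HasWeakPartial.of_locally {𝕜 : Type*} [RCLike 𝕜] {Ω : Set Plane} {i : Fin 2}
    {f g : Plane → 𝕜} (hf : LocallyIntegrableOn f Ω) (hg : LocallyIntegrableOn g Ω)
    (h : ∀ x ∈ Ω, ∃ U, IsOpen U ∧ x ∈ U ∧ U ⊆ Ω ∧ ∀ η, IsTest U η →
      ∫ x, fderiv ℝ η x (e i) • f x = -∫ x, η x • g x) : HasWeakPartial Ω i f g := by
  refine ⟨hf, hg, fun η h1 h2 h3 => ?_⟩
  have hη : IsTest Ω η := ⟨h1, h2, h3⟩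
  choose U hUo hxU hUΩ hU using h
  obtain ⟨t, ht⟩ := hη.hasCompactSupport.isCompact.elim_finite_subcover
    (fun x : Ω => U x x.2) (fun x => hUo x x.2)
    fun x hx => mem_iUnion.2 ⟨⟨x, h3 hx⟩, hxU x (h3 hx)⟩
  obtain ⟨p, hp⟩ := SmoothPartitionOfUnity.exists_isSubordinate 𝓘(ℝ, Plane)
    (isClosed_tsupport η) (fun x : t => U x.1 x.1.2) (fun x => hUo _ x.1.2) (by
      intro x hx
      obtain ⟨y, hy, hxy⟩ := mem_iUnion₂.1 (ht hx)
      exact mem_iUnion.2 ⟨⟨y, hy⟩, hxy⟩)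
  have hpt : ∀ k : t, IsTest (U k.1 k.1.2) fun x => p k x * η x := fun k => by
    refine ⟨(p k).contMDiff.contDiff.mul h1, h2.mul_left, ?_⟩
    exact (closure_mono (Function.support_mul_subset_left (p k) η)).trans (hp k)
  have hsum : η = fun x => ∑ k : t, p k x * η x := by
    ext x
    rw [← Finset.sum_mul]
    by_cases hx : x ∈ tsupport η
    · have := p.sum_eq_one hx
      rw [finsum_eq_sum_of_fintype] at this
      rw [this, one_mul]
    · rw [image_eq_zero_of_notMem_tsupport hx, mul_zero]
  have hfd : ∀ x, fderiv ℝ η x (e i) = ∑ k : t, fderiv ℝ (fun x => p k x * η x) x (e i) := by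
    intro x
    conv_lhs => rw [hsum]
    rw [fderiv_fun_sum fun k _ => (hpt k).differentiable x, sum_apply]
  have e1 : ∫ x, fderiv ℝ η x (e i) • f x =
      ∑ k : t, ∫ x, fderiv ℝ (fun x => p k x * η x) x (e i) • f x := by
    rw [← integral_finsetSum]
    · simp only [hfd, Finset.sum_smul]
    · exact fun k _ => (((hpt k).mono (hUΩ _ k.1.2)).fderiv_apply (e i)).integrable_smul hf
  have e2 : ∫ x, η x • g x = ∑ k : t, ∫ x, (p k x * η x) • g x := by
    rw [← integral_finsetSum]
    · refine integral_congr_ae (Eventually.of_forall fun x => ?_)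
      simp only
      rw [← Finset.sum_smul, ← congrFun hsum x]
    · exact fun k _ => ((hpt k).mono (hUΩ _ k.1.2)).integrable_smul hg
  rw [e1, e2, ← Finset.sum_neg_distrib]
  exact Finset.sum_congr rfl fun k _ => hU _ k.1.2 _ (hpt k)

/-- A function that is absolutely continuous on almost every line, locally, is weakly
differentiable. -/
theorem HasWeakPartial.of_slices {Ω : Set Plane} {i : Fin 2} {f g : Plane → ℂ}
    (hf : LocallyIntegrableOn f Ω) (hg : LocallyIntegrableOn g Ω)
    (h : ∀ x ∈ Ω, ∃ a b : Fin 2 → ℝ, (∀ k, a k < b k) ∧ x ∈ box a b ∧ closedBox a b ⊆ Ω ∧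
      ∀ᵐ s, s ∈ Ioo (a (i + 1)) (b (i + 1)) →
        HasACRep (a i) (b i) (fun t => f (chart i (s, t))) fun t => g (chart i (s, t))) :
    HasWeakPartial Ω i f g := by
  refine HasWeakPartial.of_locally hf hg fun x hx => ?_
  obtain ⟨a, b, hab, hxb, hsub, hs⟩ := h x hx
  refine ⟨box a b, isOpen_box a b, hxb, (box_subset_closedBox a b).trans hsub, fun η hη => ?_⟩
  exact hη.integral_fderiv_smul_of_slices hab i
    ((hf.integrableOn_closedBox hsub).mono_set (box_subset_closedBox a b))
    ((hg.integrableOn_closedBox hsub).mono_set (box_subset_closedBox a b)) hs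

theorem Plane.ae_coord {P : ℝ → Prop} (h : ∀ᵐ s, P s) (i : Fin 2) : ∀ᵐ x : Plane, P (x i) := by
  have h1 : ∀ᵐ p : ℝ × ℝ, P p.2 := Measure.quasiMeasurePreserving_snd.ae h
  have h2 := (MeasurePreserving.symm (chart i).toHomeomorph.toMeasurableEquiv
    (measurePreserving_chart i)).quasiMeasurePreserving.ae h1
  exact h2

/-- Smooth functions on the line vanishing near a finite set and converging to one off it. -/
theorem exists_contDiff_cutoff (A : Finset ℝ) :
    ∃ χ : ℕ → ℝ → ℝ, (∀ n, ContDiff ℝ ∞ (χ n)) ∧ (∀ n s, ‖χ n s‖ ≤ 1) ∧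
      (∀ n, ∀ c ∈ A, ∀ᶠ s in 𝓝 c, χ n s = 0) ∧
      ∀ s, s ∉ A → Tendsto (fun n => χ n s) atTop (𝓝 1) := by
  let f : ℕ → ∀ c : ℝ, ContDiffBump c := fun n c =>
    { rIn := 1 / ((n : ℝ) + 1) / 2, rOut := 1 / ((n : ℝ) + 1), rIn_pos := by positivity,
      rIn_lt_rOut := half_lt_self (by positivity) }
  refine ⟨fun n s => ∏ c ∈ A, (1 - f n c s), fun n => ?_, fun n s => ?_, fun n c hc => ?_,
    fun s hs => ?_⟩
  · exact contDiff_prod fun c _ => contDiff_const.sub (f n c).contDiff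
  · rw [norm_prod]
    refine Finset.prod_le_one (fun _ _ => norm_nonneg _) fun c _ => ?_
    have h1 := (f n c).nonneg (x := s)
    have h2 := (f n c).le_one (x := s)
    rw [Real.norm_eq_abs, abs_le]
    constructor <;> linarith
  · have h1 : Metric.closedBall c (f n c).rIn ∈ 𝓝 c :=
      Metric.closedBall_mem_nhds c (f n c).rIn_pos
    filter_upwards [h1] with s hs
    refine Finset.prod_eq_zero hc ?_
    rw [(f n c).one_of_mem_closedBall hs, sub_self]
  · have h1 : ∀ c ∈ A, Tendsto (fun n => 1 - f n c s) atTop (𝓝 1) := fun c hc => by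
      have h2 : 0 < dist s c := dist_pos.2 fun h => hs (h ▸ hc)
      have h3 : ∀ᶠ n : ℕ in atTop, 1 / ((n : ℝ) + 1) < dist s c :=
        tendsto_one_div_add_atTop_nhds_zero_nat.eventually_lt_const h2
      refine tendsto_const_nhds.congr' (h3.mono fun n hn => ?_)
      beta_reduce
      rw [(f n c).zero_of_le_dist (show (f n c).rOut ≤ dist s c from hn.le), sub_zero]
    simpa using tendsto_finsetProd A h1

/-- Locally finite sets are removable for weak derivatives in a single direction. -/
theorem HasWeakPartial.of_compl {𝕜 : Type*} [RCLike 𝕜] {V : Set Plane} {i : Fin 2}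
    {f g : Plane → 𝕜} (hV : ∀ K : Set Plane, IsCompact K → (V ∩ K).Finite)
    (h : HasWeakPartial Vᶜ i f g) (hf : LocallyIntegrable f) (hg : LocallyIntegrable g) :
    HasWeakPartial univ i f g := by
  refine ⟨hf.locallyIntegrableOn _, hg.locallyIntegrableOn _, fun η h1 h2 h3 => ?_⟩
  have hη : IsTest univ η := ⟨h1, h2, h3⟩
  have hfin := (hV _ h2.isCompact).image fun x : Plane => x (i + 1)
  -- The cutoff is a function of the coordinate `i + 1` only: it removes whole strips around the
  -- finitely many points, is constant in direction `i`, and hence commutes with ∂ᵢ. No bound on its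
  -- derivative is needed, and the exceptional lines form a null set.
  obtain ⟨χ, hχ, hχ1, hχ0, hχt⟩ := exists_contDiff_cutoff hfin.toFinset
  have hη' : ∀ n, IsTest univ fun x => χ n (x (i + 1)) * η x := fun n =>
    hη.mul_left ((hχ n).comp (by fun_prop))
  have hsupp : ∀ n, tsupport (fun x : Plane => χ n (x (i + 1)) * η x) ⊆ Vᶜ := fun n x hx hxV => by
    have hxK : x ∈ tsupport η :=
      closure_mono (Function.support_mul_subset_right (fun x : Plane => χ n (x (i + 1))) η) hx
    have h4 : ∀ᶠ s in 𝓝 (x (i + 1)), χ n s = 0 :=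
      hχ0 n _ (hfin.mem_toFinset.2 ⟨x, ⟨hxV, hxK⟩, rfl⟩)
    have h5 : ∀ᶠ y : Plane in 𝓝 x, χ n (y (i + 1)) = 0 :=
      (Plane.continuous_apply (i + 1)).continuousAt.eventually h4
    refine (notMem_tsupport_iff_eventuallyEq.2 ?_) hx
    filter_upwards [h5] with y hy
    simp [hy]
  have hfd : ∀ n x, fderiv ℝ (fun x : Plane => χ n (x (i + 1)) * η x) x (e i) =
      χ n (x (i + 1)) * fderiv ℝ η x (e i) := fun n x => by
    have k1 := hasDerivAt_comp_chart (hη' n).differentiable i (x (i + 1)) (x i)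
    have k2 := (hasDerivAt_comp_chart hη.differentiable i (x (i + 1)) (x i)).const_mul
      (χ n (x (i + 1)))
    simp only [chart_apply_add_one] at k1
    have := k1.unique k2
    simpa using this
  have hne : ∀ᵐ x : Plane, x (i + 1) ∉ hfin.toFinset :=
    Plane.ae_coord (hfin.toFinset.finite_toSet.countable.ae_notMem volume) (i + 1)
  have conv : ∀ (z : Plane → ℝ) (u : Plane → 𝕜), IsTest univ z → LocallyIntegrable u →
      Tendsto (fun n => ∫ x, (χ n (x (i + 1)) * z x) • u x) atTop (𝓝 (∫ x, z x • u x)) := by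
    intro z u hz hu
    have hi := hz.integrable_smul (hu.locallyIntegrableOn univ)
    refine tendsto_integral_of_dominated_convergence (fun x => ‖z x • u x‖) (fun n => ?_) hi.norm
      (fun n => Eventually.of_forall fun x => ?_) (hne.mono fun x hx => ?_)
    · simp only [mul_smul]
      exact (((hχ n).continuous.comp (Plane.continuous_apply (i + 1))).aestronglyMeasurable).smul hi.1
    · rw [mul_smul, norm_smul]
      exact mul_le_of_le_one_left (norm_nonneg _) (hχ1 n _)
    · have := (hχt _ hx).smul_const (z x • u x)
      simpa only [mul_smul, one_smul] using this
  have c1 := conv _ f (hη.fderiv_apply (e i)) hf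
  have c2 := (conv _ g hη hg).neg
  refine tendsto_nhds_unique c1 (c2.congr fun n => ?_)
  rw [← h.integral_eq _ (hη' n).contDiff (hη' n).hasCompactSupport (hsupp n)]
  simp only [hfd]

/-! ### Counting the jumps of the phase -/

/-- A ball of radius α/2 contains at most one point of `V`. -/
theorem finite_inter_of_separated {X : Type*} [PseudoMetricSpace X] {V : Set X} {α : ℝ}
    (hα : 0 < α) (hV : ∀ x ∈ V, ∀ y ∈ V, x ≠ y → α ≤ dist x y) {K : Set X} (hK : IsCompact K) :
    (V ∩ K).Finite := by
  obtain ⟨t, -, htf, ht⟩ := hK.finite_cover_balls (e := α / 2) (by linarith)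
  refine (htf.biUnion (t := fun c => V ∩ Metric.ball c (α / 2)) fun c _ => ?_).subset
    fun x hx => ?_
  · refine Set.Subsingleton.finite fun x hx y hy => by_contra fun hne => ?_
    have h1 := hV x hx.1 y hy.1 hne
    have h2 := dist_triangle_right x y c
    linarith [Metric.mem_ball.1 hx.2, Metric.mem_ball.1 hy.2]
  · obtain ⟨c, hc, hxc⟩ := mem_iUnion₂.1 (ht hx.2)
    exact mem_iUnion₂.2 ⟨c, hc, hx.1, hxc⟩

theorem countable_of_finite_inter_compact {V : Set Plane}
    (hV : ∀ K : Set Plane, IsCompact K → (V ∩ K).Finite) : V.Countable := by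
  have : V = ⋃ n : ℕ, V ∩ Metric.closedBall 0 n := by
    rw [← inter_iUnion, Metric.iUnion_closedBall_nat, inter_univ]
  rw [this]
  exact countable_iUnion fun n => (hV _ (isCompact_closedBall _ _)).countable

/-- The integer-valued step function with a unit jump at `c`, vanishing near the origin. -/
noncomputable def stepFun (c t : ℝ) : ℤ := (if c < t then 1 else 0) - if c < 0 then 1 else 0

/-- This is what the normalisation at the origin is for: only points with coordinates no larger in
modulus than those of x contribute to `phaseCount` at x, so the sum over an infinite `V` is locally
finite. -/
theorem abs_le_of_stepFun_ne_zero {c t : ℝ} (h : stepFun c t ≠ 0) : |c| ≤ |t| := by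
  unfold stepFun at h
  split_ifs at h with h1 h2 h2
  · simp at h
  · rw [not_lt] at h2
    rw [abs_of_nonneg h2]
    exact h1.le.trans (le_abs_self t)
  · rw [not_lt] at h1
    rw [abs_of_neg h2, abs_of_neg (h1.trans_lt h2)]
    linarith
  · simp at h

theorem measurable_stepFun (c : ℝ) : Measurable (stepFun c) :=
  (Measurable.ite measurableSet_Ioi measurable_const measurable_const).sub measurable_const

theorem abs_stepFun_le (c t : ℝ) : |(stepFun c t : ℝ)| ≤ 1 := by
  unfold stepFun
  split_ifs <;> simp

theorem stepFun_eq_of_notMem {c l u t t' : ℝ} (hc : c ∉ Ioo l u) (ht : t ∈ Ioo l u)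
    (ht' : t' ∈ Ioo l u) : stepFun c t = stepFun c t' := by
  have : c < t ↔ c < t' := by
    rw [mem_Ioo, not_and_or, not_lt, not_lt] at hc
    rcases hc with hc | hc
    · exact ⟨fun _ => hc.trans_lt ht'.1, fun _ => hc.trans_lt ht.1⟩
    · exact ⟨fun h => absurd h (not_lt.2 (ht.2.le.trans hc)),
        fun h => absurd h (not_lt.2 (ht'.2.le.trans hc))⟩
  simp only [stepFun, this]

/-- The derivative of the step is the Dirac mass at `c`; the normalising constant drops out because
∫ ζ' = 0. -/
theorem integral_stepFun_mul_deriv {ζ : ℝ → ℝ} (hζ : ContDiff ℝ 1 ζ) (hζc : HasCompactSupport ζ)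
    (c : ℝ) : ∫ t, (stepFun c t : ℝ) * deriv ζ t = -ζ c := by
  have hd : Integrable (deriv ζ) :=
    (hζ.continuous_deriv (by norm_num)).integrable_of_hasCompactSupport hζc.deriv
  have h0 : ∫ t, deriv ζ t = 0 := by
    have := integral_of_hasDerivAt_of_tendsto (f := ζ) (f' := deriv ζ) (m := 0) (n := 0)
      (fun x => (hζ.differentiable (by norm_num) x).hasDerivAt) hd
      (hζc.is_zero_at_infty.mono_left atBot_le_cocompact)
      (hζc.is_zero_at_infty.mono_left atTop_le_cocompact)
    simpa using this
  have h1 : ∀ t, (stepFun c t : ℝ) * deriv ζ t =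
      (Ioi c).indicator (deriv ζ) t - (if c < 0 then 1 else 0) * deriv ζ t := fun t => by
    unfold stepFun
    by_cases h : c < t
    · rw [indicator_of_mem (mem_Ioi.2 h), if_pos h]
      push_cast
      ring
    · rw [indicator_of_notMem (fun h' => h (mem_Ioi.1 h')), if_neg h]
      push_cast
      ring
  simp only [h1]
  rw [integral_sub (hd.indicator measurableSet_Ioi) (hd.const_mul _), integral_const_mul, h0,
    mul_zero, sub_zero, integral_indicator measurableSet_Ioi, hζc.integral_Ioi_deriv_eq hζ]

/-- The mixed second derivative of the quadrant function of a point is the Dirac mass at it. -/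
theorem IsTest.integral_stepFun_mul {Ω : Set Plane} (hη : IsTest Ω η) (y : Plane) :
    ∫ x : Plane, ((stepFun (y 0) (x 0) * stepFun (y 1) (x 1) : ℤ) : ℝ) *
      fderiv ℝ (fun x => fderiv ℝ η x (e 1)) x (e 0) = η y := by
  have h1 := hη.fderiv_apply (e 1)
  have h2 := h1.fderiv_apply (e 0)
  have hm : Measurable fun x : Plane => ((stepFun (y 0) (x 0) * stepFun (y 1) (x 1) : ℤ) : ℝ) :=
    measurable_from_top.comp (((measurable_stepFun _).comp (Plane.continuous_apply 0).measurable).mul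
      ((measurable_stepFun _).comp (Plane.continuous_apply 1).measurable))
  have hi : Integrable fun x : Plane => ((stepFun (y 0) (x 0) * stepFun (y 1) (x 1) : ℤ) : ℝ) *
      fderiv ℝ (fun x => fderiv ℝ η x (e 1)) x (e 0) := by
    refine h2.integrable.bdd_mul (c := 1) hm.aestronglyMeasurable
      (Eventually.of_forall fun x => ?_)
    push_cast
    rw [norm_mul]
    exact mul_le_one₀ (abs_stepFun_le _ _) (norm_nonneg _) (abs_stepFun_le _ _)
  rw [integral_eq_integral_integral hi 0]
  have h3 : ∀ s, ∫ t, ((stepFun (y 0) (chart 0 (s, t) 0) * stepFun (y 1) (chart 0 (s, t) 1) : ℤ) : ℝ)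
      * fderiv ℝ (fun x => fderiv ℝ η x (e 1)) (chart 0 (s, t)) (e 0) =
      -((stepFun (y 1) s : ℝ) * deriv (fun t => η (chart 1 (y 0, t))) s) := fun s => by
    have h4 := integral_stepFun_mul_deriv (h1.slice_contDiff 0 s) (h1.slice_hasCompactSupport 0 s)
      (y 0)
    have h5 : chart 1 (y 0, s) = chart 0 (s, y 0) := by
      ext k
      fin_cases k <;> simp [chart_apply]
    simp only [h1.deriv_slice] at h4
    rw [hη.deriv_slice, h5, ← mul_neg, ← h4, ← integral_const_mul]
    congr 1
    ext t
    have : chart 0 (s, t) 1 = s := chart_apply_add_one 0 (s, t)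
    rw [this, chart_apply_self]
    push_cast
    ring
  simp only [h3]
  rw [integral_neg, integral_stepFun_mul_deriv (hη.slice_contDiff 1 _)
    (hη.slice_hasCompactSupport 1 _), neg_neg]
  congr 1
  exact chart_coords 1 y

/-! ### The integer-valued function that carries the quantised vorticity. -/

section PhaseCount

variable {V : Set Plane} (k : V → ℤ)

/-- A locally finite, integer-valued function `N` with `∂₀∂₁N = ∑ kₓ δₓ`. -/
noncomputable def phaseCount (x : Plane) : ℤ :=
  ∑ᶠ y : V, k y * (stepFun (y.1 0) (x 0) * stepFun (y.1 1) (x 1))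

/-- One finite set serves the whole box: the points of `V` in the closed box. It contains every
point that contributes to `phaseCount` on the box, and every point at which a test function
supported in the box can be non-zero. -/
theorem exists_finset_phaseCount (hV : ∀ K : Set Plane, IsCompact K → (V ∩ K).Finite) (M : ℝ) :
    ∃ A : Finset V, (∀ y : V, y.1 ∈ box (fun _ => -M) (fun _ => M) → y ∈ A) ∧
      ∀ x ∈ box (fun _ => -M) (fun _ => M), phaseCount k x =
        ∑ y ∈ A, k y * (stepFun (y.1 0) (x 0) * stepFun (y.1 1) (x 1)) := by
  have hfin : {y : V | y.1 ∈ closedBox (fun _ => -M) (fun _ => M)}.Finite := by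
    refine Set.Finite.of_finite_image (f := Subtype.val)
      ((hV _ (isCompact_closedBox (fun _ => -M) (fun _ => M))).subset ?_)
      Subtype.val_injective.injOn
    rintro _ ⟨y, hy, rfl⟩
    exact ⟨y.2, hy⟩
  refine ⟨hfin.toFinset, fun y hy => hfin.mem_toFinset.2 (box_subset_closedBox _ _ hy),
    fun x hx => finsum_eq_sum_of_support_subset _ fun y hy => ?_⟩
  rw [Finite.coe_toFinset]
  intro i
  have h1 : stepFun (y.1 0) (x 0) ≠ 0 ∧ stepFun (y.1 1) (x 1) ≠ 0 := by
    constructor <;> intro h <;> exact hy (by simp [h])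
  have h2 : |y.1 i| ≤ |x i| := by
    fin_cases i
    · exact abs_le_of_stepFun_ne_zero h1.1
    · exact abs_le_of_stepFun_ne_zero h1.2
  have h3 : |x i| < M := abs_lt.2 (hx i)
  exact abs_le.1 (h2.trans h3.le)

theorem measurable_sum_stepFun (A : Finset V) : Measurable fun x : Plane =>
    ((∑ y ∈ A, k y * (stepFun (y.1 0) (x 0) * stepFun (y.1 1) (x 1)) : ℤ) : ℝ) :=
  measurable_from_top.comp (Finset.measurable_sum _ fun _ _ => measurable_const.mul
    (((measurable_stepFun _).comp (Plane.continuous_apply 0).measurable).mul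
      ((measurable_stepFun _).comp (Plane.continuous_apply 1).measurable)))

theorem abs_sum_stepFun_le (A : Finset V) (x : Plane) :
    |((∑ y ∈ A, k y * (stepFun (y.1 0) (x 0) * stepFun (y.1 1) (x 1)) : ℤ) : ℝ)| ≤
      ∑ y ∈ A, |(k y : ℝ)| := by
  push_cast
  refine (Finset.abs_sum_le_sum_abs _ _).trans (Finset.sum_le_sum fun y _ => ?_)
  rw [abs_mul, abs_mul]
  exact mul_le_of_le_one_right (abs_nonneg _)
    (mul_le_one₀ (abs_stepFun_le _ _) (abs_nonneg _) (abs_stepFun_le _ _))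

/-- The function `N`, composed with a map that preserves all large boxes, is locally integrable. -/
theorem integrableOn_phaseCount_comp (hV : ∀ K : Set Plane, IsCompact K → (V ∩ K).Finite)
    {Φ : Plane → Plane} (hΦ : Measurable Φ) {M : ℝ} {S : Set Plane} (hS : MeasurableSet S)
    (hSM : S ⊆ box (fun _ => -M) (fun _ => M)) (hΦS : MapsTo Φ S (box (fun _ => -M) (fun _ => M))) :
    IntegrableOn (fun x => (phaseCount k (Φ x) : ℝ)) S := by
  obtain ⟨A, -, hA⟩ := exists_finset_phaseCount k hV M
  have hfin : volume S < ⊤ := (measure_mono (hSM.trans (box_subset_closedBox _ _))).trans_lt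
    (isCompact_closedBox _ _).measure_lt_top
  have h1 : IntegrableOn (fun x => ((∑ y ∈ A, k y * (stepFun (y.1 0) (Φ x 0) *
      stepFun (y.1 1) (Φ x 1)) : ℤ) : ℝ)) S :=
    Measure.integrableOn_of_bounded hfin.ne
      ((measurable_sum_stepFun k A).comp hΦ).aestronglyMeasurable
      (Eventually.of_forall fun x => abs_sum_stepFun_le k A (Φ x))
  refine h1.congr_fun (fun x hx => ?_) hS
  simp only [hA _ (hΦS hx)]

theorem locallyIntegrable_phaseCount (hV : ∀ K : Set Plane, IsCompact K → (V ∩ K).Finite) :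
    LocallyIntegrable fun x => (phaseCount k x : ℝ) := by
  refine locallyIntegrable_iff.2 fun K hK => ?_
  obtain ⟨M, -, hM⟩ := exists_box_supset hK
  refine IntegrableOn.mono_set ?_ hM
  exact integrableOn_phaseCount_comp k hV measurable_id (isOpen_box _ _).measurableSet subset_rfl
    (mapsTo_id _)

/-- On a box containing the support of `η` both sides are sums over the same finite set, and the
identity holds term by term. -/
theorem IsTest.integral_phaseCount_mul {Ω : Set Plane} (hη : IsTest Ω η)
    (hV : ∀ K : Set Plane, IsCompact K → (V ∩ K).Finite) :
    ∫ x, (phaseCount k x : ℝ) * fderiv ℝ (fun x => fderiv ℝ η x (e 1)) x (e 0) =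
      ∑ᶠ y : V, (k y : ℝ) * η y := by
  obtain ⟨M, -, hM⟩ := exists_box_supset hη.hasCompactSupport.isCompact
  have hηM : IsTest (box (fun _ => -M) (fun _ => M)) η := ⟨hη.contDiff, hη.hasCompactSupport, hM⟩
  obtain ⟨A, hA1, hA2⟩ := exists_finset_phaseCount k hV M
  have h2 := (hηM.fderiv_apply (e 1)).fderiv_apply (e 0)
  have e1 : ∑ᶠ y : V, (k y : ℝ) * η y = ∑ y ∈ A, (k y : ℝ) * η y := by
    refine finsum_eq_sum_of_support_subset _ fun y hy => hA1 y ?_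
    by_contra hne
    exact hy (by simp [hηM.eq_zero_of_notMem hne])
  have hi : ∀ y : V, Integrable fun x : Plane => ((stepFun (y.1 0) (x 0) * stepFun (y.1 1) (x 1)
      : ℤ) : ℝ) * fderiv ℝ (fun x => fderiv ℝ η x (e 1)) x (e 0) := fun y => by
    refine h2.integrable.bdd_mul (c := 1) ?_ (Eventually.of_forall fun x => ?_)
    · have := measurable_sum_stepFun (fun _ : V => 1) {y}
      simp only [Finset.sum_singleton, one_mul] at this
      exact this.aestronglyMeasurable
    · push_cast
      rw [norm_mul]
      exact mul_le_one₀ (abs_stepFun_le _ _) (norm_nonneg _) (abs_stepFun_le _ _)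
  have e2 : ∀ x, (phaseCount k x : ℝ) * fderiv ℝ (fun x => fderiv ℝ η x (e 1)) x (e 0) =
      ∑ y ∈ A, (k y : ℝ) * (((stepFun (y.1 0) (x 0) * stepFun (y.1 1) (x 1) : ℤ) : ℝ) *
        fderiv ℝ (fun x => fderiv ℝ η x (e 1)) x (e 0)) := fun x => by
    by_cases hx : x ∈ box (fun _ => -M) (fun _ => M)
    · rw [hA2 x hx]
      push_cast
      rw [Finset.sum_mul]
      exact Finset.sum_congr rfl fun y _ => by ring
    · simp only [h2.eq_zero_of_notMem hx, mul_zero, Finset.sum_const_zero]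
  simp only [e1, e2]
  rw [integral_finsetSum _ fun y _ => (hi y).const_mul _]
  refine Finset.sum_congr rfl fun y _ => ?_
  rw [integral_const_mul, hη.integral_stepFun_mul]

/-- On a rectangle without points of `V`, the function `N` is a sum of functions of one variable. -/
theorem phaseCount_add_eq (hV : ∀ K : Set Plane, IsCompact K → (V ∩ K).Finite)
    (hQ : Disjoint (box a b) V) {x c : Plane} (hx : x ∈ box a b) (hc : c ∈ box a b) :
    phaseCount k x + phaseCount k c =
      phaseCount k (chart 1 (x 0, c 1)) + phaseCount k (chart 1 (c 0, x 1)) := by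
  obtain ⟨M, -, hM⟩ := exists_box_supset (isCompact_closedBox a b)
  obtain ⟨A, -, hA⟩ := exists_finset_phaseCount k hV M
  have hM' : ∀ z ∈ box a b, z ∈ box (fun _ => -M) (fun _ => M) := fun z hz =>
    hM (box_subset_closedBox a b hz)
  have h1 : chart 1 (x 0, c 1) ∈ box a b := chart_mem_box.2 ⟨hx 0, hc 1⟩
  have h2 : chart 1 (c 0, x 1) ∈ box a b := chart_mem_box.2 ⟨hc 0, hx 1⟩
  rw [hA _ (hM' _ hx), hA _ (hM' _ hc), hA _ (hM' _ h1), hA _ (hM' _ h2),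
    ← Finset.sum_add_distrib, ← Finset.sum_add_distrib]
  refine Finset.sum_congr rfl fun y _ => ?_
  have e0 : ∀ p : ℝ × ℝ, chart 1 p 0 = p.1 := fun p => chart_apply_add_one 1 p
  simp only [chart_apply_self, e0]
  have hy : y.1 ∉ box a b := fun h => disjoint_left.1 hQ h y.2
  -- A point outside the rectangle misses one of its two coordinate intervals. The corresponding
  -- step is constant on the rectangle, and the mixed difference of the product vanishes.
  have : y.1 0 ∉ Ioo (a 0) (b 0) ∨ y.1 1 ∉ Ioo (a 1) (b 1) := by
    by_contra hcon
    push Not at hcon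
    exact hy (Fin.forall_fin_two.2 hcon)
  rcases this with h | h
  · rw [stepFun_eq_of_notMem h (hx 0) (hc 0)]
    ring
  · rw [stepFun_eq_of_notMem h (hx 1) (hc 1)]

end PhaseCount

/-! ### Potentials of curl-free distributions -/

open scoped Distributions LineDeriv

/-- A test function on the plane, as an element of `𝓓(ℝ²)`. -/
def IsTest.toTestFunction {Ω : Set Plane} (h : IsTest Ω η) :
    𝓓((⊤ : TopologicalSpace.Opens Plane), ℝ) :=
  ⟨η, h.contDiff, h.hasCompactSupport, fun _ _ => trivial⟩

theorem IsTest.coe_toTestFunction {Ω : Set Plane} (h : IsTest Ω η) : ⇑h.toTestFunction = η := rfl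

theorem TestFunction.isTest (ζ : 𝓓((⊤ : TopologicalSpace.Opens Plane), ℝ)) : IsTest univ ζ :=
  ⟨ζ.contDiff, ζ.hasCompactSupport, subset_univ _⟩

theorem TestFunction.lineDerivOp_apply_eq_fderiv
    (ζ : 𝓓((⊤ : TopologicalSpace.Opens Plane), ℝ)) (m x : Plane) :
    (∂_{m} ζ) x = fderiv ℝ ζ x m := by
  rw [TestFunction.lineDerivOp_eq_lineDerivCLM ℝ, TestFunction.lineDerivCLM_apply,
    if_pos (by simp), ((TestFunction.isTest ζ).differentiable x).lineDeriv_eq_fderiv]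

theorem IsTest.fderiv_fderiv_comm {Ω : Set Plane} (h : IsTest Ω η) (v w x : Plane) :
    fderiv ℝ (fun y => fderiv ℝ η y v) x w = fderiv ℝ (fun y => fderiv ℝ η y w) x v := by
  have h1 : ∀ u, fderiv ℝ (fun y => fderiv ℝ η y u) x = (fderiv ℝ (fderiv ℝ η) x).flip u := by
    intro u
    have hd : DifferentiableAt ℝ (fderiv ℝ η) x :=
      (h.contDiff.fderiv_right (m := ∞) (by simp)).differentiable (by simp) x
    exact (fderiv_clm_apply hd (differentiableAt_const u)).trans (by simp)
  rw [h1, h1]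
  exact (h.contDiff.contDiffAt.isSymmSndFDerivAt (n := ∞)
    (by
      rw [minSmoothness_of_isRCLikeNormedField]
      exact WithTop.coe_le_coe.2 (le_top : (2 : ℕ∞) ≤ ⊤))).eq w v

/-- Pairing the vanishing derivative with a step at `x i` recovers -η(x). -/
theorem IsTest.eq_zero_of_fderiv_eq_zero {Ω : Set Plane} (h : IsTest Ω η) (i : Fin 2)
    (h0 : ∀ x, fderiv ℝ η x (e i) = 0) (x : Plane) : η x = 0 := by
  have h1 : ∀ t, deriv (fun t => η (chart i (x (i + 1), t))) t = 0 := fun t => by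
    rw [h.deriv_slice, h0]
  have h2 := integral_stepFun_mul_deriv (h.slice_contDiff i (x (i + 1)))
    (h.slice_hasCompactSupport i (x (i + 1))) (x i)
  simp only [h1, mul_zero, integral_zero, chart_coords] at h2
  linarith

/-- A divergence-free pair of test functions is the rotated gradient of a test function. -/
theorem IsTest.exists_stream {ζ : Plane → ℝ} (hη : IsTest univ η) (hζ : IsTest univ ζ)
    (h : ∀ x, fderiv ℝ η x (e 0) + fderiv ℝ ζ x (e 1) = 0) :
    ∃ E, IsTest univ E ∧ (∀ x, fderiv ℝ E x (e 1) = η x) ∧ ∀ x, fderiv ℝ E x (e 0) = -ζ x := by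
  obtain ⟨M, hM0, hM⟩ := exists_box_supset hη.hasCompactSupport.isCompact
  have hηM : IsTest (box (fun _ => -M) (fun _ => M)) η := ⟨hη.contDiff, hη.hasCompactSupport, hM⟩
  have hz : ∀ s t, t ∉ Ioo (-M) M → η (chart 1 (s, t)) = 0 := fun s t ht =>
    hηM.eq_zero_of_notMem fun hm => ht (chart_mem_box.1 hm).2
  have hz' : ∀ s t, s ∉ Ioo (-M) M → η (chart 1 (s, t)) = 0 := fun s t ht =>
    hηM.eq_zero_of_notMem fun hm => ht (chart_mem_box.1 hm).1
  have hd0 : ∀ s t, t ∉ Ioo (-M) M → fderiv ℝ η (chart 1 (s, t)) (e 0) = 0 := fun s t ht =>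
    (hηM.fderiv_apply (e 0)).eq_zero_of_notMem fun hm => ht (chart_mem_box.1 hm).2
  have hF : ContDiff ℝ ∞ fun p : ℝ × ℝ => η (chart 1 p) := hη.contDiff.comp (chart 1).contDiff
  -- The derivative in s is ∫ ∂₀η dt = -∫ ∂₁ζ dt = 0. The line integrals of `η` are therefore
  -- constant in s, hence zero, and `η` has a compactly supported primitive in direction 1.
  have hderiv : ∀ s, HasDerivAt (fun s => ∫ t in (-M)..M, η (chart 1 (s, t))) 0 s := by
    intro s
    have h1 := (hasFDerivAt_intervalIntegral_of_contDiff (hF.of_le (by exact_mod_cast le_top))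
      (-M) M s).hasDerivAt
    refine h1.congr_deriv ?_
    have hc : Continuous fun t => (fderiv ℝ (fun p : ℝ × ℝ => η (chart 1 p)) (s, t)).comp
        (ContinuousLinearMap.inl ℝ ℝ ℝ) :=
      ((hF.continuous_fderiv (by simp)).comp (Continuous.prodMk_right s)).clm_comp
        continuous_const
    rw [ContinuousLinearMap.intervalIntegral_apply (hc.intervalIntegrable _ _)]
    have h2 : ∀ t, ((fderiv ℝ (fun p : ℝ × ℝ => η (chart 1 p)) (s, t)).comp
        (ContinuousLinearMap.inl ℝ ℝ ℝ)) 1 = fderiv ℝ η (chart 1 (s, t)) (e 0) := fun t => by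
      have h3 : HasFDerivAt (fun p : ℝ × ℝ => η (chart 1 p))
          ((fderiv ℝ η (chart 1 (s, t))).comp (chart 1 : ℝ × ℝ →L[ℝ] Plane)) (s, t) :=
        ((hη.differentiable _).hasFDerivAt).comp (s, t) (chart 1).hasFDerivAt
      rw [h3.fderiv]
      have : chart 1 (1, 0) = e 0 := by
        ext k
        fin_cases k <;> simp [chart_apply, e]
      simp [this]
    simp only [h2]
    rw [intervalIntegral_eq_integral_of_eq_zero
      (fun t ht => hd0 s t fun h' => ht (Ioo_subset_Icc_self h')) (by linarith)]
    have h4 : ∀ t, fderiv ℝ η (chart 1 (s, t)) (e 0) =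
        -fderiv ℝ ζ (chart 1 (s, t)) (e 1) := fun t => by linarith [h (chart 1 (s, t))]
    simp only [h4, ← hζ.deriv_slice]
    have h5 := integral_of_hasDerivAt_of_tendsto (m := 0) (n := 0)
      (f := fun t => ζ (chart 1 (s, t)))
      (fun t => ((hζ.slice_contDiff 1 s).differentiable (by norm_num) t).hasDerivAt)
      (((hζ.slice_contDiff 1 s).continuous_deriv (by norm_num)).integrable_of_hasCompactSupport
        (hζ.slice_hasCompactSupport 1 s).deriv)
      ((hζ.slice_hasCompactSupport 1 s).is_zero_at_infty.mono_left atBot_le_cocompact)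
      ((hζ.slice_hasCompactSupport 1 s).is_zero_at_infty.mono_left atTop_le_cocompact)
    rw [integral_neg, h5]
    simp
  have hconst : ∀ s, ∫ t in (-M)..M, η (chart 1 (s, t)) = 0 := fun s => by
    rw [is_const_of_deriv_eq_zero (fun s => (hderiv s).differentiableAt)
      (fun s => (hderiv s).deriv) s M]
    simp only [hz' M _ (by simp), intervalIntegral.integral_zero]
  obtain ⟨E, hE, hE'⟩ := hηM.exists_primitive 1 fun s => by
    rw [← hconst s, intervalIntegral_eq_integral_of_eq_zero
      (fun t ht => hz s t fun h' => ht (Ioo_subset_Icc_self h')) (by linarith)]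
  have hEu : IsTest univ E := hE.mono (subset_univ _)
  refine ⟨E, hEu, hE', fun x => ?_⟩
  -- The function ∂₀E + ζ has compact support and ∂₁ of it is ∂₀η + ∂₁ζ = 0, so it vanishes.
  have hsum : IsTest univ fun x => fderiv ℝ E x (e 0) - (-1) * ζ x :=
    (hEu.fderiv_apply (e 0)).sub (hζ.mul_left contDiff_const)
  have h0 := hsum.eq_zero_of_fderiv_eq_zero 1 (fun y => ?_) x
  · linarith
  · rw [fderiv_fun_sub ((hEu.fderiv_apply (e 0)).differentiable y)
      ((hζ.differentiable y).const_mul (-1)), fderiv_const_mul (hζ.differentiable y),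
      sub_apply, smul_apply, hEu.fderiv_fderiv_comm]
    have : (fun y => fderiv ℝ E y (e 1)) = η := funext hE'
    rw [this, smul_eq_mul]
    linarith [h y]

/-- A curl-free pair of linear functionals on test functions is the gradient of a linear
functional. -/
theorem exists_potential (v : Fin 2 → 𝓓((⊤ : TopologicalSpace.Opens Plane), ℝ) →ₗ[ℝ] ℝ)
    (hv : ∀ ζ : 𝓓((⊤ : TopologicalSpace.Opens Plane), ℝ),
      v 0 (∂_{e 1} ζ) = v 1 (∂_{e 0} ζ)) :
    ∃ T : 𝓓((⊤ : TopologicalSpace.Opens Plane), ℝ) →ₗ[ℝ] ℝ, ∀ i ζ, T (∂_{e i} ζ) = -v i ζ := by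
  let D : Fin 2 → 𝓓((⊤ : TopologicalSpace.Opens Plane), ℝ) →ₗ[ℝ]
      𝓓((⊤ : TopologicalSpace.Opens Plane), ℝ) :=
    fun i => (TestFunction.lineDerivCLM ℝ (e i)).toLinearMap
  have hD : ∀ i ζ, D i ζ = ∂_{e i} ζ := fun _ _ => rfl
  -- The potential is a factorisation of -(v₀, v₁) through the divergence (p, q) ↦ ∂₀p + ∂₁q. By
  -- linear algebra it suffices that -(v₀, v₁) vanishes on divergence-free pairs, which are rotated
  -- gradients. Continuity of T plays no role.
  let A := (D 0).coprod (D 1)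
  let B := -((v 0).coprod (v 1))
  have hB : B ∈ (LinearMap.ker A).dualAnnihilator := by
    rw [Submodule.mem_dualAnnihilator]
    rintro ⟨p, q⟩ hpq
    rw [LinearMap.mem_ker] at hpq
    have h0 : ∀ x, fderiv ℝ p x (e 0) + fderiv ℝ q x (e 1) = 0 := fun x => by
      rw [← TestFunction.lineDerivOp_apply_eq_fderiv, ← TestFunction.lineDerivOp_apply_eq_fderiv]
      exact congrArg (fun ζ : 𝓓((⊤ : TopologicalSpace.Opens Plane), ℝ) => ζ x) hpq
    obtain ⟨E, hE, h1, h2⟩ := (TestFunction.isTest p).exists_stream (TestFunction.isTest q) h0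
    have e1 : ∂_{e 1} hE.toTestFunction = p := TestFunction.ext fun x => by
      rw [TestFunction.lineDerivOp_apply_eq_fderiv, hE.coe_toTestFunction, h1]
    have e2 : ∂_{e 0} hE.toTestFunction = -q := TestFunction.ext fun x => by
      rw [TestFunction.lineDerivOp_apply_eq_fderiv, hE.coe_toTestFunction, h2]
      rfl
    have h3 := hv hE.toTestFunction
    rw [e1, e2, map_neg] at h3
    change -(v 0 p + v 1 q) = 0
    rw [h3]
    ring
  rw [← LinearMap.range_dualMap_eq_dualAnnihilator_ker] at hB
  obtain ⟨T, hT⟩ := hB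
  have hT' : ∀ p q, T (∂_{e 0} p + ∂_{e 1} q) = -(v 0 p + v 1 q) := fun p q =>
    LinearMap.congr_fun hT (p, q)
  refine ⟨T, fun i ζ => ?_⟩
  fin_cases i
  · have := hT' ζ 0
    simp only [← hD, map_zero, add_zero] at this
    exact this
  · have := hT' 0 ζ
    simp only [← hD, map_zero, zero_add] at this
    exact this

/-! ### Local phases -/

theorem IsTest.tensor {β γ : ℝ → ℝ} (hβ : ContDiff ℝ ∞ β) (hβc : HasCompactSupport β)
    (hβs : tsupport β ⊆ Ioo (a 1) (b 1)) (hγ : ContDiff ℝ ∞ γ) (hγc : HasCompactSupport γ)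
    (hγs : tsupport γ ⊆ Ioo (a 0) (b 0)) : IsTest (box a b) fun x => β (x 1) * γ (x 0) := by
  obtain ⟨c, d, hc, hd, hcd⟩ := hβc.isCompact.exists_Icc_of_subset_Ioo hβs
  obtain ⟨c', d', hc', hd', hcd'⟩ := hγc.isCompact.exists_Icc_of_subset_Ioo hγs
  refine IsTest.of_closedBox (a' := ![c', c]) (b' := ![d', d]) (Fin.forall_fin_two.2 ⟨hc', hc⟩)
    (Fin.forall_fin_two.2 ⟨hd', hd⟩) ?_ fun x hx => ?_
  · exact (hβ.comp (by fun_prop)).mul (hγ.comp (by fun_prop))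
  · by_contra hne
    refine hx (Fin.forall_fin_two.2 ⟨hcd' ?_, hcd ?_⟩)
    · exact subset_tsupport _ (right_ne_zero_of_mul hne)
    · exact subset_tsupport _ (left_ne_zero_of_mul hne)

/-- A linear functional on the test functions of a rectangle whose gradient is an integrable
function is itself given by an integrable function. -/
theorem exists_density (hab : ∀ k, a k < b k) (T : (Plane → ℝ) → ℝ)
    (hadd : ∀ η ζ, IsTest (box a b) η → IsTest (box a b) ζ →
      T (fun x => η x - ζ x) = T η - T ζ)
    (hsmul : ∀ (c : ℝ) η, IsTest (box a b) η → T (fun x => c * η x) = c * T η)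
    {v : Fin 2 → Plane → ℝ} (hv : ∀ i, IntegrableOn (v i) (box a b))
    (hT : ∀ i η, IsTest (box a b) η → T (fun x => fderiv ℝ η x (e i)) = -∫ x, η x * v i x) :
    ∃ g, IntegrableOn g (box a b) ∧ ∀ η, IsTest (box a b) η → T η = ∫ x, η x * g x := by
  have hQm := (isOpen_box a b).measurableSet
  have hvi : ∀ i, Integrable ((box a b).indicator (v i)) := fun i =>
    (integrable_indicator_iff hQm).2 (hv i)
  choose G hG hvG using fun i => (hvi i).1
  have hGi : ∀ i, Integrable (G i) := fun i => (hvi i).congr (hvG i)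
  have hT' : ∀ i η, IsTest (box a b) η → T (fun x => fderiv ℝ η x (e i)) =
      ∫ x, fderiv ℝ η x (e i) * linePrimitive i (G i) x := fun i η hη => by
    rw [hT i η hη, hη.integral_fderiv_mul_linePrimitive i (hG i) (hGi i)]
    congr 1
    refine integral_congr_ae ((hvG i).mono fun x hx => ?_)
    beta_reduce
    rw [← hx]
    by_cases hm : x ∈ box a b
    · rw [indicator_of_mem hm]
    · rw [hη.eq_zero_of_notMem hm, zero_mul, zero_mul]
  set u : Fin 2 → Plane → ℝ := fun i => linePrimitive i (G i) with hu
  have hui : ∀ i, IntegrableOn (u i) (box a b) := fun i =>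
    integrableOn_linePrimitive i (hG i) (hGi i) a b
  obtain ⟨β, hβ, hβc, hβs, hβ1⟩ := exists_contDiff_bump_integral_eq_one (hab 1)
  obtain ⟨γ, hγ, hγc, hγs, hγ1⟩ := exists_contDiff_bump_integral_eq_one (hab 0)
  have hB : IsTest (box a b) fun x => β (x 1) * γ (x 0) :=
    IsTest.tensor hβ hβc hβs hγ hγc hγs
  set w : Fin 2 → Plane → ℝ := fun i x =>
    ∫ c, β c * (box a b).indicator (u i) (chart 1 (x (1 + 1), c)) with hw
  have hwi : ∀ i, IntegrableOn (w i) (box a b) := fun i => by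
    obtain ⟨hint, -⟩ := IsTest.integral_average_mul
      (η := fun _ => 0) ⟨contDiff_const, HasCompactSupport.zero, by simp⟩ 1 hβ hβc hβs (hui i)
    exact (integrable_indicator_iff hQm).1 hint
  -- Each `η` decomposes as ∂₁E + ∂₀E₂ + (∫η) β⊗γ, through its average `A` in direction 1. The first
  -- two terms are evaluated with `u 1` and `u 0`; moving the averaging onto these functions
  -- produces `w 1` and `w 0`. The constant `κ` collects the contributions of β⊗γ.
  set κ : ℝ := T (fun x => β (x 1) * γ (x 0)) - ∫ x, β (x 1) * γ (x 0) * u 0 x with hκ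
  have hfin : volume (box a b) ≠ ⊤ := ((measure_mono (box_subset_closedBox a b)).trans_lt
    (isCompact_closedBox a b).measure_lt_top).ne
  refine ⟨fun x => u 1 x - w 1 x + w 0 x + κ,
    (((hui 1).sub (hwi 1)).add (hwi 0)).add (integrableOn_const hfin), fun η hη => ?_⟩
  have hA := hη.average 1 hβ hβc hβs
  set A : Plane → ℝ := fun x => (∫ t, η (chart 1 (x (1 + 1), t))) * β (x 1) with hAdef
  obtain ⟨E, hE, hE'⟩ := (hη.sub hA).exists_primitive 1 fun s => by
    simp only [hAdef, chart_apply_add_one, chart_apply_self]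
    rw [integral_sub (hη.slice_integrable 1 s)
      ((hβ.continuous.integrable_of_hasCompactSupport hβc).const_mul _), integral_const_mul, hβ1,
      mul_one, sub_self]
  have hAint : ∀ s, ∫ t, A (chart 0 (s, t)) = (∫ x, η x) * β s := fun s => by
    have e0 : ∀ t, A (chart 0 (s, t)) = (∫ τ, η (chart 1 (t, τ))) * β s := fun t => by
      have h1 : chart 0 (s, t) 1 = s := chart_apply_add_one 0 (s, t)
      have h2 : chart 0 (s, t) (1 + 1) = t := chart_apply_self 0 (s, t)
      simp only [hAdef, h1, h2]
    simp only [e0]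
    rw [integral_mul_const, ← integral_eq_integral_integral hη.integrable 1]
  have hB' : IsTest (box a b) fun x => (∫ x, η x) * (β (x 1) * γ (x 0)) :=
    hB.mul_left contDiff_const
  obtain ⟨E₂, hE₂, hE₂'⟩ := (hA.sub hB').exists_primitive 0 fun s => by
    have e1 : ∀ t, chart 0 (s, t) 1 = s := fun t => chart_apply_add_one 0 (s, t)
    simp only [e1, chart_apply_self]
    rw [integral_sub (hA.slice_integrable 0 s)
      (((hγ.continuous.integrable_of_hasCompactSupport hγc).const_mul _).const_mul _), hAint,
      integral_const_mul, integral_const_mul, hγ1, mul_one, sub_self]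
  have t1 := hT' 1 E hE
  have t2 := hT' 0 E₂ hE₂
  simp only [hE'] at t1
  simp only [hE₂'] at t2
  rw [hadd _ _ hη hA] at t1
  rw [hadd _ _ hA hB', hsmul _ _ hB] at t2
  have mulI : ∀ {ζ g : Plane → ℝ}, IsTest (box a b) ζ → IntegrableOn g (box a b) →
      Integrable fun x => ζ x * g x := fun hζ hg =>
    hζ.integrable_mul_of_integrableOn (isOpen_box a b) hg
  simp only [sub_mul] at t1 t2
  rw [integral_sub (mulI hη (hui 1)) (mulI hA (hui 1))] at t1
  rw [integral_sub (mulI hA (hui 0)) (mulI hB' (hui 0))] at t2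
  have a1 : ∫ x, A x * u 1 x = ∫ x, η x * w 1 x :=
    (hη.integral_average_mul 1 hβ hβc hβs (hui 1)).2
  have a0 : ∫ x, A x * u 0 x = ∫ x, η x * w 0 x :=
    (hη.integral_average_mul 1 hβ hβc hβs (hui 0)).2
  have b0 : ∫ x, (∫ x, η x) * (β (x 1) * γ (x 0)) * u 0 x =
      (∫ x, η x) * ∫ x, β (x 1) * γ (x 0) * u 0 x := by
    rw [← integral_const_mul]
    congr 1
    ext x
    ring
  have i1 := mulI hη (hui 1)
  have i2 := mulI hη (hwi 1)
  have i3 := mulI hη (hwi 0)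
  have final : ∫ x, η x * (u 1 x - w 1 x + w 0 x + κ) =
      (∫ x, η x * u 1 x) - (∫ x, η x * w 1 x) + (∫ x, η x * w 0 x) + (∫ x, η x) * κ := by
    have i12 : Integrable fun x => η x * u 1 x - η x * w 1 x := i1.sub i2
    have i123 : Integrable fun x => η x * u 1 x - η x * w 1 x + η x * w 0 x := i12.add i3
    rw [← integral_mul_const, ← integral_sub i1 i2, ← integral_add i12 i3,
      ← integral_add i123 (hη.integrable.mul_const κ)]
    congr 1
    ext x
    ring
  rw [final, hκ]
  rw [a1] at t1
  rw [a0, b0] at t2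
  linarith

/-- Functions of the other coordinate have vanishing weak derivative. -/
theorem IsTest.integral_fderiv_mul_of_coord (hη : IsTest (box a b) η) (i : Fin 2) {W : Plane → ℝ}
    (hW : IntegrableOn W (box a b)) {w : ℝ → ℝ} (h : ∀ x ∈ box a b, W x = w (x (i + 1))) :
    ∫ x, fderiv ℝ η x (e i) * W x = 0 := by
  have hd := hη.fderiv_apply (e i)
  have h1 := hd.integrable_mul_of_integrableOn (isOpen_box a b) hW
  simp only [smul_eq_mul] at h1
  rw [integral_eq_integral_integral h1 i]
  have h2 : ∀ s, ∫ t, fderiv ℝ η (chart i (s, t)) (e i) * W (chart i (s, t)) = 0 := fun s => by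
    have e1 : ∀ t, fderiv ℝ η (chart i (s, t)) (e i) * W (chart i (s, t)) =
        deriv (fun t => η (chart i (s, t))) t * w s := fun t => by
      rw [hη.deriv_slice]
      by_cases hm : chart i (s, t) ∈ box a b
      · rw [h _ hm, chart_apply_add_one]
      · have := hd.eq_zero_of_notMem hm
        rw [this, zero_mul, zero_mul]
    simp only [e1]
    have h5 := integral_of_hasDerivAt_of_tendsto (m := 0) (n := 0)
      (f := fun t => η (chart i (s, t)))
      (fun t => ((hη.slice_contDiff i s).differentiable (by norm_num) t).hasDerivAt)
      (((hη.slice_contDiff i s).continuous_deriv (by norm_num)).integrable_of_hasCompactSupport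
        (hη.slice_hasCompactSupport i s).deriv)
      ((hη.slice_hasCompactSupport i s).is_zero_at_infty.mono_left atBot_le_cocompact)
      ((hη.slice_hasCompactSupport i s).is_zero_at_infty.mono_left atTop_le_cocompact)
    rw [integral_mul_const, h5]
    simp
  simp [h2]

/-- Off the points of `V`, a potential of a vector field with quantised vorticity is locally, up
to multiples of `2π`, a function with the vector field as weak gradient. -/
theorem exists_local_phase {V : Set Plane} (k : V → ℤ)
    (hV : ∀ K : Set Plane, IsCompact K → (V ∩ K).Finite) (hab : ∀ k, a k < b k)
    (hQ : Disjoint (box a b) V) {u : Fin 2 → Plane → ℝ} (hu : ∀ i, IntegrableOn (u i) (box a b))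
    (T : 𝓓((⊤ : TopologicalSpace.Opens Plane), ℝ) →ₗ[ℝ] ℝ)
    (hT0 : ∀ η (hη : IsTest (box a b) η), T (∂_{e 0} hη.toTestFunction) =
      -((∫ x, η x * u 0 x) - 2 * Real.pi * ∫ x, (phaseCount k x : ℝ) * fderiv ℝ η x (e 0)))
    (hT1 : ∀ η (hη : IsTest (box a b) η), T (∂_{e 1} hη.toTestFunction) = -∫ x, η x * u 1 x) :
    ∃ f g : Plane → ℝ, IntegrableOn f (box a b) ∧ IntegrableOn g (box a b) ∧
      (∀ η (hη : IsTest (box a b) η), T hη.toTestFunction = ∫ x, η x * f x) ∧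
      (∀ i, HasWeakPartial (box a b) i g (u i)) ∧
      ∀ x ∈ box a b, Complex.exp (Complex.I * f x) = Complex.exp (Complex.I * g x) := by
  classical
  have hQm := (isOpen_box a b).measurableSet
  obtain ⟨M, -, hM⟩ := exists_box_supset (isCompact_closedBox a b)
  have hM' : box a b ⊆ box (fun _ => -M) (fun _ => M) := (box_subset_closedBox a b).trans hM
  let c : Plane := chart 1 ((a 0 + b 0) / 2, (a 1 + b 1) / 2)
  have hc : c ∈ box a b := chart_mem_box.2
    ⟨show (a 0 + b 0) / 2 ∈ Ioo (a 0) (b 0) from ⟨by linarith [hab 0], by linarith [hab 0]⟩,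
      show (a 1 + b 1) / 2 ∈ Ioo (a 1) (b 1) from ⟨by linarith [hab 1], by linarith [hab 1]⟩⟩
  -- On the rectangle N - A depends on x₁ only, so ∂₀A = ∂₀N, while ∂₁A = 0. Subtracting 2πA from T
  -- thus turns its gradient (v₀ + 2π∂₀N, v₁) into v.
  let A : Plane → ℝ := fun x => (phaseCount k (chart 1 (x 0, c 1)) : ℝ)
  have hAi : IntegrableOn A (box a b) := by
    refine integrableOn_phaseCount_comp k hV (Φ := fun x => chart 1 (x 0, c 1)) ?_ hQm hM' ?_
    · exact (chart 1).continuous.measurable.comp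
        ((Plane.continuous_apply 0).measurable.prodMk measurable_const)
    · exact fun x hx => hM' (chart_mem_box.2 ⟨hx 0, hc 1⟩)
  have hNi : IntegrableOn (fun x => (phaseCount k x : ℝ)) (box a b) :=
    integrableOn_phaseCount_comp k hV measurable_id hQm hM' hM'
  have mulI : ∀ {ζ g : Plane → ℝ}, IsTest (box a b) ζ → IntegrableOn g (box a b) →
      Integrable fun x => ζ x * g x := fun hζ hg =>
    hζ.integrable_mul_of_integrableOn (isOpen_box a b) hg
  -- The default value 0 is immaterial: `T'` is only evaluated at test functions of the rectangle.
  let T' : (Plane → ℝ) → ℝ := fun η =>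
    (if h : IsTest (box a b) η then T h.toTestFunction else 0) - 2 * Real.pi * ∫ x, η x * A x
  have hT' : ∀ η (h : IsTest (box a b) η),
      T' η = T h.toTestFunction - 2 * Real.pi * ∫ x, η x * A x := fun η h => by
    simp only [T', dif_pos h]
  have hTd : ∀ i η, IsTest (box a b) η → T' (fun x => fderiv ℝ η x (e i)) =
      -∫ x, η x * u i x := by
    intro i η hη
    have hd := hη.fderiv_apply (e i)
    have e1 : hd.toTestFunction = ∂_{e i} hη.toTestFunction := TestFunction.ext fun x => by
      rw [TestFunction.lineDerivOp_apply_eq_fderiv]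
      rfl
    rw [hT' _ hd, e1]
    revert hd e1
    fin_cases i
    · intro hd _
      have hd' : IsTest (box a b) fun x => fderiv ℝ η x (e 0) := hd
      have h0 := hη.integral_fderiv_mul_of_coord 0 (hNi.sub hAi)
        (w := fun s => (phaseCount k (chart 1 (c 0, s)) : ℝ) - phaseCount k c) fun x hx => by
        have := phaseCount_add_eq k hV hQ hx hc
        have h' : (phaseCount k x : ℝ) + phaseCount k c =
          phaseCount k (chart 1 (x 0, c 1)) + phaseCount k (chart 1 (c 0, x 1)) := by
          exact_mod_cast this
        simp only [Pi.sub_apply, A]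
        change _ = (phaseCount k (chart 1 (c 0, x 1)) : ℝ) - phaseCount k c
        linarith
      simp only [Pi.sub_apply, mul_sub] at h0
      rw [integral_sub (mulI hd' hNi) (mulI hd' hAi), sub_eq_zero] at h0
      have h1 := hT0 η hη
      simp only [mul_comm (phaseCount k _ : ℝ)] at h1
      change T (∂_{e 0} hη.toTestFunction) - 2 * Real.pi * ∫ x, fderiv ℝ η x (e 0) * A x =
        -∫ x, η x * u 0 x
      rw [h1, h0]
      ring
    · intro hd _
      have h0 := hη.integral_fderiv_mul_of_coord 1 hAi
        (w := fun s => (phaseCount k (chart 1 (s, c 1)) : ℝ)) fun x hx => rfl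
      change T (∂_{e 1} hη.toTestFunction) - 2 * Real.pi * ∫ x, fderiv ℝ η x (e 1) * A x =
        -∫ x, η x * u 1 x
      rw [h0, hT1 η hη, mul_zero, sub_zero]
  obtain ⟨g, hg, hgT⟩ := exists_density hab T' (fun η ζ hη hζ => by
      rw [hT' _ hη, hT' _ hζ, hT' _ (hη.sub hζ)]
      have e1 : (hη.sub hζ).toTestFunction = hη.toTestFunction - hζ.toTestFunction :=
        TestFunction.ext fun x => rfl
      rw [e1, map_sub]
      simp only [sub_mul]
      rw [integral_sub (mulI hη hAi) (mulI hζ hAi)]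
      ring) (fun r η hη => by
      have h1 : IsTest (box a b) fun x => r * η x := hη.mul_left contDiff_const
      rw [hT' _ hη, hT' _ h1]
      have e1 : h1.toTestFunction = r • hη.toTestFunction := TestFunction.ext fun x => rfl
      rw [e1, map_smul, smul_eq_mul]
      simp only [mul_assoc]
      rw [integral_const_mul]
      ring) hu hTd
  refine ⟨fun x => g x + 2 * Real.pi * A x, g, hg.add (hAi.const_mul _), hg, fun η hη => ?_,
    fun i => ⟨hg.locallyIntegrableOn, (hu i).locallyIntegrableOn, fun η h1 h2 h3 => ?_⟩,
    fun x _ => ?_⟩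
  · have h1 := hgT η hη
    rw [hT' η hη] at h1
    simp only [mul_add]
    rw [integral_add (mulI hη hg) (mulI hη (hAi.const_mul _)), ← h1]
    have : ∫ x, η x * (2 * Real.pi * A x) = 2 * Real.pi * ∫ x, η x * A x := by
      rw [← integral_const_mul]
      congr 1
      ext x
      ring
    rw [this]
    ring
  · have hη : IsTest (box a b) η := ⟨h1, h2, h3⟩
    have := hgT _ (hη.fderiv_apply (e i))
    rw [hTd i η hη] at this
    simpa using this.symm
  · rw [Complex.exp_eq_exp_iff_exists_int]
    refine ⟨phaseCount k (chart 1 (x 0, c 1)), ?_⟩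
    simp only [A]
    push_cast
    ring

/-! ### The global phase -/

/-- Functions on open sets that agree almost everywhere on the overlaps can be glued. -/
theorem exists_ae_glue {ι : Type*} {U : ι → Set Plane} (hU : ∀ i, IsOpen (U i))
    {f : ι → Plane → ℝ} (hf : ∀ i, AEStronglyMeasurable (f i) (volume.restrict (U i)))
    (h : ∀ i j, ∀ᵐ z, z ∈ U i → z ∈ U j → f i z = f j z) :
    ∃ F : Plane → ℝ, AEStronglyMeasurable F (volume.restrict (⋃ i, U i)) ∧
      ∀ i, ∀ᵐ z, z ∈ U i → F z = f i z := by
  classical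
  -- By the Lindelöf property countably many of the sets suffice. `F` may then choose any index of
  -- `S` at each point, as the exceptional sets still have null union.
  obtain ⟨S, hS, hSU⟩ := TopologicalSpace.isOpen_iUnion_countable U hU
  have hsel : ∀ z, ∃ g : ℝ, ∀ (_ : z ∈ ⋃ i, U i), ∃ i ∈ S, z ∈ U i ∧ g = f i z := fun z => by
    by_cases hz : z ∈ ⋃ i, U i
    · have hz' := hz
      rw [← hSU, mem_iUnion₂] at hz'
      obtain ⟨i, hi, hzi⟩ := hz'
      exact ⟨f i z, fun _ => ⟨i, hi, hzi, rfl⟩⟩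
    · exact ⟨0, fun h => absurd h hz⟩
  choose F hF using hsel
  have hFi : ∀ i, ∀ᵐ z, z ∈ U i → F z = f i z := fun i => by
    filter_upwards [(ae_ball_iff hS).2 fun j _ => h j i] with z hz hzi
    obtain ⟨j, hj, hzj, e1⟩ := hF z (mem_iUnion_of_mem i hzi)
    rw [e1, hz j hj hzj hzi]
  refine ⟨F, ?_, hFi⟩
  rw [← hSU, biUnion_eq_iUnion]
  have := hS.to_subtype
  refine aestronglyMeasurable_iUnion_iff.2 fun i => (hf i).congr ?_
  exact (ae_restrict_iff' (hU i).measurableSet).2 ((hFi i).mono fun z hz hm => (hz hm).symm)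

theorem ae_eq_of_forall_isTest {U : Set Plane} (hU : IsOpen U) {f g : Plane → ℝ}
    (hf : LocallyIntegrableOn f U) (hg : LocallyIntegrableOn g U)
    (h : ∀ η, IsTest U η → ∫ x, η x * f x = ∫ x, η x * g x) : ∀ᵐ z, z ∈ U → f z = g z := by
  have := hU.ae_eq_zero_of_integral_contDiff_smul_eq_zero (μ := volume) (f := fun x => f x - g x)
    (hf.sub hg) fun η h1 h2 h3 => by
      have hη : IsTest U η := ⟨h1, h2, h3⟩
      have i1 := hη.integrable_smul hf
      have i2 := hη.integrable_smul hg
      simp only [smul_eq_mul, mul_sub] at i1 i2 ⊢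
      rw [integral_sub i1 i2, h η hη, sub_self]
  exact this.mono fun z hz hm => sub_eq_zero.1 (hz hm)

section Phase

variable {r : Plane → ℝ} {Λ : Plane → Plane}

theorem isClosed_vacuum (hr : Continuous r) : IsClosed (vacuum r) :=
  isClosed_singleton.preimage hr

theorem locallyIntegrableOn_velocity (hr : Continuous r) (hΛ : LocallyIntegrable Λ) :
    LocallyIntegrableOn (velocity r Λ) (vacuum r)ᶜ := by
  have h1 : ContinuousOn (fun x => (r x ^ 2)⁻¹ * r x) (vacuum r)ᶜ :=
    ((hr.pow 2).continuousOn.inv₀ fun x hx => pow_ne_zero 2 hx).mul hr.continuousOn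
  have h2 := (hΛ.locallyIntegrableOn (vacuum r)ᶜ).continuousOn_smul
    (isClosed_vacuum hr).isOpen_compl.isLocallyClosed h1
  exact h2.congr (Eventually.of_forall fun x => by simp [velocity, momentum, smul_smul])

theorem MeasureTheory.LocallyIntegrableOn.euclidean_apply {Ω : Set Plane} {u : Plane → Plane}
    (hu : LocallyIntegrableOn u Ω) (i : Fin 2) : LocallyIntegrableOn (fun x => u x i) Ω :=
  fun x hx => by
    obtain ⟨s, hs, hi⟩ := hu x hx
    exact ⟨s, hs, (EuclideanSpace.proj i : Plane →L[ℝ] ℝ).integrable_comp hi⟩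

/-- A vector field with quantised vorticity has a potential, after the jumps of the phase are
taken into account. -/
theorem HasQuantisedVorticity.exists_potential (hr : Continuous r) (hΛ : LocallyIntegrable Λ)
    (hV : ∀ K : Set Plane, IsCompact K → (vacuum r ∩ K).Finite)
    (h : HasQuantisedVorticity r Λ) :
    ∃ (k : vacuum r → ℤ) (T : 𝓓((⊤ : TopologicalSpace.Opens Plane), ℝ) →ₗ[ℝ] ℝ),
      (∀ η (hη : IsTest (vacuum r)ᶜ η), T (∂_{e 0} hη.toTestFunction) =
        -((∫ x, η x * velocity r Λ x 0) -
          2 * Real.pi * ∫ x, (phaseCount k x : ℝ) * fderiv ℝ η x (e 0))) ∧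
      ∀ η (hη : IsTest (vacuum r)ᶜ η), T (∂_{e 1} hη.toTestFunction) =
        -∫ x, η x * velocity r Λ x 1 := by
  obtain ⟨v, hv, k, hk⟩ := h
  have hN := locallyIntegrable_phaseCount k hV
  have hNi : ∀ ζ : 𝓓((⊤ : TopologicalSpace.Opens Plane), ℝ),
      Integrable fun x => (phaseCount k x : ℝ) * fderiv ℝ ζ x (e 0) := fun ζ => by
    have := ((TestFunction.isTest ζ).fderiv_apply (e 0)).integrable_smul
      (hN.locallyIntegrableOn univ)
    simpa [mul_comm] using this
  have hd : ∀ ζ : 𝓓((⊤ : TopologicalSpace.Opens Plane), ℝ), Differentiable ℝ ζ :=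
    fun ζ => (TestFunction.isTest ζ).differentiable
  let N : 𝓓((⊤ : TopologicalSpace.Opens Plane), ℝ) →ₗ[ℝ] ℝ :=
    { toFun := fun ζ => 2 * Real.pi * ∫ x, (phaseCount k x : ℝ) * fderiv ℝ ζ x (e 0)
      map_add' := fun ζ ξ => by
        rw [← mul_add, ← integral_add (hNi ζ) (hNi ξ)]
        congr 2
        ext x
        have : fderiv ℝ (⇑(ζ + ξ)) x = fderiv ℝ ζ x + fderiv ℝ ξ x := fderiv_add (hd ζ x) (hd ξ x)
        rw [this, add_apply, mul_add]
      map_smul' := fun c ζ => by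
        have : ∀ x, fderiv ℝ (⇑(c • ζ)) x = c • fderiv ℝ ζ x := fun x =>
          fderiv_const_smul (hd ζ x) c
        simp only [this, smul_apply, smul_eq_mul, RingHom.id_apply,
          mul_left_comm _ c]
        rw [integral_const_mul]
        ring }
  let w : Fin 2 → 𝓓((⊤ : TopologicalSpace.Opens Plane), ℝ) →ₗ[ℝ] ℝ := fun i =>
    { toFun := fun ζ => v ζ i
      map_add' := fun ζ ξ => by rw [map_add]; rfl
      map_smul' := fun c ζ => by rw [map_smul]; rfl }
  -- As a distribution the functional `N` is -2π∂₀ of `phaseCount`, so the first component is v₀ +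
  -- 2π∂₀(`phaseCount`), whose ∂₁ absorbs the Dirac masses.
  obtain ⟨T, hT⟩ := _root_.exists_potential ![w 0 - N, w 1] fun ζ => by
    have h1 := hk ζ
    rw [Distribution.lineDerivOp_apply_apply, Distribution.lineDerivOp_apply_apply, map_neg,
      map_neg] at h1
    have h2 := (TestFunction.isTest ζ).integral_phaseCount_mul k hV
    have h3 : N (∂_{e 1} ζ) = 2 * Real.pi * ∑ᶠ x : vacuum r, (k x : ℝ) * ζ x := by
      rw [← h2]
      have : ⇑(∂_{e 1} ζ : 𝓓((⊤ : TopologicalSpace.Opens Plane), ℝ)) = fun x => fderiv ℝ ζ x (e 1) :=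
        funext fun x => TestFunction.lineDerivOp_apply_eq_fderiv ζ (e 1) x
      simp only [N, LinearMap.coe_mk, AddHom.coe_mk, this]
    change v (∂_{e 1} ζ) 0 - N (∂_{e 1} ζ) = v (∂_{e 0} ζ) 1
    rw [h3, ← h1]
    simp
  have hvel := locallyIntegrableOn_velocity hr hΛ
  have hcomp : ∀ η (hη : IsTest (vacuum r)ᶜ η) (i : Fin 2),
      v hη.toTestFunction i = ∫ x, η x * velocity r Λ x i := fun η hη i => by
    rw [hv hη.toTestFunction (disjoint_left.2 fun x hx => hη.tsupport_subset hx)]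
    exact ((EuclideanSpace.proj i : Plane →L[ℝ] ℝ).integral_comp_comm
      (hη.integrable_smul hvel)).symm
  refine ⟨k, T, fun η hη => ?_, fun η hη => ?_⟩
  · rw [hT, ← hcomp η hη 0]
    rfl
  · rw [hT, ← hcomp η hη 1]
    rfl

/-- A vector field with quantised vorticity is, off the vacuum, the gradient of the phase of a
unimodular function. -/
theorem HasQuantisedVorticity.exists_phase (hr : Continuous r) (hΛ : LocallyIntegrable Λ)
    (hV : ∀ K : Set Plane, IsCompact K → (vacuum r ∩ K).Finite)
    (h : HasQuantisedVorticity r Λ) :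
    ∃ φ : Plane → ℂ, AEStronglyMeasurable φ ∧ (∀ x, ‖φ x‖ = 1) ∧
      ∀ x ∈ (vacuum r)ᶜ, ∃ a b : Fin 2 → ℝ, (∀ k, a k < b k) ∧ x ∈ box a b ∧
        closedBox a b ⊆ (vacuum r)ᶜ ∧ ∀ i, ∀ᵐ s, s ∈ Ioo (a (i + 1)) (b (i + 1)) →
          HasACRep (a i) (b i) (fun t => φ (chart i (s, t)))
            fun t => Complex.I * velocity r Λ (chart i (s, t)) i * φ (chart i (s, t)) := by
  obtain ⟨k, T, hT0, hT1⟩ := h.exists_potential hr hΛ hV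
  have hvel := locallyIntegrableOn_velocity hr hΛ
  have hVo := (isClosed_vacuum hr).isOpen_compl
  have hloc : ∀ x : ((vacuum r)ᶜ : Set Plane), ∃ (a b : Fin 2 → ℝ) (f g : Plane → ℝ),
      x.1 ∈ box a b ∧ box a b ⊆ (vacuum r)ᶜ ∧ IntegrableOn f (box a b) ∧
      (∀ η (hη : IsTest (box a b) η), T hη.toTestFunction = ∫ x, η x * f x) ∧
      (∀ i, HasWeakPartial (box a b) i g fun x => velocity r Λ x i) ∧
      ∀ x ∈ box a b, Complex.exp (Complex.I * f x) = Complex.exp (Complex.I * g x) := by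
    rintro ⟨x, hx⟩
    obtain ⟨a, b, hab, hxb, hsub⟩ := exists_closedBox_subset hVo hx
    have hsub' := (box_subset_closedBox a b).trans hsub
    obtain ⟨f, g, hf, -, hfT, hg, hfg⟩ := exists_local_phase k hV hab
      (disjoint_left.2 fun x hx => hsub' hx) (u := fun i x => velocity r Λ x i)
      (fun i => ((hvel.euclidean_apply i).integrableOn_closedBox hsub).mono_set (box_subset_closedBox a b)) T
      (fun η hη => hT0 η (hη.mono hsub')) fun η hη => hT1 η (hη.mono hsub')
    exact ⟨a, b, f, g, hxb, hsub', hf, hfT, hg, hfg⟩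
  choose a b f g hxb hsub hf hfT hg hfg using hloc
  -- On an overlap the local functions `f` represent the same functional T, hence agree almost
  -- everywhere. The functions `g` need not: they may differ by multiples of 2π.
  obtain ⟨F, hFm, hF⟩ := exists_ae_glue (U := fun x => box (a x) (b x)) (f := f)
    (fun x => isOpen_box _ _) (fun x => (hf x).aestronglyMeasurable) fun x y => by
      have := ae_eq_of_forall_isTest ((isOpen_box (a x) (b x)).inter (isOpen_box (a y) (b y)))
        ((hf x).locallyIntegrableOn.mono_set inter_subset_left)
        ((hf y).locallyIntegrableOn.mono_set inter_subset_right) fun η hη => by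
          rw [← hfT x η (hη.mono inter_subset_left), ← hfT y η (hη.mono inter_subset_right)]
          rfl
      exact this.mono fun z hz h1 h2 => hz ⟨h1, h2⟩
  have hU : ⋃ x : ((vacuum r)ᶜ : Set Plane), box (a x) (b x) = (vacuum r)ᶜ :=
    (iUnion_subset fun x => hsub x).antisymm fun x hx => mem_iUnion.2 ⟨⟨x, hx⟩, hxb ⟨x, hx⟩⟩
  have hnull : volume (vacuum r) = 0 := (countable_of_finite_inter_compact hV).measure_zero _
  have hFm' : AEStronglyMeasurable F := by
    have : volume.restrict (vacuum r)ᶜ = (volume : Measure Plane) :=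
      Measure.restrict_eq_self_of_ae_mem (measure_eq_zero_iff_ae_notMem.1 hnull)
    rwa [hU, this] at hFm
  refine ⟨fun x => Complex.exp (Complex.I * F x), ?_, fun x => ?_, fun x hx => ?_⟩
  · exact (by fun_prop : Continuous fun y : ℝ => Complex.exp (Complex.I * y)).comp_aestronglyMeasurable
      hFm'
  · beta_reduce
    rw [mul_comm, Complex.norm_exp_ofReal_mul_I]
  -- On a smaller rectangle, closed in the domain of `g`, exp(iF) = exp(if) = exp(ig) almost
  -- everywhere, and `g` has the velocity as weak gradient.
  · obtain ⟨a', b', hab', hxb', hsub'⟩ := exists_closedBox_subset (isOpen_box _ _) (hxb ⟨x, hx⟩)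
    refine ⟨a', b', hab', hxb', hsub'.trans (hsub _), fun i => ?_⟩
    filter_upwards [(hg ⟨x, hx⟩ i).ae_hasACRep hab' hsub', ae_chart (hF ⟨x, hx⟩) i] with s h1 h2 hs
    have h3 : ∀ᵐ t, t ∈ uIcc (a' i) (b' i) → Complex.exp (Complex.I * F (chart i (s, t))) =
        Complex.exp (Complex.I * g ⟨x, hx⟩ (chart i (s, t))) := by
      filter_upwards [h2] with t ht hm
      rw [uIcc_of_le (hab' i).le] at hm
      have hmem : chart i (s, t) ∈ box (a ⟨x, hx⟩) (b ⟨x, hx⟩) :=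
        hsub' (chart_mem_closedBox.2 ⟨Ioo_subset_Icc_self hs, hm⟩)
      rw [ht hmem, hfg _ _ hmem]
    exact (h1 hs).exp_I.congr h3 (h3.mono fun t ht hm => by rw [ht hm])

end Phase

/-! ### Mixed second derivatives -/

open scoped SchwartzMap FourierTransform

/-- The space `L²(ℝ²; ℂ)`. -/
abbrev Plane.L2 : Type := Lp ℂ 2 (volume : Measure Plane)

theorem MeasureTheory.MemLp.integrable_smul_two {u : Plane → ℝ} {f : Plane → ℂ} (hu : MemLp u 2)
    (hf : MemLp f 2) : Integrable fun x => u x • f x :=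
  memLp_one_iff_integrable.1 (hf.smul (r := 1) hu)

/-- The defining identity of the weak derivative extends to test functions without compact
support, provided that all functions are square integrable. -/
theorem HasWeakPartial.integral_fderiv_smul_of_memLp {i : Fin 2} {f g : Plane → ℂ}
    (h : HasWeakPartial univ i f g) (hf : MemLp f 2) (hg : MemLp g 2) {u : Plane → ℝ}
    (hu : ContDiff ℝ ∞ u) (hu2 : MemLp u 2) (hdu : MemLp (fun x => fderiv ℝ u x (e i)) 2) :
    ∫ x, fderiv ℝ u x (e i) • f x = -∫ x, u x • g x := by
  let χ : ContDiffBump (0 : Plane) := ⟨1, 2, one_pos, one_lt_two⟩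
  have hχ : ContDiff ℝ ∞ χ := χ.contDiff
  have hχd : Differentiable ℝ χ := hχ.differentiable (by simp)
  have hχ1 : ∀ x, |χ x| ≤ 1 := fun x => by
    rw [abs_of_nonneg (χ.nonneg' x)]
    exact χ.le_one
  obtain ⟨B, hB⟩ := (χ.hasCompactSupport.fderiv (𝕜 := ℝ)).exists_bound_of_continuous
    (hχ.continuous_fderiv (by simp))
  -- The truncations θₙ(x) = χ(cₙx) u(x) tend to u, and the derivative of the cutoff carries the
  -- factor cₙ → 0. All terms are dominated by products of square integrable functions.
  let c : ℕ → ℝ := fun n => 1 / ((n : ℝ) + 1)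
  have hc0 : ∀ n, 0 < c n := fun n => by positivity
  have hc1 : ∀ n, c n ≤ 1 := fun n => by
    simp only [c]
    rw [div_le_one (by positivity)]
    linarith [n.cast_nonneg (α := ℝ)]
  have hct : Tendsto c atTop (𝓝 0) := tendsto_one_div_add_atTop_nhds_zero_nat
  let θ : ℕ → Plane → ℝ := fun n x => χ (c n • x) * u x
  have hθ : ∀ n, ContDiff ℝ ∞ (θ n) := fun n => (hχ.comp (contDiff_const_smul (c n))).mul hu
  have hθc : ∀ n, HasCompactSupport (θ n) := fun n => by
    refine HasCompactSupport.intro (isCompact_closedBall 0 (2 / c n)) fun x hx => ?_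
    have : χ (c n • x) = 0 := χ.zero_of_le_dist <| by
      rw [mem_closedBall_zero_iff, not_le, div_lt_iff₀ (hc0 n)] at hx
      rw [dist_zero_right, norm_smul, Real.norm_of_nonneg (hc0 n).le, mul_comm]
      exact hx.le
    simp [θ, this]
  have hud : Differentiable ℝ u := hu.differentiable (by simp)
  have hθd : ∀ n x, fderiv ℝ (θ n) x (e i) =
      χ (c n • x) * fderiv ℝ u x (e i) + u x * (c n * fderiv ℝ χ (c n • x) (e i)) := fun n x => by
    have h1 : HasFDerivAt (fun x : Plane => c n • x) (c n • ContinuousLinearMap.id ℝ Plane) x :=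
      (hasFDerivAt_id x).const_smul (c n)
    have h2 : HasFDerivAt (fun x => χ (c n • x))
        ((fderiv ℝ χ (c n • x)).comp (c n • ContinuousLinearMap.id ℝ Plane)) x :=
      (hχd (c n • x)).hasFDerivAt.comp x h1
    have h3 := (h2.mul (hud x).hasFDerivAt).fderiv
    have h4 : fderiv ℝ (θ n) x = _ := h3
    rw [h4]
    simp
  have hBi : ∀ x, |fderiv ℝ χ x (e i)| ≤ B := fun x => by
    refine ((fderiv ℝ χ x).le_opNorm (e i)).trans ?_
    rw [show ‖e i‖ = 1 by simp [Plane.e], mul_one]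
    exact hB x
  have hχt : ∀ x : Plane, Tendsto (fun n => χ (c n • x)) atTop (𝓝 1) := fun x => by
    have h1 : Tendsto (fun n => c n • x) atTop (𝓝 ((0 : ℝ) • x)) := hct.smul_const x
    rw [zero_smul] at h1
    have h2 := (hχ.continuous.tendsto 0).comp h1
    rwa [χ.one_of_mem_closedBall (Metric.mem_closedBall_self zero_le_one)] at h2
  have key : ∀ n, ∫ x, fderiv ℝ (θ n) x (e i) • f x = -∫ x, θ n x • g x := fun n =>
    h.integral_eq (θ n) (hθ n) (hθc n) (subset_univ _)
  have lim1 : Tendsto (fun n => ∫ x, fderiv ℝ (θ n) x (e i) • f x) atTop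
      (𝓝 (∫ x, fderiv ℝ u x (e i) • f x)) := by
    refine tendsto_integral_of_dominated_convergence
      (fun x => ‖fderiv ℝ u x (e i) • f x‖ + B * ‖u x • f x‖) (fun n => ?_) ?_ (fun n => ?_) ?_
    · exact ((hθ n).continuous_fderiv (by simp)).clm_apply continuous_const
        |>.aestronglyMeasurable.smul hf.1
    · exact (hdu.integrable_smul_two hf).norm.add ((hu2.integrable_smul_two hf).norm.const_mul B)
    · refine Eventually.of_forall fun x => ?_
      rw [hθd, norm_smul, norm_smul, norm_smul, ← mul_assoc B, ← add_mul]
      gcongr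
      refine (norm_add_le _ _).trans (add_le_add ?_ ?_)
      · rw [norm_mul]
        exact mul_le_of_le_one_left (norm_nonneg _) (hχ1 _)
      · rw [norm_mul, mul_comm]
        gcongr
        rw [norm_mul, Real.norm_of_nonneg (hc0 n).le]
        exact (mul_le_of_le_one_left (norm_nonneg _) (hc1 n)).trans (hBi _)
    · refine Eventually.of_forall fun x => Tendsto.smul_const ?_ _
      simp only [hθd]
      have t1 := (hχt x).mul_const (fderiv ℝ u x (e i))
      have t2 : Tendsto (fun n => c n * fderiv ℝ χ (c n • x) (e i)) atTop (𝓝 0) :=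
        hct.zero_mul_isBoundedUnder_le (isBoundedUnder_of ⟨B, fun n => hBi _⟩)
      simpa using t1.add (t2.const_mul (u x))
  have lim2 : Tendsto (fun n => ∫ x, θ n x • g x) atTop (𝓝 (∫ x, u x • g x)) := by
    refine tendsto_integral_of_dominated_convergence
      (fun x => ‖u x • g x‖) (fun n => ?_) (hu2.integrable_smul_two hg).norm (fun n => ?_) ?_
    · exact (hθ n).continuous.aestronglyMeasurable.smul hg.1
    · refine Eventually.of_forall fun x => ?_
      rw [norm_smul, norm_smul]
      gcongr
      rw [norm_mul]
      exact mul_le_of_le_one_left (norm_nonneg _) (hχ1 _)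
    · refine Eventually.of_forall fun x => Tendsto.smul_const ?_ _
      simpa using (hχt x).mul_const (u x)
  refine tendsto_nhds_unique lim1 ?_
  simp only [key]
  exact lim2.neg

/-- Schwartz functions are complex-valued and not compactly supported. The real and imaginary parts
are treated separately with `HasWeakPartial.integral_fderiv_smul_of_memLp`. -/
theorem HasWeakPartial.lineDerivOp_toTemperedDistribution {i : Fin 2} {f g : L2}
    (h : HasWeakPartial univ i f g) :
    ∂_{e i} (f : 𝓢'(Plane, ℂ)) = (g : 𝓢'(Plane, ℂ)) := by
  ext η
  rw [TemperedDistribution.lineDerivOp_apply_apply, map_neg, Lp.toTemperedDistribution_apply,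
    Lp.toTemperedDistribution_apply]
  have hη : ContDiff ℝ ∞ η := η.smooth'
  have hηd : Differentiable ℝ η := hη.differentiable (by simp)
  have hd : ∀ x, (∂_{e i} η : 𝓢(Plane, ℂ)) x = fderiv ℝ η x (e i) := fun x =>
    SchwartzMap.lineDerivOp_apply_eq_fderiv _ _ _
  have hm : MemLp η 2 := η.memLp 2 volume
  have hdm : MemLp (fun x => fderiv ℝ η x (e i)) 2 := by
    have := (∂_{e i} η : 𝓢(Plane, ℂ)).memLp 2 volume
    rwa [show ⇑(∂_{e i} η : 𝓢(Plane, ℂ)) = fun x => fderiv ℝ η x (e i) from funext hd] at this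
  have hre : ∀ x, fderiv ℝ (fun x => (η x).re) x (e i) = (fderiv ℝ η x (e i)).re := fun x => by
    have := (Complex.reCLM.hasFDerivAt.comp x (hηd x).hasFDerivAt).fderiv
    have h' : fderiv ℝ (fun x => (η x).re) x = _ := this
    rw [h']
    rfl
  have him : ∀ x, fderiv ℝ (fun x => (η x).im) x (e i) = (fderiv ℝ η x (e i)).im := fun x => by
    have := (Complex.imCLM.hasFDerivAt.comp x (hηd x).hasFDerivAt).fderiv
    have h' : fderiv ℝ (fun x => (η x).im) x = _ := this
    rw [h']
    rfl
  have h1 := h.integral_fderiv_smul_of_memLp (Lp.memLp f) (Lp.memLp g)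
    (Complex.reCLM.contDiff.comp hη) hm.re (by
      simp only [Function.comp_def, Complex.reCLM_apply, hre]
      exact hdm.re)
  have h2 := h.integral_fderiv_smul_of_memLp (Lp.memLp f) (Lp.memLp g)
    (Complex.imCLM.contDiff.comp hη) hm.im (by
      simp only [Function.comp_def, Complex.imCLM_apply, him]
      exact hdm.im)
  simp only [Function.comp_def, Complex.reCLM_apply, hre, Complex.imCLM_apply, him] at h1 h2
  have split : ∀ (w : Plane → ℂ) (F : L2), MemLp w 2 →
      ∫ x, w x • F x = (∫ x, (w x).re • F x) + Complex.I * ∫ x, (w x).im • F x := by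
    intro w F hw
    have i1 : Integrable fun x => (w x).re • F x := hw.re.integrable_smul_two (Lp.memLp F)
    have i2 : Integrable fun x => (w x).im • F x := hw.im.integrable_smul_two (Lp.memLp F)
    rw [← integral_const_mul, ← integral_add i1 (i2.const_mul _)]
    congr 1
    ext x
    conv_lhs => rw [← Complex.re_add_im (w x)]
    simp only [smul_eq_mul, Complex.real_smul]
    ring_nf
  simp only [hd]
  rw [split _ f hdm, split _ g hm, h1, h2]
  ring

theorem HasWeakPartial.of_lineDerivOp_toTemperedDistribution {i : Fin 2}
    {f g : L2} (h : ∂_{e i} (f : 𝓢'(Plane, ℂ)) = (g : 𝓢'(Plane, ℂ))) :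
    HasWeakPartial univ i f g := by
  refine ⟨((Lp.memLp f).locallyIntegrable (by norm_num)).locallyIntegrableOn _,
    ((Lp.memLp g).locallyIntegrable (by norm_num)).locallyIntegrableOn _, fun η h1 h2 _ => ?_⟩
  have h3 : HasCompactSupport fun x => (η x : ℂ) := h2.comp_left (g := fun y : ℝ => (y : ℂ)) (by simp)
  have h4 : ContDiff ℝ ∞ fun x => (η x : ℂ) := Complex.ofRealCLM.contDiff.comp h1
  have h5 := congrArg (fun S : 𝓢'(Plane, ℂ) => S (h3.toSchwartzMap h4)) h
  simp only [TemperedDistribution.lineDerivOp_apply_apply, Lp.toTemperedDistribution_apply,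
    map_neg] at h5
  have hd : ∀ x, (∂_{e i} (h3.toSchwartzMap h4) : 𝓢(Plane, ℂ)) x = (fderiv ℝ η x (e i) : ℂ) :=
    fun x => by
    rw [SchwartzMap.lineDerivOp_apply_eq_fderiv]
    have hη : DifferentiableAt ℝ η x := h1.differentiable (by simp) x
    have h' : fderiv ℝ (fun x => (η x : ℂ)) x = _ :=
      (Complex.ofRealCLM.hasFDerivAt.comp x hη.hasFDerivAt).fderiv
    exact (congrArg (fun L => L (e i)) h').trans rfl
  simp only [hd] at h5
  have h6 : ∀ x, (h3.toSchwartzMap h4) x = (η x : ℂ) := fun x => rfl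
  simp only [h6, smul_eq_mul] at h5
  simp only [Complex.real_smul]
  rw [← h5, neg_neg]

/-- The Fourier transform turns ∂ᵢ into multiplication by 2πiξᵢ. Both sides are then locally
integrable functions of ξ, for which equality as distributions is equality almost everywhere. -/
theorem lineDerivOp_toTemperedDistribution_eq_iff {i : Fin 2} {f g : L2} :
    ∂_{e i} (f : 𝓢'(Plane, ℂ)) = (g : 𝓢'(Plane, ℂ)) ↔
      ∀ᵐ ξ : Plane, (𝓕 g : L2) ξ =
        2 * Real.pi * Complex.I * ξ i * (𝓕 f : L2) ξ := by
  have hin : ∀ ξ : Plane, inner ℝ ξ (e i) = ξ i := fun ξ => by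
    simp [Plane.e, EuclideanSpace.inner_single_right]
  have hg : Function.HasTemperateGrowth fun ξ : Plane => ((inner ℝ ξ (e i) : ℝ) : ℂ) := by
    fun_prop
  have e1 : ∂_{e i} (f : 𝓢'(Plane, ℂ)) = (g : 𝓢'(Plane, ℂ)) ↔
      𝓕 (∂_{e i} (f : 𝓢'(Plane, ℂ))) = 𝓕 (g : 𝓢'(Plane, ℂ)) :=
    ⟨fun h => by rw [h], fun h => by
      have := congrArg (fun S : 𝓢'(Plane, ℂ) => 𝓕⁻ S) h
      simpa using this⟩
  rw [e1, TemperedDistribution.fourier_lineDerivOp_eq, Lp.fourier_toTemperedDistribution_eq,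
    Lp.fourier_toTemperedDistribution_eq]
  have e2 : ∀ η : 𝓢(Plane, ℂ), ((2 * Real.pi * Complex.I) • TemperedDistribution.smulLeftCLM ℂ
      (fun ξ : Plane => ((inner ℝ ξ (e i) : ℝ) : ℂ)) ((𝓕 f : L2) : 𝓢'(Plane, ℂ))) η =
      ∫ ξ : Plane, η ξ * (2 * Real.pi * Complex.I * ξ i * (𝓕 f) ξ) := fun η => by
    change (2 * Real.pi * Complex.I) • TemperedDistribution.smulLeftCLM ℂ _ _ η = _
    rw [TemperedDistribution.smulLeftCLM_apply_apply, Lp.toTemperedDistribution_apply, smul_eq_mul,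
      ← integral_const_mul]
    congr 1
    ext ξ
    rw [SchwartzMap.smulLeftCLM_apply_apply hg, hin]
    simp only [smul_eq_mul]
    ring
  constructor
  · intro h
    have hl : LocallyIntegrable fun ξ : Plane =>
        2 * Real.pi * Complex.I * ξ i * (𝓕 f) ξ := by
      have h1 := (Lp.memLp (𝓕 f)).locallyIntegrable (by norm_num)
      have h2 : Continuous fun ξ : Plane => 2 * Real.pi * Complex.I * ξ i := by fun_prop
      have := (h1.locallyIntegrableOn univ).continuousOn_smul isOpen_univ.isLocallyClosed h2.continuousOn
      exact locallyIntegrableOn_univ.1 this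
    have hl' := (Lp.memLp (𝓕 g)).locallyIntegrable (by norm_num)
    refine ae_eq_of_integral_contDiff_smul_eq hl' hl fun η h1 h2 => ?_
    have h3 : HasCompactSupport fun x => (η x : ℂ) :=
      h2.comp_left (g := fun y : ℝ => (y : ℂ)) (by simp)
    have h4 : ContDiff ℝ ∞ fun x => (η x : ℂ) := Complex.ofRealCLM.contDiff.comp h1
    have h5 := congrArg (fun S : 𝓢'(Plane, ℂ) => S (h3.toSchwartzMap h4)) h
    simp only [Lp.toTemperedDistribution_apply] at h5
    rw [e2] at h5
    exact h5.symm
  · intro h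
    ext η
    rw [e2, Lp.toTemperedDistribution_apply]
    refine integral_congr_ae (h.mono fun ξ hξ => ?_)
    simp only [hξ, smul_eq_mul]

theorem eLpNorm_fourier_eq (f : L2) :
    eLpNorm (𝓕 f : L2) 2 volume = eLpNorm f 2 volume := by
  rw [← Lp.enorm_def, ← Lp.enorm_def, ← ofReal_norm, Lp.norm_fourier_eq,
    ofReal_norm]

theorem HasWeakPartial.congr_ae {𝕜 : Type*} [RCLike 𝕜] {Ω : Set Plane} {i : Fin 2}
    {f g f' g' : Plane → 𝕜} (h : HasWeakPartial Ω i f g) (hf : f =ᵐ[volume] f')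
    (hg : g =ᵐ[volume] g') : HasWeakPartial Ω i f' g' :=
  ⟨h.locallyIntegrableOn.congr (ae_restrict_of_ae hf),
    h.locallyIntegrableOn_deriv.congr (ae_restrict_of_ae hg), fun η h1 h2 h3 => by
    rw [← integral_congr_ae (hf.mono fun x hx => congrArg (fderiv ℝ η x (e i) • ·) hx),
      ← integral_congr_ae (hg.mono fun x hx => congrArg (η x • ·) hx)]
    exact h.integral_eq η h1 h2 h3⟩

/-- In the plane, square integrability of `∂₀²f` and `∂₁²f` implies that of `∂₀∂₁f`. -/
theorem exists_mixed_weakPartial {f : Plane → ℂ} {f₁ f₂ : Fin 2 → Plane → ℂ} (hf : MemLp f 2)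
    (hf₁ : ∀ i, MemLp (f₁ i) 2) (hf₂ : ∀ i, MemLp (f₂ i) 2)
    (h₁ : ∀ i, HasWeakPartial univ i f (f₁ i)) (h₂ : ∀ i, HasWeakPartial univ i (f₁ i) (f₂ i)) :
    ∃ g : Plane → ℂ, MemLp g 2 ∧ eLpNorm g 2 ≤ eLpNorm (f₂ 0) 2 + eLpNorm (f₂ 1) 2 ∧
      HasWeakPartial univ 0 (f₁ 1) g ∧ HasWeakPartial univ 1 (f₁ 0) g := by
  let F : L2 := hf.toLp f
  let F₁ : Fin 2 → L2 := fun i => (hf₁ i).toLp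
  let F₂ : Fin 2 → L2 := fun i => (hf₂ i).toLp
  have A : ∀ i, ∀ᵐ ξ : Plane, (𝓕 (F₁ i) : L2) ξ =
      2 * Real.pi * Complex.I * ξ i * (𝓕 F : L2) ξ := fun i =>
    lineDerivOp_toTemperedDistribution_eq_iff.1
      ((h₁ i).congr_ae hf.coeFn_toLp.symm (hf₁ i).coeFn_toLp.symm).lineDerivOp_toTemperedDistribution
  have B : ∀ i, ∀ᵐ ξ : Plane, (𝓕 (F₂ i) : L2) ξ =
      2 * Real.pi * Complex.I * ξ i * (𝓕 (F₁ i) : L2) ξ := fun i =>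
    lineDerivOp_toTemperedDistribution_eq_iff.1
      ((h₂ i).congr_ae (hf₁ i).coeFn_toLp.symm
        (hf₂ i).coeFn_toLp.symm).lineDerivOp_toTemperedDistribution
  let m : Plane → ℂ := fun ξ =>
    2 * Real.pi * Complex.I * ξ 0 * (𝓕 (F₁ 1) : L2) ξ
  let n : Plane → ℝ := fun ξ =>
    ‖(𝓕 (F₂ 0) : L2) ξ‖ + ‖(𝓕 (F₂ 1) : L2) ξ‖
  -- The symbol of ∂₀∂₁ is dominated by those of ∂₀² and ∂₁², because |ξ₀ξ₁| ≤ ξ₀² + ξ₁².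
  have hmn : ∀ᵐ ξ, ‖m ξ‖ ≤ n ξ := by
    filter_upwards [A 0, A 1, B 0, B 1] with ξ a0 a1 b0 b1
    simp only [m, n]
    rw [b0, b1, a0, a1]
    simp only [norm_mul, Complex.norm_I, Complex.norm_real, Real.norm_eq_abs, mul_one]
    set p := ‖(2 : ℂ)‖ * |Real.pi|
    set q := ‖(𝓕 F : L2) ξ‖
    have h1 : |ξ 0| * |ξ 1| ≤ |ξ 0| * |ξ 0| + |ξ 1| * |ξ 1| := by
      nlinarith [sq_nonneg (|ξ 0| - |ξ 1|), sq_nonneg (|ξ 0| + |ξ 1|)]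
    calc p * |ξ 0| * (p * |ξ 1| * q) = p * p * q * (|ξ 0| * |ξ 1|) := by ring
      _ ≤ p * p * q * (|ξ 0| * |ξ 0| + |ξ 1| * |ξ 1|) := by gcongr
      _ = _ := by ring
  have hn : MemLp n 2 := (Lp.memLp _).norm.add (Lp.memLp _).norm
  have hmm : AEStronglyMeasurable m :=
    (by fun_prop : Continuous fun ξ : Plane => 2 * Real.pi * Complex.I * (ξ 0 : ℂ))
      |>.aestronglyMeasurable.mul (Lp.aestronglyMeasurable _)
  have hm : MemLp m 2 := hn.mono' hmm hmn
  let G : L2 := 𝓕⁻ (hm.toLp m)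
  have hG : (𝓕 G : L2) = hm.toLp m := by simp [G]
  have hGm : ∀ᵐ ξ, (𝓕 G : L2) ξ = m ξ := by
    rw [hG]
    exact hm.coeFn_toLp
  have hnorm : ∀ i, eLpNorm (fun ξ => ‖(𝓕 (F₂ i) : L2) ξ‖) 2 volume =
      eLpNorm (f₂ i) 2 := fun i => by
    rw [eLpNorm_norm, eLpNorm_fourier_eq]
    exact eLpNorm_congr_ae (hf₂ i).coeFn_toLp
  refine ⟨G, Lp.memLp G, ?_, ?_, ?_⟩
  · rw [← eLpNorm_fourier_eq, ← hnorm, ← hnorm, eLpNorm_congr_ae hGm]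
    exact (eLpNorm_mono_ae_real hmn).trans (eLpNorm_add_le (Lp.aestronglyMeasurable _).norm
      (Lp.aestronglyMeasurable _).norm (by norm_num))
  · refine HasWeakPartial.congr_ae (f := F₁ 1) (g := G) ?_ (hf₁ 1).coeFn_toLp EventuallyEq.rfl
    exact HasWeakPartial.of_lineDerivOp_toTemperedDistribution
      (lineDerivOp_toTemperedDistribution_eq_iff.2 hGm)
  · refine HasWeakPartial.congr_ae (f := F₁ 0) (g := G) ?_ (hf₁ 0).coeFn_toLp EventuallyEq.rfl
    refine HasWeakPartial.of_lineDerivOp_toTemperedDistribution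
      (lineDerivOp_toTemperedDistribution_eq_iff.2 ?_)
    filter_upwards [hGm, A 0, A 1] with ξ h1 a0 a1
    rw [h1, a0]
    simp only [m]
    rw [a1]
    ring

/-! ### The wave function -/

section WaveFunction

variable {r : Plane → ℝ} {Dr Λ : Plane → Plane} {φ : Plane → ℂ}

/-- `φ` is unimodular and, off the vacuum, its phase has the velocity as gradient along almost
every line. -/
structure IsPhase (r : Plane → ℝ) (Λ : Plane → Plane) (φ : Plane → ℂ) : Prop where
  aestronglyMeasurable : AEStronglyMeasurable φ
  norm_eq_one : ∀ x, ‖φ x‖ = 1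
  slices : ∀ x ∈ (vacuum r)ᶜ, ∃ a b : Fin 2 → ℝ, (∀ k, a k < b k) ∧ x ∈ box a b ∧
    closedBox a b ⊆ (vacuum r)ᶜ ∧ ∀ i, ∀ᵐ s, s ∈ Ioo (a (i + 1)) (b (i + 1)) →
      HasACRep (a i) (b i) (fun t => φ (chart i (s, t)))
        fun t => Complex.I * velocity r Λ (chart i (s, t)) i * φ (chart i (s, t))

theorem velocity_apply (x : Plane) (j : Fin 2) :
    velocity r Λ x j = (r x ^ 2)⁻¹ * (r x * Λ x j) := rfl

theorem MeasureTheory.MemLp.euclidean_apply {𝕜 ι : Type*} [RCLike 𝕜] [Fintype ι]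
    {u : Plane → EuclideanSpace 𝕜 ι} (hu : MemLp u 2) (i : ι) : MemLp (fun x => u x i) 2 :=
  hu.mono ((EuclideanSpace.proj i : EuclideanSpace 𝕜 ι →L[𝕜] 𝕜).continuous.comp_aestronglyMeasurable
    hu.1) (Eventually.of_forall fun x => PiLp.norm_apply_le (u x) i)

/-- The gradient `(∇√ρ + iΛ) φ` of the wave function `√ρ φ`. -/
noncomputable def waveGradient (Dr Λ : Plane → Plane) (φ : Plane → ℂ) (x : Plane) :
    EuclideanSpace ℂ (Fin 2) :=
  WithLp.toLp 2 fun j => ((Dr x j : ℂ) + Complex.I * Λ x j) * φ x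

theorem IsPhase.memLp_ofReal_mul (hφ : IsPhase r Λ φ) {f : Plane → ℝ} (hf : MemLp f 2) :
    MemLp (fun x => (f x : ℂ) * φ x) 2 :=
  hf.mono ((Complex.continuous_ofReal.comp_aestronglyMeasurable hf.1).mul
    hφ.aestronglyMeasurable) (Eventually.of_forall fun x => by simp [hφ.norm_eq_one x])

theorem IsPhase.memLp_waveGradient_apply (hφ : IsPhase r Λ φ) (hDr : MemLp Dr 2) (hΛ : MemLp Λ 2)
    (j : Fin 2) : MemLp (fun x => waveGradient Dr Λ φ x j) 2 := by
  refine ((hφ.memLp_ofReal_mul (hDr.euclidean_apply j)).add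
    ((hφ.memLp_ofReal_mul (hΛ.euclidean_apply j)).const_mul Complex.I)).ae_eq
    (Eventually.of_forall fun x => ?_)
  simp only [Pi.add_apply, waveGradient]
  ring

/-- On a line off the vacuum the product rule gives (∂ᵢr)φ + r · i vᵢφ, and r vᵢ = Λᵢ there.
Function and derivative are square integrable on the plane, so the vacuum points are removable. -/
theorem IsPhase.hasWeakPartial (hφ : IsPhase r Λ φ) (h : IsH1 r Dr) (hΛ : MemLp Λ 2)
    (hV : ∀ K : Set Plane, IsCompact K → (vacuum r ∩ K).Finite) (i : Fin 2) :
    HasWeakPartial univ i (fun x => (r x : ℂ) * φ x) fun x => waveGradient Dr Λ φ x i := by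
  have h1 := (hφ.memLp_ofReal_mul h.memLp).locallyIntegrable (by norm_num)
  have h2 := (hφ.memLp_waveGradient_apply h.memLp_grad hΛ i).locallyIntegrable (by norm_num)
  refine HasWeakPartial.of_compl hV (HasWeakPartial.of_slices (h1.locallyIntegrableOn _)
    (h2.locallyIntegrableOn _) fun x hx => ?_) h1 h2
  obtain ⟨a, b, hab, hxb, hsub, hs⟩ := hφ.slices x hx
  refine ⟨a, b, hab, hxb, hsub, ?_⟩
  filter_upwards [hs i, (h.hasWeakPartial i).ae_hasACRep hab (subset_univ _)] with s h3 h4 hm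
  refine ((h4 hm).ofReal.mul (h3 hm)).congr (Eventually.of_forall fun t _ => rfl)
    (Eventually.of_forall fun t ht => ?_)
  rw [uIcc_of_le (hab i).le] at ht
  have hne : r (chart i (s, t)) ≠ 0 :=
    hsub (chart_mem_closedBox.2 ⟨Ioo_subset_Icc_self hm, ht⟩)
  have hne' : (r (chart i (s, t)) : ℂ) ≠ 0 := by exact_mod_cast hne
  simp only [waveGradient, velocity_apply]
  push_cast
  field_simp

/-- The second derivative `∂ⱼ²(√ρ φ)`, where `d = ∂ⱼ²√ρ` and `m = ∂ⱼJⱼ`. -/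
noncomputable def waveSecond (r : Plane → ℝ) (Λ : Plane → Plane) (φ : Plane → ℂ) (j : Fin 2)
    (d m : Plane → ℝ) (x : Plane) : ℂ :=
  (-((Λ x j ^ 2 / r x - d x : ℝ) : ℂ) + Complex.I * (m x / r x : ℝ)) * φ x

theorem IsPhase.waveSecond_memLp (hφ : IsPhase r Λ φ) {j : Fin 2} {d m : Plane → ℝ}
    (hd : MemLp (fun x => Λ x j ^ 2 / r x - d x) 2) (hm : MemLp (fun x => m x / r x) 2) :
    MemLp (waveSecond r Λ φ j d m) 2 := by
  refine ((hφ.memLp_ofReal_mul hm).const_mul Complex.I |>.sub (hφ.memLp_ofReal_mul hd)).ae_eq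
    (Eventually.of_forall fun x => ?_)
  simp only [Pi.sub_apply, waveSecond]
  ring

theorem IsPhase.eLpNorm_waveSecond_le (hφ : IsPhase r Λ φ) {j : Fin 2} {d m : Plane → ℝ}
    (hd : MemLp (fun x => Λ x j ^ 2 / r x - d x) 2) (hm : MemLp (fun x => m x / r x) 2) :
    eLpNorm (waveSecond r Λ φ j d m) 2 volume ≤
      eLpNorm (fun x => Λ x j ^ 2 / r x - d x) 2 volume + eLpNorm (fun x => m x / r x) 2 volume := by
  rw [← eLpNorm_norm fun x => Λ x j ^ 2 / r x - d x, ← eLpNorm_norm fun x => m x / r x]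
  refine (eLpNorm_mono_real fun x => ?_).trans (eLpNorm_add_le hd.1.norm hm.1.norm (by norm_num))
  rw [waveSecond, norm_mul, hφ.norm_eq_one, mul_one]
  refine (norm_add_le _ _).trans (le_of_eq ?_)
  rw [norm_neg, norm_mul, Complex.norm_I, one_mul, Complex.norm_real, Complex.norm_real]
  rfl

/-- Since |φ| = 1 and `Dr`, `Λ` are real, |∇ψ|² = |Dr|² + |Λ|² ≤ (|Dr| + |Λ|)² pointwise. -/
theorem IsPhase.eLpNorm_waveGradient_le (hφ : IsPhase r Λ φ) (hDr : MemLp Dr 2) (hΛ : MemLp Λ 2) :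
    eLpNorm (waveGradient Dr Λ φ) 2 volume ≤ eLpNorm Dr 2 volume + eLpNorm Λ 2 volume := by
  rw [← eLpNorm_norm Dr, ← eLpNorm_norm Λ]
  refine (eLpNorm_mono_real fun x => ?_).trans (eLpNorm_add_le hDr.1.norm hΛ.1.norm (by norm_num))
  refine abs_le_of_sq_le_sq' ?_ (add_nonneg (norm_nonneg _) (norm_nonneg _)) |>.2
  have h1 : ‖waveGradient Dr Λ φ x‖ ^ 2 = ‖Dr x‖ ^ 2 + ‖Λ x‖ ^ 2 := by
    rw [EuclideanSpace.norm_sq_eq, EuclideanSpace.norm_sq_eq, EuclideanSpace.norm_sq_eq,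
      ← Finset.sum_add_distrib]
    refine Finset.sum_congr rfl fun j _ => ?_
    simp only [waveGradient]
    rw [norm_mul, hφ.norm_eq_one, mul_one, ← Complex.normSq_eq_norm_sq, Complex.normSq_apply]
    simp
    ring
  rw [h1]
  nlinarith [norm_nonneg (Dr x), norm_nonneg (Λ x)]

theorem eLpNorm_euclidean_le_sum {ι : Type*} [Fintype ι] {u : Plane → EuclideanSpace ℂ ι}
    (hu : ∀ i, AEStronglyMeasurable fun x => u x i) :
    eLpNorm u 2 volume ≤ ∑ i, eLpNorm (fun x => u x i) 2 volume := by
  have h1 : ∀ x, ‖u x‖ ≤ (∑ i, fun x => ‖u x i‖) x := fun x => by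
    classical
    rw [Finset.sum_apply]
    conv_lhs => rw [← (EuclideanSpace.basisFun ι ℂ).sum_repr (u x)]
    refine (norm_sum_le _ _).trans (Finset.sum_le_sum fun i _ => ?_)
    simp [norm_smul]
  refine (eLpNorm_mono_real h1).trans ((eLpNorm_sum_le (fun i _ => (hu i).norm)
    (by norm_num)).trans_eq (Finset.sum_congr rfl fun i _ => eLpNorm_norm _))

/-- The weak derivative is available for J and not for Λ, so ∂ⱼψ is written as (∂ⱼr + i Jⱼ r⁻¹)φ
before differentiating along lines. The term i(∂ⱼr)vⱼφ from the phase cancels -i Jⱼ(∂ⱼr)r⁻²φ from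
r⁻¹, and what remains is square integrable by assumption. -/
theorem IsPhase.hasWeakPartial_waveGradient (hφ : IsPhase r Λ φ) (hr : Continuous r)
    (hr0 : ∀ x, 0 ≤ r x) (h : IsH1 r Dr) (hΛ : MemLp Λ 2)
    (hV : ∀ K : Set Plane, IsCompact K → (vacuum r ∩ K).Finite) {j : Fin 2} {d m : Plane → ℝ}
    (hd : HasWeakPartial (vacuum r)ᶜ j (fun x => Dr x j) d)
    (hm : HasWeakPartial (vacuum r)ᶜ j (fun x => momentum r Λ x j) m)
    (hd2 : MemLp (fun x => Λ x j ^ 2 / r x - d x) 2) (hm2 : MemLp (fun x => m x / r x) 2) :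
    HasWeakPartial univ j (fun x => waveGradient Dr Λ φ x j) (waveSecond r Λ φ j d m) := by
  have h1 := (hφ.memLp_waveGradient_apply h.memLp_grad hΛ j).locallyIntegrable (by norm_num)
  have h2 := (hφ.waveSecond_memLp hd2 hm2).locallyIntegrable (by norm_num)
  refine HasWeakPartial.of_compl hV (HasWeakPartial.of_slices (h1.locallyIntegrableOn _)
    (h2.locallyIntegrableOn _) fun x hx => ?_) h1 h2
  obtain ⟨a, b, hab, hxb, hsub, hs⟩ := hφ.slices x hx
  refine ⟨a, b, hab, hxb, hsub, ?_⟩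
  filter_upwards [hs j, (h.hasWeakPartial j).ae_hasACRep hab (subset_univ _),
    hd.ae_hasACRep hab hsub, hm.ae_hasACRep hab hsub] with s h3 h4 h5 h6 hm
  have hne : ∀ t ∈ Icc (a j) (b j), r (chart j (s, t)) ≠ 0 := fun t ht =>
    hsub (chart_mem_closedBox.2 ⟨Ioo_subset_Icc_self hm, ht⟩)
  -- The closed segment lies off the vacuum, so the continuous function r has a positive minimum on
  -- it.
  have hinv := (h4 hm).inv (hab j)
    (hr.comp ((chart j).continuous.comp (by fun_prop))).continuousOn
    fun t ht => lt_of_le_of_ne (hr0 _) (hne t ht).symm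
  have h7 := ((h5 hm).ofReal.mul (h3 hm)).add
    ((((h6 hm).ofReal.mul hinv.ofReal).mul (h3 hm)).const_mul Complex.I)
  refine h7.congr (Eventually.of_forall fun t ht => ?_) (Eventually.of_forall fun t ht => ?_)
  all_goals
    rw [uIcc_of_le (hab j).le] at ht
    have hne' : (r (chart j (s, t)) : ℂ) ≠ 0 := by exact_mod_cast hne t ht
    have hJ : momentum r Λ (chart j (s, t)) j = r (chart j (s, t)) * Λ (chart j (s, t)) j := rfl
  · simp only [waveGradient, hJ]
    push_cast
    field_simp
  · simp only [waveSecond, velocity_apply, hJ]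
    push_cast
    field_simp
    ring_nf
    rw [Complex.I_sq]
    ring

theorem IsPhase.isH1 (hφ : IsPhase r Λ φ) (h : IsH1 r Dr) (hΛ : MemLp Λ 2)
    (hV : ∀ K : Set Plane, IsCompact K → (vacuum r ∩ K).Finite) :
    IsH1 (fun x => (r x : ℂ) * φ x) (waveGradient Dr Λ φ) :=
  ⟨hφ.memLp_ofReal_mul h.memLp,
    MemLp.of_eval_piLp fun j => hφ.memLp_waveGradient_apply h.memLp_grad hΛ j,
    hφ.hasWeakPartial h hΛ hV⟩

theorem HasWeakPartial.aestronglyMeasurable_deriv {V : Set Plane} {i : Fin 2} {f g : Plane → ℝ}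
    (h : HasWeakPartial Vᶜ i f g) (hV : volume V = 0) : AEStronglyMeasurable g := by
  have := h.locallyIntegrableOn_deriv.aestronglyMeasurable
  have e1 : volume.restrict Vᶜ = (volume : Measure Plane) :=
    Measure.restrict_eq_self_of_ae_mem (measure_eq_zero_iff_ae_notMem.1 hV)
  rwa [e1] at this

/-- The diagonal of the Hessian is explicit; both off-diagonal entries are the single function given
by `exists_mixed_weakPartial`. -/
theorem IsPhase.exists_isH2 (hφ : IsPhase r Λ φ) (hr : Continuous r) (hr0 : ∀ x, 0 ≤ r x)
    (h : IsH1 r Dr) (hΛ : MemLp Λ 2) (hV : ∀ K : Set Plane, IsCompact K → (vacuum r ∩ K).Finite)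
    {M : ℝ≥0} (hM : HasHigherOrderBound r Dr Λ M) :
    ∃ D2 : Plane → EuclideanSpace ℂ (Fin 2 × Fin 2),
      IsH2 (fun x => (r x : ℂ) * φ x) (waveGradient Dr Λ φ) D2 ∧ eLpNorm D2 2 volume ≤ 6 * M := by
  have hnull : volume (vacuum r) = 0 := (countable_of_finite_inter_compact hV).measure_zero _
  have hH1 := hφ.isH1 h hΛ hV
  choose d m hd hm hb using hM.bound
  have hd2 : ∀ j, MemLp (fun x => Λ x j ^ 2 / r x - d j x) 2 := fun j =>
    ⟨(((hΛ.euclidean_apply j).1.pow 2).div₀ hr.aestronglyMeasurable).sub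
      ((hd j).aestronglyMeasurable_deriv hnull),
      (le_self_add.trans (hb j)).trans_lt ENNReal.coe_lt_top⟩
  have hm2 : ∀ j, MemLp (fun x => m j x / r x) 2 := fun j =>
    ⟨((hm j).aestronglyMeasurable_deriv hnull).div₀ hr.aestronglyMeasurable,
      (le_add_self.trans (hb j)).trans_lt ENNReal.coe_lt_top⟩
  have hw2 := fun j => hφ.waveSecond_memLp (hd2 j) (hm2 j)
  have hwn : ∀ j, eLpNorm (waveSecond r Λ φ j (d j) (m j)) 2 volume ≤ M := fun j =>
    (hφ.eLpNorm_waveSecond_le (hd2 j) (hm2 j)).trans (hb j)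
  have hw := fun j => hφ.hasWeakPartial_waveGradient hr hr0 h hΛ hV (hd j) (hm j) (hd2 j) (hm2 j)
  obtain ⟨g, hg, hgn, h01, h10⟩ := exists_mixed_weakPartial hH1.memLp
    (fun j => hφ.memLp_waveGradient_apply h.memLp_grad hΛ j) hw2 hH1.hasWeakPartial hw
  let D2 : Plane → EuclideanSpace ℂ (Fin 2 × Fin 2) := fun x => WithLp.toLp 2 fun p =>
    if p.1 = p.2 then waveSecond r Λ φ p.1 (d p.1) (m p.1) x else g x
  have hD : ∀ i, (fun x => D2 x (i, i)) = waveSecond r Λ φ i (d i) (m i) := fun i =>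
    funext fun x => if_pos rfl
  have hD' : ∀ i j, i ≠ j → (fun x => D2 x (i, j)) = g := fun i j hij => funext fun x => if_neg hij
  have hDm : ∀ p, MemLp (fun x => D2 x p) 2 := by
    rintro ⟨i, j⟩
    by_cases hij : i = j
    · subst hij
      rw [hD]
      exact hw2 i
    · rw [hD' i j hij]
      exact hg
  refine ⟨D2, ⟨hH1, MemLp.of_eval_piLp hDm, ?_⟩, ?_⟩
  · intro i j
    by_cases hij : i = j
    · subst hij
      rw [hD]
      exact hw i
    · rw [hD' i j hij]
      fin_cases i <;> fin_cases j
      · exact absurd rfl hij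
      · exact h01
      · exact h10
      · exact absurd rfl hij
  -- Each diagonal entry contributes at most M and each of the two mixed entries at most 2M, in
  -- total 6M.
  · have hgM : eLpNorm g 2 volume ≤ M + M := hgn.trans (add_le_add (hwn 0) (hwn 1))
    calc eLpNorm D2 2 volume ≤ ∑ p, eLpNorm (fun x => D2 x p) 2 volume :=
          eLpNorm_euclidean_le_sum fun p => (hDm p).1
      _ = eLpNorm (waveSecond r Λ φ 0 (d 0) (m 0)) 2 volume + eLpNorm g 2 volume +
          (eLpNorm g 2 volume + eLpNorm (waveSecond r Λ φ 1 (d 1) (m 1)) 2 volume) := by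
        rw [Fintype.sum_prod_type, Fin.sum_univ_two, Fin.sum_univ_two, Fin.sum_univ_two, hD, hD,
          hD' 0 1 (by simp), hD' 1 0 (by simp)]
      _ ≤ M + (M + M) + ((M + M) + M) :=
        add_le_add (add_le_add (hwn 0) hgM) (add_le_add hgM (hwn 1))
      _ = 6 * M := by ring

end WaveFunction

theorem proposition3p1 :
    ∃ C : ℝ≥0 → ℝ≥0 → ℝ≥0,
      ∀ (M₁ : ℝ≥0) (r : Plane → ℝ) (Dr Λ : Plane → Plane),
        (∀ x, 0 ≤ r x) →
        IsH1 r Dr →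
        MemLp Λ 2 volume →
        normH1 r Dr + eLpNorm Λ 2 volume ≤ M₁ →
        Continuous r →
        HasSeparatedPointVacuum r →
        HasQuantisedVorticity r Λ →
        ∃ (ψ : Plane → ℂ) (Dψ : Plane → EuclideanSpace ℂ (Fin 2)),
          IsH1 ψ Dψ ∧
          (∀ᵐ x, r x = ‖ψ x‖) ∧
          (∃ φ ∈ polarFactors ψ,
            ∀ᵐ x, ∀ j : Fin 2, Λ x j = ((starRingEnd ℂ) (φ x) * Dψ x j).im) ∧
          ∀ M₂ : ℝ≥0, HasHigherOrderBound r Dr Λ M₂ →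
            ∃ D2ψ : Plane → EuclideanSpace ℂ (Fin 2 × Fin 2),
              IsH2 ψ Dψ D2ψ ∧ normH2 ψ Dψ D2ψ ≤ C M₁ M₂ := by
  -- M₁ bounds the H¹ part, since ‖ψ‖ = ‖√ρ‖ and ‖∇ψ‖ ≤ ‖∇√ρ‖ + ‖Λ‖ in L²; 6M₂ bounds the Hessian.
  refine ⟨fun M₁ M₂ => M₁ + 6 * M₂, fun M₁ r Dr Λ hr0 h hΛ hM hr hsep hq => ?_⟩
  obtain ⟨α, hα, hsep⟩ := hsep
  have hV : ∀ K : Set Plane, IsCompact K → (vacuum r ∩ K).Finite := fun K hK =>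
    finite_inter_of_separated hα hsep hK
  obtain ⟨φ, hφm, hφ1, hφs⟩ := hq.exists_phase hr (hΛ.locallyIntegrable (by norm_num)) hV
  have hφ : IsPhase r Λ φ := ⟨hφm, hφ1, hφs⟩
  have hnorm : ∀ x, ‖(r x : ℂ) * φ x‖ = r x := fun x => by
    rw [norm_mul, hφ1, mul_one, Complex.norm_real, Real.norm_of_nonneg (hr0 x)]
  have hφn : eLpNorm φ ⊤ volume ≤ 1 := by
    rw [eLpNorm_exponent_top]
    exact eLpNormEssSup_le_of_ae_enorm_bound (Eventually.of_forall fun x => by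
      rw [← ofReal_norm, hφ1, ENNReal.ofReal_one])
  refine ⟨fun x => (r x : ℂ) * φ x, waveGradient Dr Λ φ, hφ.isH1 h hΛ hV,
    Eventually.of_forall fun x => (hnorm x).symm, ⟨φ, ⟨⟨hφm, hφn.trans_lt ENNReal.one_lt_top⟩, hφn,
      Eventually.of_forall fun x => by rw [hnorm]⟩, Eventually.of_forall fun x j => ?_⟩,
    fun M₂ hM₂ => ?_⟩
  · have h1 : (starRingEnd ℂ) (φ x) * φ x = 1 := by
      rw [mul_comm, Complex.mul_conj, Complex.normSq_eq_norm_sq, hφ1]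
      simp
    have h2 : (starRingEnd ℂ) (φ x) * waveGradient Dr Λ φ x j = Dr x j + Complex.I * Λ x j := by
      simp only [waveGradient]
      rw [mul_left_comm, h1, mul_one]
    rw [h2]
    simp
  · obtain ⟨D2, hD2, hD2n⟩ := hφ.exists_isH2 hr hr0 h hΛ hV hM₂
    refine ⟨D2, hD2, ?_⟩
    have h1 : eLpNorm (fun x => (r x : ℂ) * φ x) 2 volume = eLpNorm r 2 volume :=
      eLpNorm_congr_norm_ae (Eventually.of_forall fun x => by
        rw [hnorm, Real.norm_of_nonneg (hr0 x)])
    have h2 := hφ.eLpNorm_waveGradient_le h.memLp_grad hΛ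
    rw [normH2, h1]
    push_cast
    refine add_le_add (le_trans ?_ hM) hD2n
    rw [normH1, add_assoc]
    exact add_le_add le_rfl h2
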